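/- **Theorem (Comparison).** Let $S$ be a locally Noetherian scheme and $f\colon X\to S$ a separated morphism of finite type. For a locally Noetherian $S$-scheme $T$ put $X_T:=X\times_S T$, let $f_T\colon X_T\to T$ be the projection, and let $\operatorname{Pic}_{X/S}(T):=\operatorname{Pic}(X_T)/f_T^*\operatorname{Pic}(T)$; this defines a functor $\operatorname{Pic}_{X/S}$ from locally Noetherian $S$-schemes to abelian groups. Denote its associated sheaves in the Zariski, étale and fppf topologies by $\operatorname{Pic}_{(X/S)\mathrm{zar}}$, $\operatorname{Pic}_{(X/S)\mathrm{\acute et}}$ and $\operatorname{Pic}_{(X/S)\mathrm{fppf}}$. Assume that $\mathcal O_S\to f_*\mathcal O_X$ is an isomorphism universally, that is, for every locally Noetherian $S$-scheme $T$ the comorphism $\mathcal O_T\to f_{T*}\mathcal O_{X_T}$ is an isomorphism. Consider the natural maps $$\operatorname{Pic}_{X/S}\longrightarrow\operatorname{Pic}_{(X/S)\mathrm{zar}}\longrightarrow\operatorname{Pic}_{(X/S)\mathrm{\acute et}}\longrightarrow\operatorname{Pic}_{(X/S)\mathrm{fppf}}.$$ 1. All three maps are injective (on $T$-points, for every locally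 Noetherian $S$-scheme $T$). 2. All three maps are isomorphisms if $f$ has a section. The last two maps are isomorphisms if $f$ has a section locally in the Zariski topology, that is, if $S$ has a covering by jointly surjective open immersions $U_i\to S$ such that each base change $X_{U_i}\to U_i$ has a section. The last map is an isomorphism if $f$ has a section locally in the étale topology, that is, if $S$ has a covering by jointly surjective étale morphisms $U_i\to S$ such that each base change $X_{U_i}\to U_i$ has a section. -/

import Mathlib

open CategoryTheory MonoidalCategory AlgebraicGeometry Opposite Limits TopologicalSpace

universe u

namespace PicardFunctor

section
variable {C : Type u} [SmallCategory C] {R : Cᵒᵖ ⥤ RingCat.{u}}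

/-! ### Natural transformations between cocontinuous functors on presheaves of modules -/

theorem isIso_app_of_isColimit {A D J : Type*} [Category A] [Category D] [Category J]
    {G H : A ⥤ D} (τ : G ⟶ H) {K : J ⥤ A} {c : Cocone K} (hc : IsColimit c)
    [PreservesColimit K G] [PreservesColimit K H] (h : ∀ j, IsIso (τ.app (K.obj j))) :
    IsIso (τ.app c.pt) := by
  have : ∀ j, IsIso ((Functor.whiskerLeft K τ).app j) := h
  have : IsIso (Functor.whiskerLeft K τ) := NatIso.isIso_of_isIso_app _
  have e : τ.app c.pt = ((isColimitOfPreserves G hc).coconePointsIsoOfNatIso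
      (isColimitOfPreserves H hc) (asIso (Functor.whiskerLeft K τ))).hom := by
    refine (isColimitOfPreserves G hc).hom_ext fun j => ?_
    rw [IsColimit.comp_coconePointsIsoOfNatIso_hom]
    exact τ.naturality (c.ι.app j)
  rw [e]
  infer_instance

theorem isIso_app_of_free {D : Type*} [Category D]
    {G H : PresheafOfModules.{u} R ⥤ D} (τ : G ⟶ H)
    [PreservesColimitsOfSize.{u, u} G] [PreservesColimitsOfSize.{u, u} H]
    (h : ∀ U : C, IsIso (τ.app ((PresheafOfModules.free R).obj (yoneda.obj U))))
    (M : PresheafOfModules.{u} R) : IsIso (τ.app M) := by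
  have hco : ∀ N : PresheafOfModules.{u} R, IsIso (τ.app N.freeYonedaCoproduct) := fun N =>
    isIso_app_of_isColimit τ (colimit.isColimit (Discrete.functor
      (PresheafOfModules.Elements.freeYoneda (M := N)))) (fun j => h _)
  have : PreservesColimitsOfSize.{0, 0} G := preservesColimitsOfSize_shrink.{0, u, 0, u} G
  have : PreservesColimitsOfSize.{0, 0} H := preservesColimitsOfSize_shrink.{0, u, 0, u} H
  refine isIso_app_of_isColimit τ M.isColimitFreeYonedaCoproductsCokernelCofork ?_
  rintro (_ | _)
  · exact hco _
  · exact hco _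
end

section
variable {X : TopCat.{u}} (R : (Opens X)ᵒᵖ ⥤ CommRingCat.{u})

/-- Presheaves of modules over a presheaf of commutative rings on a topological space. -/
abbrev PMod := PresheafOfModules.{u} (R ⋙ forget₂ CommRingCat RingCat)

variable {R}
/-- A morphism of presheaves of modules is a local isomorphism if it becomes an isomorphism
after sheafification of the underlying presheaves. -/
abbrev IsLocIso {M N : PMod R} (f : M ⟶ N) : Prop :=
  (Opens.grothendieckTopology X).W ((PresheafOfModules.toPresheaf _).map f)

theorem isLocIso_iff {M N : PMod R} (f : M ⟶ N) : IsLocIso f ↔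
    (∀ (U : Opens X) (m : M.obj (op U)), f.app (op U) m = 0 → ∀ x ∈ U,
      ∃ (V : Opens X) (i : V ⟶ U), x ∈ V ∧ M.presheaf.map i.op m = 0) ∧
    (∀ (U : Opens X) (n : N.obj (op U)), ∀ x ∈ U,
      ∃ (V : Opens X) (i : V ⟶ U), x ∈ V ∧ ∃ m : M.obj (op V),
        f.app (op V) m = N.presheaf.map i.op n) := by
  rw [IsLocIso, GrothendieckTopology.W_iff_isLocallyBijective]
  refine and_congr ⟨fun h U m hm x hx => ?_, fun h => ⟨?_⟩⟩
    ⟨fun h U n x hx => ?_, fun h => ⟨?_⟩⟩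
  · obtain ⟨V, i, hi, hV⟩ := h.equalizerSieve_mem (X := op U) m 0 (hm.trans (map_zero _).symm) x hx
    exact ⟨V, i, hV, Eq.trans hi (map_zero (M.presheaf.map i.op).hom)⟩
  · rintro ⟨U⟩ m m' hm x hx
    have : f.app (op U) (show M.obj (op U) from (m : M.presheaf.obj (op U)) - m') = 0 := by
      refine (map_sub (f.app (op U)).hom m m').trans ?_
      exact sub_eq_zero.2 hm
    obtain ⟨V, i, hV, hi⟩ := h U _ this x hx
    refine ⟨V, i, ?_, hV⟩
    exact sub_eq_zero.1 ((map_sub (M.presheaf.map i.op).hom m m').symm.trans hi)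
  · obtain ⟨V, i, hi, hV⟩ := h.imageSieve_mem (U := U) n x hx
    exact ⟨V, i, hV, hi⟩
  · intro U n x hx
    obtain ⟨V, i, hV, hi⟩ := h U n x hx
    exact ⟨V, i, hi, hV⟩

end

section
variable {X : TopCat.{u}} {R : (Opens X)ᵒᵖ ⥤ CommRingCat.{u}}

/-- Restriction of sections of a presheaf of modules. -/
noncomputable def res (M : PMod R) {U V : Opens X} (i : V ⟶ U) (m : M.obj (op U)) : M.obj (op V) :=
  M.presheaf.map i.op m

theorem presheaf_map_tmul (M N : PMod R) {U V : Opens X} (i : V ⟶ U)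
    (m : M.obj (op U)) (n : N.obj (op U)) :
    (M ⊗ N : PMod R).presheaf.map i.op (m ⊗ₜ[R.obj (op U)] n : TensorProduct _ _ _) =
      (res M i m ⊗ₜ[R.obj (op V)] res N i n : TensorProduct _ _ _) := rfl

theorem whiskerRight_tmul {M N : PMod R} (f : M ⟶ N) (L : PMod R) {U : Opens X}
    (m : M.obj (op U)) (l : L.obj (op U)) :
    (f ▷ L).app (op U) (m ⊗ₜ[R.obj (op U)] l : TensorProduct _ _ _) =
      (f.app (op U) m ⊗ₜ[R.obj (op U)] l : TensorProduct _ _ _) := rfl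

theorem app_presheaf_map {M N : PMod R} (f : M ⟶ N) {U V : Opens X} (i : V ⟶ U)
    (m : M.obj (op U)) :
    f.app (op V) (M.presheaf.map i.op m : M.obj (op V)) =
      (N.presheaf.map i.op (f.app (op U) m : N.obj (op U)) : N.obj (op V)) :=
  ConcreteCategory.congr_hom (((PresheafOfModules.toPresheaf _).map f).naturality i.op) m

theorem presheaf_map_map (M : PMod R) {U V W : Opens X} (i : V ⟶ U) (j : W ⟶ V)
    (m : M.obj (op U)) :
    M.presheaf.map j.op (M.presheaf.map i.op m) = M.presheaf.map (j ≫ i).op m := by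
  rw [op_comp, Functor.map_comp]; rfl

theorem locSurj_tensor {M N : PMod R} (f : M ⟶ N) (hf : IsLocIso f) (L : PMod R)
    (U : Opens X) (t : (N ⊗ L : PMod R).obj (op U)) (x : X) (hx : x ∈ U) :
    ∃ (V : Opens X) (i : V ⟶ U), x ∈ V ∧ ∃ m : (M ⊗ L : PMod R).obj (op V),
        (f ▷ L).app (op V) m = (N ⊗ L : PMod R).presheaf.map i.op t := by
  induction t using TensorProduct.induction_on with
  | zero =>
    refine ⟨U, 𝟙 U, hx, 0, (map_zero ((f ▷ L).app (op U)).hom).trans ?_⟩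
    exact (map_zero ((N ⊗ L : PMod R).presheaf.map (𝟙 U).op).hom).symm
  | tmul n l =>
    obtain ⟨V, i, hV, m, hm⟩ := ((isLocIso_iff f).1 hf).2 U n x hx
    refine ⟨V, i, hV, TensorProduct.tmul (R.obj (op V)) m (L.presheaf.map i.op l : L.obj (op V)), ?_⟩
    refine (whiskerRight_tmul f L m _).trans ?_
    rw [hm]
    rfl
  | add t s ht hs =>
    obtain ⟨V, i, hV, m, hm⟩ := ht
    obtain ⟨W, j, hW, n, hn⟩ := hs
    refine ⟨V ⊓ W, homOfLE (inf_le_left.trans (leOfHom i)), ⟨hV, hW⟩,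
      ((M ⊗ L : PMod R).presheaf.map (homOfLE inf_le_left : V ⊓ W ⟶ V).op m :
        (M ⊗ L : PMod R).obj (op (V ⊓ W))) +
      ((M ⊗ L : PMod R).presheaf.map (homOfLE inf_le_right : V ⊓ W ⟶ W).op n :
        (M ⊗ L : PMod R).obj (op (V ⊓ W))), ?_⟩
    refine (map_add ((f ▷ L).app (op (V ⊓ W))).hom _ _).trans ?_
    refine Eq.trans ?_ (map_add ((N ⊗ L : PMod R).presheaf.map _).hom _ _).symm
    refine congrArg₂ (· + ·) ?_ ?_
    · refine (app_presheaf_map (f ▷ L) _ m).trans ?_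
      rw [hm]
      exact presheaf_map_map (N ⊗ L : PMod R) i (homOfLE inf_le_left : V ⊓ W ⟶ V) t
    · refine (app_presheaf_map (f ▷ L) _ n).trans ?_
      rw [hn]
      exact presheaf_map_map (N ⊗ L : PMod R) j (homOfLE inf_le_right : V ⊓ W ⟶ W) s

/-- The free presheaf of modules on one generator over the open set `U`. -/
noncomputable abbrev freeY (R : (Opens X)ᵒᵖ ⥤ CommRingCat.{u}) (U : Opens X) : PMod R :=
  (PresheafOfModules.free (R ⋙ forget₂ CommRingCat RingCat)).obj (yoneda.obj U)

theorem isLocIso_whiskerRight_free {M N : PMod R} (f : M ⟶ N) (hf : IsLocIso f) (W : Opens X) :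
    IsLocIso (f ▷ freeY R W) := by
  refine (isLocIso_iff _).2 ⟨fun U t ht x hx => ?_, fun U t x hx => locSurj_tensor f hf _ U t x hx⟩
  have key : ∀ (A : PMod R), ∀ h : U ⟶ W,
      Function.Injective (fun a : A.obj (op U) =>
        (a ⊗ₜ[R.obj (op U)] (Finsupp.single h 1 : (U ⟶ W) →₀ R.obj (op U)) :
          TensorProduct (R.obj (op U)) (A.obj (op U)) ((U ⟶ W) →₀ R.obj (op U)))) := by
    intro A h a b hab
    have := congrArg (fun z => TensorProduct.rid (R.obj (op U)) (A.obj (op U))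
      (LinearMap.lTensor (A.obj (op U)) (Finsupp.lapply h :
        ((U ⟶ W) →₀ R.obj (op U)) →ₗ[R.obj (op U)] R.obj (op U)) z)) hab
    simpa using this
  have gen : ∀ t : TensorProduct (R.obj (op U)) (M.obj (op U)) ((U ⟶ W) →₀ R.obj (op U)),
      t = 0 ∨ ∃ (h : U ⟶ W) (m : M.obj (op U)),
        t = m ⊗ₜ[R.obj (op U)] (Finsupp.single h 1 : (U ⟶ W) →₀ R.obj (op U)) := by
    intro t
    by_cases hUW : Nonempty (U ⟶ W)
    · obtain ⟨h⟩ := hUW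
      right
      refine ⟨h, ?_⟩
      induction t using TensorProduct.induction_on with
      | zero => exact ⟨0, (TensorProduct.zero_tmul _ _).symm⟩
      | tmul m l =>
        refine ⟨l h • m, ?_⟩
        rw [TensorProduct.smul_tmul]
        congr 1
        ext h'
        obtain rfl : h' = h := Subsingleton.elim _ _
        simp
      | add s t hs ht =>
        obtain ⟨m, rfl⟩ := hs
        obtain ⟨n, rfl⟩ := ht
        exact ⟨m + n, (TensorProduct.add_tmul _ _ _).symm⟩
    · left
      have : IsEmpty (U ⟶ W) := not_nonempty_iff.1 hUW
      have : Subsingleton ((U ⟶ W) →₀ R.obj (op U)) := inferInstance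
      induction t using TensorProduct.induction_on with
      | zero => rfl
      | tmul m l => rw [Subsingleton.elim l 0, TensorProduct.tmul_zero]
      | add s t hs ht => rw [hs, ht, add_zero]
  rcases gen t with rfl | ⟨h, m, rfl⟩
  · exact ⟨U, 𝟙 U, hx, map_zero ((M ⊗ freeY R W : PMod R).presheaf.map (𝟙 U).op).hom⟩
  · have h0 : f.app (op U) m = 0 := by
      refine key N h ?_
      refine Eq.trans ht ?_
      exact (TensorProduct.zero_tmul _ _).symm
    obtain ⟨V, i, hV, hi⟩ := ((isLocIso_iff f).1 hf).1 U m h0 x hx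
    refine ⟨V, i, hV, (presheaf_map_tmul M (freeY R W) i m _).trans ?_⟩
    rw [show res M i m = 0 from hi]
    exact TensorProduct.zero_tmul _ _
end

section
variable (X : Scheme.{u})

/-- The associated sheaf of modules. -/
noncomputable def sheafification : PMod X.presheaf ⥤ X.Modules :=
  (PresheafOfModules.sheafification (𝟙 X.ringCatSheaf.obj) : X.PresheafOfModules ⥤ X.Modules)

/-- The underlying presheaf of modules. -/
noncomputable def toPMod : X.Modules ⥤ PMod X.presheaf :=
  SheafOfModules.forget X.ringCatSheaf

/-- Sheafification is left adjoint to the inclusion. -/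
noncomputable def sheafificationAdj : sheafification X ⊣ toPMod X :=
  PresheafOfModules.sheafificationAdjunction (𝟙 X.ringCatSheaf.obj)

instance : IsIso (sheafificationAdj X).counit :=
  inferInstanceAs (IsIso
    (PresheafOfModules.sheafificationAdjunction (𝟙 X.ringCatSheaf.obj)).counit)

instance : (sheafification X).IsLeftAdjoint := (sheafificationAdj X).isLeftAdjoint

variable {X}

theorem isIso_sheafification_map_iff {M N : PMod X.presheaf} (f : M ⟶ N) :
    IsIso ((sheafification X).map f) ↔ IsLocIso f := by
  have := PresheafOfModules.inverseImage_W_toPresheaf_eq_inverseImage_isomorphisms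
    (𝟙 X.ringCatSheaf.obj)
  exact (iff_of_eq (congrFun (congrFun (congrFun (congrArg (fun P => P) this) M) N) f)).symm

instance isIso_sheafification_map_unit (M : PMod X.presheaf) :
    IsIso ((sheafification X).map ((sheafificationAdj X).unit.app M)) := by
  have h := (sheafificationAdj X).left_triangle_components M
  exact IsIso.of_isIso_fac_right h

theorem isIso_sheafification_whiskerRight {M N : PMod X.presheaf} (f : M ⟶ N)
    (hf : IsIso ((sheafification X).map f)) (L : PMod X.presheaf) :
    IsIso ((sheafification X).map (f ▷ L)) := by
  let τ : tensorLeft M ⋙ sheafification X ⟶ tensorLeft N ⋙ sheafification X :=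
    Functor.whiskerRight ((tensoringLeft (PMod X.presheaf)).map f) (sheafification X)
  have : PreservesColimitsOfSize.{u, u} (sheafification X) :=
    (sheafificationAdj X).leftAdjoint_preservesColimits
  exact isIso_app_of_free τ (fun U => (isIso_sheafification_map_iff _).2
    (isLocIso_whiskerRight_free f ((isIso_sheafification_map_iff _).1 hf) U)) L

theorem isIso_sheafification_whiskerLeft {M N : PMod X.presheaf} (f : M ⟶ N)
    (hf : IsIso ((sheafification X).map f)) (L : PMod X.presheaf) :
    IsIso ((sheafification X).map (L ◁ f)) := by
  have := isIso_sheafification_whiskerRight f hf L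
  have h : L ◁ f = (β_ L M).hom ≫ f ▷ L ≫ (β_ L N).inv := by simp
  rw [h, Functor.map_comp, Functor.map_comp]
  infer_instance

/-- The tensor product of `𝒪_X`-modules: the sheaf associated to the presheaf
`U ↦ M(U) ⊗ N(U)`, the tensor product being taken over `𝒪_X(U)`. -/
noncomputable def tensor (M N : X.Modules) : X.Modules :=
  (sheafification X).obj ((toPMod X).obj M ⊗ (toPMod X).obj N)

variable (X) in
/-- The structure sheaf `𝒪_X` as a module over itself. -/
noncomputable def structureSheaf : X.Modules := SheafOfModules.unit X.ringCatSheaf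

/-- A sheaf of modules is its own sheafification. -/
noncomputable def sheafificationObjIso (M : X.Modules) :
    (sheafification X).obj ((toPMod X).obj M) ≅ M :=
  asIso ((sheafificationAdj X).counit.app M)

/-- The tensor product respects isomorphisms. -/
noncomputable def tensorCongr {M M' N N' : X.Modules} (e : M ≅ M') (e' : N ≅ N') : tensor M N ≅ tensor M' N' :=
  (sheafification X).mapIso ((toPMod X).mapIso e ⊗ᵢ (toPMod X).mapIso e')

/-- Sheafification is compatible with tensor products. -/
noncomputable def sheafificationTensor (P Q : PMod X.presheaf) :
    (sheafification X).obj (P ⊗ Q) ≅ tensor ((sheafification X).obj P) ((sheafification X).obj Q) :=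
  @asIso _ _ _ _ _ (isIso_sheafification_whiskerRight _ (isIso_sheafification_map_unit P) Q) ≪≫
    @asIso _ _ _ _ _ (isIso_sheafification_whiskerLeft _ (isIso_sheafification_map_unit Q)
      ((toPMod X).obj ((sheafification X).obj P)))

/-- Commutativity of the tensor product. -/
noncomputable def tensorComm (M N : X.Modules) : tensor M N ≅ tensor N M :=
  (sheafification X).mapIso (β_ _ _)

/-- The structure sheaf is neutral for the tensor product. -/
noncomputable def unitTensor (M : X.Modules) : tensor (structureSheaf X) M ≅ M :=
  (sheafification X).mapIso (λ_ ((toPMod X).obj M)) ≪≫ sheafificationObjIso M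

/-- Associativity of the tensor product. -/
noncomputable def tensorAssoc (M N P : X.Modules) :
    tensor (tensor M N) P ≅ tensor M (tensor N P) :=
  tensorCongr (Iso.refl _) (sheafificationObjIso P).symm ≪≫
    (sheafificationTensor _ _).symm ≪≫ (sheafification X).mapIso (α_ _ _ _) ≪≫
    sheafificationTensor _ _ ≪≫ tensorCongr (sheafificationObjIso M) (Iso.refl _)

end

section
variable {X : TopCat.{u}} {R : (Opens X)ᵒᵖ ⥤ CommRingCat.{u}}

/-- A section `x` over `U` freely generates `A` if morphisms out of `A` correspond to sections
over `U` by evaluation at `x`. -/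
def IsGen {A : PMod R} {U : Opens X} (x : A.obj (op U)) : Prop :=
  ∀ K : PMod R, Function.Bijective (fun φ : A ⟶ K => (φ.app (op U) x : K.obj (op U)))

theorem IsGen.isIso {A B : PMod R} {U : Opens X} {x : A.obj (op U)} {y : B.obj (op U)}
    (hx : IsGen x) (hy : IsGen y) (φ : A ⟶ B) (h : φ.app (op U) x = y) : IsIso φ := by
  obtain ⟨ψ, hψ⟩ := (hy A).2 x
  replace hψ : ψ.app (op U) y = x := hψ
  refine ⟨ψ, (hx A).1 ?_, (hy B).1 ?_⟩
  · change ψ.app (op U) (φ.app (op U) x) = x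
    rw [h, hψ]
  · change φ.app (op U) (ψ.app (op U) y) = y
    rw [hψ, h]

theorem IsGen.of_isIso {A B : PMod R} {U : Opens X} {x : A.obj (op U)} (hx : IsGen x)
    (φ : A ⟶ B) [IsIso φ] : IsGen (φ.app (op U) x : B.obj (op U)) := by
  intro K
  have : Function.Bijective (fun ψ : B ⟶ K => φ ≫ ψ) :=
    ⟨fun a b h => (cancel_epi φ).1 h, fun a => ⟨inv φ ≫ a, by simp⟩⟩
  exact (hx K).comp this

/-- The generator of `freeY R U`. -/
noncomputable def freeGen (R : (Opens X)ᵒᵖ ⥤ CommRingCat.{u}) (U : Opens X) : (freeY R U).obj (op U) :=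
  ModuleCat.freeMk (𝟙 U)

theorem isGen_freeGen (U : Opens X) : IsGen (freeGen R U) := by
  intro K
  exact (PresheafOfModules.freeYonedaEquiv (M := K) (X := U)).bijective

theorem res_freeGen {U V : Opens X} (i : V ⟶ U) :
    res (freeY R U) i (freeGen R U) = (Finsupp.single i 1 : (V ⟶ U) →₀ R.obj (op V)) := by
  refine Eq.trans (b := (PresheafOfModules.freeObj (R := R ⋙ forget₂ CommRingCat RingCat)
    (yoneda.obj U)).map i.op (ModuleCat.freeMk (𝟙 U))) rfl ?_
  rw [PresheafOfModules.freeObj_map]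
  refine (ModuleCat.freeDesc_apply (R := (R ⋙ forget₂ CommRingCat RingCat).obj (op U))
    (M := (ModuleCat.restrictScalars ((R ⋙ forget₂ CommRingCat RingCat).map i.op).hom).obj
      ((ModuleCat.free _).obj _)) _ (𝟙 U)).trans ?_
  exact congrArg (ModuleCat.freeMk (R := R.obj (op V))) (Category.comp_id i)

theorem app_res {M N : PMod R} (f : M ⟶ N) {U V : Opens X} (i : V ⟶ U)
    (m : M.obj (op U)) : f.app (op V) (res M i m) = res N i (f.app (op U) m) :=
  app_presheaf_map f i m

/-- The tensor product of two sections, over the intersection of their domains. -/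
noncomputable def tmulGen {A B : PMod R} {U V : Opens X} (x : A.obj (op U)) (y : B.obj (op V)) :
    (A ⊗ B : PMod R).obj (op (U ⊓ V)) :=
  (res A (homOfLE inf_le_left) x ⊗ₜ[R.obj (op (U ⊓ V))] res B (homOfLE inf_le_right) y :
    TensorProduct _ _ _)

theorem res_tmulGen {A B : PMod R} {U V W : Opens X} (x : A.obj (op U)) (y : B.obj (op V))
    (i : W ⟶ U ⊓ V) (iU : W ⟶ U) (iV : W ⟶ V) :
    res (A ⊗ B : PMod R) i (tmulGen x y) =
      (res A iU x ⊗ₜ[R.obj (op W)] res B iV y : TensorProduct _ _ _) := by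
  refine (presheaf_map_tmul A B i _ _).trans ?_
  have hA : res A i (res A (homOfLE inf_le_left : U ⊓ V ⟶ U) x) = res A iU x :=
    presheaf_map_map A _ _ x
  have hB : res B i (res B (homOfLE inf_le_right : U ⊓ V ⟶ V) y) = res B iV y :=
    presheaf_map_map B _ _ y
  rw [hA, hB]

theorem isGen_tmulGen_free (U V : Opens X) :
    IsGen (tmulGen (freeGen R U) (freeGen R V)) := by
  obtain ⟨e, he⟩ := (isGen_freeGen (R := R) (U ⊓ V) (freeY R U ⊗ freeY R V)).2
    (tmulGen (freeGen R U) (freeGen R V))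
  replace he : e.app (op (U ⊓ V)) (freeGen R (U ⊓ V)) = tmulGen (freeGen R U) (freeGen R V) := he
  suffices IsIso e from he ▸ (isGen_freeGen (U ⊓ V)).of_isIso e
  suffices h : ∀ W, IsIso (e.app W) from
    (PresheafOfModules.isoMk (fun W => @asIso _ _ _ _ _ (h W)) (fun _ _ _ => e.naturality _)).isIso_hom
  rintro ⟨W⟩
  let σ : (W ⟶ U ⊓ V) ≃ (W ⟶ U) × (W ⟶ V) :=
    { toFun := fun i => (i ≫ homOfLE inf_le_left, i ≫ homOfLE inf_le_right)
      invFun := fun p => homOfLE (le_inf (leOfHom p.1) (leOfHom p.2))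
      left_inv := fun _ => Subsingleton.elim _ _
      right_inv := fun _ => Subsingleton.elim _ _ }
  let E : ((W ⟶ U ⊓ V) →₀ R.obj (op W)) ≃ₗ[R.obj (op W)]
      TensorProduct (R.obj (op W)) ((W ⟶ U) →₀ R.obj (op W)) ((W ⟶ V) →₀ R.obj (op W)) :=
    (Finsupp.domLCongr σ).trans (finsuppTensorFinsupp' (R.obj (op W)) (W ⟶ U) (W ⟶ V)).symm
  have hE : (e.app (op W)).hom = E.toLinearMap := by
    refine Finsupp.lhom_ext' fun i => LinearMap.ext_ring ?_
    have h1 : e.app (op W) (Finsupp.single i 1 : (W ⟶ U ⊓ V) →₀ R.obj (op W)) =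
        (Finsupp.single (i ≫ homOfLE inf_le_left : W ⟶ U) 1 ⊗ₜ[R.obj (op W)]
          Finsupp.single (i ≫ homOfLE inf_le_right : W ⟶ V) 1 : TensorProduct _
            ((W ⟶ U) →₀ R.obj (op W)) ((W ⟶ V) →₀ R.obj (op W))) := by
      rw [← res_freeGen, app_res, he,
        res_tmulGen _ _ i (i ≫ homOfLE inf_le_left) (i ≫ homOfLE inf_le_right),
        res_freeGen, res_freeGen]
      rfl
    refine Eq.trans h1 (Eq.symm ?_)
    refine ((finsuppTensorFinsupp' (R.obj (op W)) (W ⟶ U) (W ⟶ V)).symm_apply_eq.2 ?_)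
    rw [finsuppTensorFinsupp'_single_tmul_single, one_mul]
    exact Finsupp.domLCongr_single σ i 1
  have h2 : Function.Bijective (e.app (op W)).hom := by
    rw [hE]
    exact E.bijective
  exact (ConcreteCategory.isIso_iff_bijective (e.app (op W))).2 h2

theorem isGen_tmulGen {A B : PMod R} {U V : Opens X} {x : A.obj (op U)} {y : B.obj (op V)}
    (hx : IsGen x) (hy : IsGen y) : IsGen (tmulGen x y) := by
  obtain ⟨a, ha⟩ := (isGen_freeGen (R := R) U A).2 x
  obtain ⟨b, hb⟩ := (isGen_freeGen (R := R) V B).2 y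
  have := (isGen_freeGen U).isIso hx a ha
  have := (isGen_freeGen V).isIso hy b hb
  have h := (isGen_tmulGen_free (R := R) U V).of_isIso (a ⊗ₘ b)
  have e : (a ⊗ₘ b).app (op (U ⊓ V)) (tmulGen (freeGen R U) (freeGen R V)) = tmulGen x y := by
    subst ha hb
    refine Eq.trans (b := TensorProduct.tmul (R.obj (op (U ⊓ V)))
      (a.app (op (U ⊓ V)) (res (freeY R U) (homOfLE inf_le_left) (freeGen R U)))
      (b.app (op (U ⊓ V)) (res (freeY R V) (homOfLE inf_le_right) (freeGen R V)))) rfl ?_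
    rw [app_res, app_res]
    rfl
  exact e ▸ h

end
section
variable {X Y : TopCat.{u}} (f : X ⟶ Y) {R : (Opens X)ᵒᵖ ⥤ CommRingCat.{u}} {S : (Opens Y)ᵒᵖ ⥤ CommRingCat.{u}} (φ : S ⟶ (Opens.map f).op ⋙ R)

/-- The morphism of presheaves of rings underlying a morphism of presheaves of commutative rings. -/
def ringHom : S ⋙ forget₂ CommRingCat RingCat ⟶ (Opens.map f).op ⋙ (R ⋙ forget₂ CommRingCat RingCat) :=
  Functor.whiskerRight φ (forget₂ CommRingCat RingCat)

/-- Pushforward of presheaves of modules. -/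
noncomputable def pushforwardP : PMod R ⥤ PMod S :=
  PresheafOfModules.pushforward (ringHom f φ)

/-- Pullback of presheaves of modules. -/
noncomputable def pullbackP : PMod S ⥤ PMod R :=
  PresheafOfModules.pullback (ringHom f φ)

/-- The adjunction between pullback and pushforward of presheaves of modules. -/
noncomputable def adjP : pullbackP f φ ⊣ pushforwardP f φ :=
  PresheafOfModules.pullbackPushforwardAdjunction (ringHom f φ)

/-- The map `f_* K ⊗ f_* L → f_* (K ⊗ L)` on sections over `U`, as a linear map. -/
noncomputable def pushMuApp (K L : PMod R) (U : Opens Y) :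
    TensorProduct (S.obj (op U)) (((pushforwardP f φ).obj K).obj (op U)) (((pushforwardP f φ).obj L).obj (op U)) →ₗ[S.obj (op U)] (((pushforwardP f φ).obj (K ⊗ L : PMod R)).obj (op U)) :=
  TensorProduct.lift
   (LinearMap.mk₂ _ (fun k l => (TensorProduct.tmul (R.obj (op ((Opens.map f).obj U))) (M := K.obj (op ((Opens.map f).obj U))) (N := L.obj (op ((Opens.map f).obj U))) k l))
    (fun _ _ _ => TensorProduct.add_tmul _ _ _)
    (fun a k l => (TensorProduct.smul_tmul' (R := R.obj (op ((Opens.map f).obj U))) (R' := R.obj (op ((Opens.map f).obj U))) (M := K.obj (op ((Opens.map f).obj U))) (N := L.obj (op ((Opens.map f).obj U))) (φ.app (op U) a) k l).symm)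
    (fun _ _ _ => TensorProduct.tmul_add _ _ _)
    (fun a k l => TensorProduct.tmul_smul (R := R.obj (op ((Opens.map f).obj U))) (R' := R.obj (op ((Opens.map f).obj U))) (M := K.obj (op ((Opens.map f).obj U))) (N := L.obj (op ((Opens.map f).obj U))) (φ.app (op U) a) k l))

/-- The map `f_* K ⊗ f_* L → f_* (K ⊗ L)` on sections over `U`. -/
noncomputable def pushMuHom (K L : PMod R) (U : Opens Y) :
    ((pushforwardP f φ).obj K ⊗ (pushforwardP f φ).obj L : PMod S).obj (op U) ⟶
      ((pushforwardP f φ).obj (K ⊗ L : PMod R)).obj (op U) :=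
  (ModuleCat.homAddEquiv (M := ((pushforwardP f φ).obj K ⊗ (pushforwardP f φ).obj L : PMod S).obj (op U))
    (N := ((pushforwardP f φ).obj (K ⊗ L : PMod R)).obj (op U)) ).symm (pushMuApp f φ K L U)

/-- The natural map `f_* K ⊗ f_* L → f_* (K ⊗ L)`. -/
noncomputable def pushMu (K L : PMod R) :
    ((pushforwardP f φ).obj K ⊗ (pushforwardP f φ).obj L : PMod S) ⟶
      (pushforwardP f φ).obj (K ⊗ L : PMod R) where
  app U := pushMuHom f φ K L U.unop
  naturality _ := ModuleCat.MonoidalCategory.tensor_ext (fun _ _ => rfl)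

theorem pushMuApp_tmul (K L : PMod R) (U : Opens Y) (k : K.obj (op ((Opens.map f).obj U)))
    (l : L.obj (op ((Opens.map f).obj U))) :
    (pushMu f φ K L).app (op U) (TensorProduct.tmul (S.obj (op U))
      (M := ((pushforwardP f φ).obj K).obj (op U)) (N := ((pushforwardP f φ).obj L).obj (op U)) k l) =
    (TensorProduct.tmul (R.obj (op ((Opens.map f).obj U))) k l) := rfl

/-- The natural map `f^* (A ⊗ B) → f^* A ⊗ f^* B`. -/
noncomputable def pullDelta (A B : PMod S) :
    (pullbackP f φ).obj (A ⊗ B : PMod S) ⟶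
      ((pullbackP f φ).obj A ⊗ (pullbackP f φ).obj B : PMod R) :=
  ((adjP f φ).homEquiv _ _).symm
    (((adjP f φ).unit.app A ⊗ₘ (adjP f φ).unit.app B) ≫ pushMu f φ _ _)

theorem pushMu_naturality {K K' L L' : PMod R} (k : K ⟶ K') (l : L ⟶ L') :
    pushMu f φ K L ≫ (pushforwardP f φ).map (k ⊗ₘ l) =
      ((pushforwardP f φ).map k ⊗ₘ (pushforwardP f φ).map l) ≫ pushMu f φ K' L' := by
  ext1 U
  exact ModuleCat.MonoidalCategory.tensor_ext (fun _ _ => rfl)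

theorem pullDelta_naturality {A A' B B' : PMod S} (a : A ⟶ A') (b : B ⟶ B') :
    (pullbackP f φ).map (a ⊗ₘ b) ≫ pullDelta f φ A' B' =
      pullDelta f φ A B ≫ ((pullbackP f φ).map a ⊗ₘ (pullbackP f φ).map b) := by
  apply ((adjP f φ).homEquiv _ _).injective
  rw [Adjunction.homEquiv_naturality_left, Adjunction.homEquiv_naturality_right]
  rw [pullDelta, pullDelta, Equiv.apply_symm_apply, Equiv.apply_symm_apply]
  have hA := (adjP f φ).unit.naturality a
  have hB := (adjP f φ).unit.naturality b
  dsimp only [Functor.id_obj, Functor.id_map, Functor.comp_obj, Functor.comp_map] at hA hB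
  rw [Category.assoc, pushMu_naturality, MonoidalCategory.tensorHom_comp_tensorHom_assoc,
    MonoidalCategory.tensorHom_comp_tensorHom_assoc, hA, hB]

/-- The pullback of a section. -/
noncomputable def pullSec {A : PMod S} {U : Opens Y} (x : A.obj (op U)) :
    ((pullbackP f φ).obj A).obj (op ((Opens.map f).obj U)) :=
  ((adjP f φ).unit.app A).app (op U) x

theorem pullSec_res {A : PMod S} {U V : Opens Y} (i : V ⟶ U) (x : A.obj (op U)) :
    pullSec f φ (res A i x) =
      res ((pullbackP f φ).obj A) ((Opens.map f).map i) (pullSec f φ x) :=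
  app_res ((adjP f φ).unit.app A) i x

theorem isGen_pullSec {A : PMod S} {U : Opens Y} {x : A.obj (op U)} (hx : IsGen x) :
    IsGen (pullSec f φ x) := by
  intro K
  have h := (hx ((pushforwardP f φ).obj K)).comp ((adjP f φ).homEquiv A K).bijective
  convert! h using 1

theorem pullDelta_pullSec {A B : PMod S} {U : Opens Y} (a : A.obj (op U)) (b : B.obj (op U)) :
    (pullDelta f φ A B).app (op ((Opens.map f).obj U))
      (pullSec f φ (A := (A ⊗ B : PMod S)) (TensorProduct.tmul (S.obj (op U)) a b)) =
    TensorProduct.tmul (R.obj (op ((Opens.map f).obj U))) (pullSec f φ a) (pullSec f φ b) := by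
  have key : (adjP f φ).unit.app _ ≫ (pushforwardP f φ).map (pullDelta f φ A B)
      = ((adjP f φ).unit.app _ ⊗ₘ (adjP f φ).unit.app _) ≫ pushMu f φ _ _ :=
    ((adjP f φ).homEquiv_unit _ _ _).symm.trans (Equiv.apply_symm_apply _ _)
  exact congrArg (fun ψ => ψ.app (op U) (TensorProduct.tmul (S.obj (op U)) a b)) key

theorem isIso_pullDelta_free (U V : Opens Y) :
    IsIso (pullDelta f φ (freeY S U) (freeY S V)) := by
  have h1 := isGen_pullSec f φ (isGen_tmulGen_free (R := S) U V)
  have h2 := isGen_tmulGen (isGen_pullSec f φ (isGen_freeGen (R := S) U))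
    (isGen_pullSec f φ (isGen_freeGen (R := S) V))
  refine h1.isIso h2 _ ?_
  refine (pullDelta_pullSec f φ _ _).trans ?_
  rw [pullSec_res, pullSec_res]
  rfl

instance : PreservesColimitsOfSize.{u, u} (pullbackP f φ) :=
  (adjP f φ).leftAdjoint_preservesColimits

theorem isIso_pullDelta (A B : PMod S) : IsIso (pullDelta f φ A B) := by
  let τ (B : PMod S) : tensorRight B ⋙ pullbackP f φ ⟶
      pullbackP f φ ⋙ tensorRight ((pullbackP f φ).obj B) :=
    { app A := pullDelta f φ A B
      naturality A A' a := by simpa using pullDelta_naturality f φ a (𝟙 B) }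
  let τ' (A : PMod S) : tensorLeft A ⋙ pullbackP f φ ⟶
      pullbackP f φ ⋙ tensorLeft ((pullbackP f φ).obj A) :=
    { app B := pullDelta f φ A B
      naturality B B' b := by simpa using pullDelta_naturality f φ (𝟙 A) b }
  exact isIso_app_of_free (τ' A) (fun V => isIso_app_of_free (τ (freeY S V))
    (fun U => isIso_pullDelta_free f φ U V) A) B
end

section
variable {X Y : Scheme.{u}} (f : X ⟶ Y)

/-- Pullback of sheaves of modules is the sheafification of the pullback of presheaves. -/
noncomputable def pullbackSheafification :
    sheafification Y ⋙ Scheme.Modules.pullback f ≅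
      pullbackP f.base (R := X.presheaf) (S := Y.presheaf) f.c ⋙ sheafification X :=
  Adjunction.leftAdjointUniq
    ((sheafificationAdj Y).comp (Scheme.Modules.pullbackPushforwardAdjunction f))
    ((adjP f.base f.c).comp (sheafificationAdj X))

/-- Pullback of modules is compatible with tensor products. -/
noncomputable def pullbackTensor (M N : Y.Modules) :
    (Scheme.Modules.pullback f).obj (tensor M N) ≅
      tensor ((Scheme.Modules.pullback f).obj M) ((Scheme.Modules.pullback f).obj N) :=
  (pullbackSheafification f).app _ ≪≫
    (sheafification X).mapIso (@asIso _ _ _ _ _ (isIso_pullDelta f.base f.c _ _)) ≪≫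
    sheafificationTensor _ _ ≪≫
    tensorCongr
      (((pullbackSheafification f).app _).symm ≪≫
        (Scheme.Modules.pullback f).mapIso (sheafificationObjIso M))
      (((pullbackSheafification f).app _).symm ≪≫
        (Scheme.Modules.pullback f).mapIso (sheafificationObjIso N))
end
theorem final_opensMap {X Y : TopCat.{u}} (f : X ⟶ Y) : (Opens.map f).Final where
  out U := by
    let T : StructuredArrow U (Opens.map f) :=
      StructuredArrow.mk (Y := (⊤ : Opens Y)) (homOfLE fun _ _ => trivial)
    have : Nonempty (StructuredArrow U (Opens.map f)) := ⟨T⟩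
    have h : ∀ Z : StructuredArrow U (Opens.map f), Zigzag Z T := fun Z =>
      Zigzag.of_hom (StructuredArrow.homMk (homOfLE le_top) (Subsingleton.elim _ _))
    exact zigzag_isConnected fun Z Z' => (h Z).trans (h Z').symm

/-- The pullback of the structure sheaf is the structure sheaf. -/
noncomputable def pullbackStructureSheaf {X Y : Scheme.{u}} (f : X ⟶ Y) :
    (Scheme.Modules.pullback f).obj (structureSheaf Y) ≅ structureSheaf X := by
  haveI : (SheafOfModules.pushforward.{u} f.toRingCatSheafHom).IsRightAdjoint :=
    inferInstanceAs ((Scheme.Modules.pushforward f).IsRightAdjoint)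
  haveI := final_opensMap f.base
  exact @asIso _ _ _ _ _ (SheafOfModules.instIsIsoPullbackObjUnitToUnitOfFinal f.toRingCatSheafHom)

section
variable {X Y Z : Scheme.{u}}

variable (X) in
/-- The isomorphism classes of `𝒪_X`-modules. -/
def ModuleClass : Type (u + 1) := Quotient (isIsomorphicSetoid X.Modules)

/-- The isomorphism class of an `𝒪_X`-module. -/
def ModuleClass.mk (M : X.Modules) : ModuleClass X := Quotient.mk _ M

theorem ModuleClass.mk_eq_mk_iff {M N : X.Modules} :
    ModuleClass.mk M = ModuleClass.mk N ↔ Nonempty (M ≅ N) := Quotient.eq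

theorem ModuleClass.ind {p : ModuleClass X → Prop} (h : ∀ M, p (.mk M)) (a) : p a :=
  Quotient.ind h a

/-- The commutative monoid of isomorphism classes of `𝒪_X`-modules: multiplication is the tensor
product and the neutral element is the class of `𝒪_X`. -/
noncomputable instance : CommMonoid (ModuleClass X) where
  mul := Quotient.map₂ tensor (fun _ _ ⟨e⟩ _ _ ⟨e'⟩ => ⟨tensorCongr e e'⟩)
  one := .mk (structureSheaf X)
  mul_assoc a b c := by
    induction a using ModuleClass.ind
    induction b using ModuleClass.ind
    induction c using ModuleClass.ind
    exact Quotient.sound ⟨tensorAssoc _ _ _⟩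
  mul_comm a b := by
    induction a using ModuleClass.ind
    induction b using ModuleClass.ind
    exact Quotient.sound ⟨tensorComm _ _⟩
  one_mul a := by
    induction a using ModuleClass.ind
    exact Quotient.sound ⟨unitTensor _⟩
  mul_one a := by
    induction a using ModuleClass.ind
    exact Quotient.sound ⟨tensorComm _ _ ≪≫ unitTensor _⟩

/-- Pullback of isomorphism classes of modules. -/
noncomputable def ModuleClass.map (f : X ⟶ Y) : ModuleClass Y →* ModuleClass X where
  toFun := Quotient.map (Scheme.Modules.pullback f).obj
    (fun _ _ ⟨e⟩ => ⟨(Scheme.Modules.pullback f).mapIso e⟩)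
  map_one' := Quotient.sound ⟨pullbackStructureSheaf f⟩
  map_mul' a b := by
    induction a using ModuleClass.ind
    induction b using ModuleClass.ind
    exact Quotient.sound ⟨pullbackTensor f _ _⟩

theorem ModuleClass.map_mk (f : X ⟶ Y) (M : Y.Modules) :
    ModuleClass.map f (.mk M) = .mk ((Scheme.Modules.pullback f).obj M) := rfl

theorem ModuleClass.map_id : ModuleClass.map (𝟙 X) = MonoidHom.id _ := by
  ext a
  induction a using ModuleClass.ind
  exact Quotient.sound ⟨(Scheme.Modules.pullbackId X).app _⟩

theorem ModuleClass.map_comp (f : X ⟶ Y) (g : Y ⟶ Z) :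
    ModuleClass.map (f ≫ g) = (ModuleClass.map f).comp (ModuleClass.map g) := by
  ext a
  induction a using ModuleClass.ind
  exact Quotient.sound ⟨((Scheme.Modules.pullbackComp f g).app _).symm⟩

theorem units_map_comp (f : X ⟶ Y) (g : Y ⟶ Z) (a : (ModuleClass Z)ˣ) :
    Units.map (ModuleClass.map (f ≫ g)) a =
      Units.map (ModuleClass.map f) (Units.map (ModuleClass.map g) a) := by
  rw [ModuleClass.map_comp, Units.map_comp]; rfl

variable (X) in
/-- The Picard group of a scheme: the isomorphism classes of invertible sheaves, that is,
of the `⊗`-invertible `𝒪_X`-modules that are locally isomorphic to the structure sheaf. -/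
noncomputable def picSubgroup : Subgroup (ModuleClass X)ˣ where
  carrier := {a | ∀ x : X, ∃ U : X.Opens, x ∈ U ∧ Units.map (ModuleClass.map U.ι) a = 1}
  one_mem' x := ⟨⊤, trivial, _root_.map_one _⟩
  mul_mem' {a b} ha hb x := by
    obtain ⟨U, hU, hUa⟩ := ha x
    obtain ⟨V, hV, hVb⟩ := hb x
    refine ⟨U ⊓ V, ⟨hU, hV⟩, ?_⟩
    have h1 : (U ⊓ V).ι = X.homOfLE (inf_le_left : U ⊓ V ≤ U) ≫ U.ι := by simp
    have h2 : (U ⊓ V).ι = X.homOfLE (inf_le_right : U ⊓ V ≤ V) ≫ V.ι := by simp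
    rw [_root_.map_mul]
    nth_rw 1 [h1]
    rw [h2, units_map_comp, units_map_comp, hUa, hVb, _root_.map_one, _root_.map_one, mul_one]
  inv_mem' {a} ha x := by
    obtain ⟨U, hU, hUa⟩ := ha x
    exact ⟨U, hU, by rw [_root_.map_inv, hUa, inv_one]⟩

variable (X) in
/-- The Picard group of a scheme. -/
abbrev Pic : Type (u + 1) := picSubgroup X

theorem map_mem_picSubgroup (f : X ⟶ Y) {a : (ModuleClass Y)ˣ} (ha : a ∈ picSubgroup Y) :
    Units.map (ModuleClass.map f) a ∈ picSubgroup X := by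
  intro x
  obtain ⟨U, hU, hUa⟩ := ha (f x)
  refine ⟨f ⁻¹ᵁ U, hU, ?_⟩
  rw [← units_map_comp, ← morphismRestrict_ι, units_map_comp, hUa, _root_.map_one]

/-- Pullback of invertible sheaves. -/
noncomputable def Pic.map (f : X ⟶ Y) : Pic Y →* Pic X :=
  ((Units.map (ModuleClass.map f)).comp (picSubgroup Y).subtype).codRestrict (picSubgroup X)
    (fun a => map_mem_picSubgroup f a.2)

theorem Pic.map_id : Pic.map (𝟙 X) = MonoidHom.id _ := by
  ext a
  exact DFunLike.congr_fun ModuleClass.map_id _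

theorem Pic.map_comp (f : X ⟶ Y) (g : Y ⟶ Z) :
    Pic.map (f ≫ g) = (Pic.map f).comp (Pic.map g) := by
  ext a
  exact DFunLike.congr_fun (ModuleClass.map_comp f g) _

end

section
variable {S X : Scheme.{u}} (f : X ⟶ S)

/-- The base change `X_{T'} ⟶ X_T` of a morphism `T' ⟶ T` of `S`-schemes. -/
noncomputable def baseChangeMap {T' T : Over S} (h : T' ⟶ T) :
    pullback f T'.hom ⟶ pullback f T.hom :=
  pullback.lift (pullback.fst f T'.hom) (pullback.snd f T'.hom ≫ h.left) (by
    rw [Category.assoc, Over.w, pullback.condition])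

theorem baseChangeMap_snd {T' T : Over S} (h : T' ⟶ T) :
    baseChangeMap f h ≫ pullback.snd f T.hom = pullback.snd f T'.hom ≫ h.left :=
  pullback.lift_snd _ _ _

theorem baseChangeMap_fst {T' T : Over S} (h : T' ⟶ T) :
    baseChangeMap f h ≫ pullback.fst f T.hom = pullback.fst f T'.hom :=
  pullback.lift_fst _ _ _

theorem baseChangeMap_id (T : Over S) : baseChangeMap f (𝟙 T) = 𝟙 _ := by
  apply pullback.hom_ext <;> simp [baseChangeMap]

theorem baseChangeMap_comp {T'' T' T : Over S} (h : T'' ⟶ T') (g : T' ⟶ T) :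
    baseChangeMap f (h ≫ g) = baseChangeMap f h ≫ baseChangeMap f g := by
  apply pullback.hom_ext
  · rw [Category.assoc, baseChangeMap_fst, baseChangeMap_fst, baseChangeMap_fst]
  · rw [Category.assoc, baseChangeMap_snd, baseChangeMap_snd, ← Category.assoc, baseChangeMap_snd,
      Category.assoc, Over.comp_left]

/-- The group `Pic(X_T) / Pic(T)`, where `Pic(T)` acts through pullback along the projection
`f_T : X_T ⟶ T`. -/
abbrev RelPic (T : Over S) : Type (u + 1) :=
  Pic (pullback f T.hom) ⧸ (Pic.map (pullback.snd f T.hom)).range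

/-- The map `Pic(X_T) / Pic(T) → Pic(X_{T'}) / Pic(T')` given by pullback. -/
noncomputable def RelPic.map {T' T : Over S} (h : T' ⟶ T) : RelPic f T →* RelPic f T' :=
  QuotientGroup.map _ _ (Pic.map (baseChangeMap f h)) (by
    rintro _ ⟨a, rfl⟩
    refine ⟨Pic.map h.left a, ?_⟩
    rw [← MonoidHom.comp_apply, ← MonoidHom.comp_apply, ← Pic.map_comp, ← Pic.map_comp,
      baseChangeMap_snd])

theorem RelPic.map_id (T : Over S) : RelPic.map f (𝟙 T) = MonoidHom.id _ := by
  ext a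
  refine congrArg (QuotientGroup.mk (s := (Pic.map (pullback.snd f T.hom)).range)) ?_
  rw [baseChangeMap_id, Pic.map_id]; rfl

theorem RelPic.map_comp {T'' T' T : Over S} (h : T'' ⟶ T') (g : T' ⟶ T) :
    RelPic.map f (h ≫ g) = (RelPic.map f h).comp (RelPic.map f g) := by
  ext a
  refine congrArg (QuotientGroup.mk (s := (Pic.map (pullback.snd f T''.hom)).range)) ?_
  rw [baseChangeMap_comp, Pic.map_comp]; rfl

variable (S) in
/-- The category of locally Noetherian `S`-schemes. -/
abbrev LocNoethOver := ObjectProperty.FullSubcategory (fun T : Over S => IsLocallyNoetherian T.left)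

variable (S) in
/-- The underlying scheme of a locally Noetherian `S`-scheme. -/
abbrev LocNoethOver.toScheme : LocNoethOver S ⥤ Scheme.{u} :=
  ObjectProperty.ι _ ⋙ Over.forget S

/-- The relative Picard functor `T ↦ Pic(X_T) / Pic(T)` on locally Noetherian `S`-schemes. -/
noncomputable def relPicFunctor : (LocNoethOver S)ᵒᵖ ⥤ AddCommGrpCat.{u + 1} where
  obj T := AddCommGrpCat.of (Additive (RelPic f T.unop.obj))
  map h := AddCommGrpCat.ofHom (MonoidHom.toAdditive (RelPic.map f h.unop.hom))
  map_id T := by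
    rw [show (𝟙 T : T ⟶ T).unop.hom = 𝟙 T.unop.obj from rfl, RelPic.map_id]; rfl
  map_comp h g := by
    rw [show (h ≫ g).unop.hom = g.unop.hom ≫ h.unop.hom from rfl, RelPic.map_comp]; rfl

variable (S) in
/-- The Zariski topology on locally Noetherian `S`-schemes, generated by the jointly surjective
families of open immersions. -/
def zariskiTopology : GrothendieckTopology (LocNoethOver S) :=
  (Scheme.zariskiPrecoverage.comap (LocNoethOver.toScheme S)).toGrothendieck

variable (S) in
/-- The étale topology on locally Noetherian `S`-schemes, generated by the jointly surjective
families of étale morphisms. -/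
def etaleTopology : GrothendieckTopology (LocNoethOver S) :=
  (Scheme.etalePrecoverage.comap (LocNoethOver.toScheme S)).toGrothendieck

variable (S) in
/-- The fppf topology on locally Noetherian `S`-schemes, generated by the jointly surjective
families of flat morphisms that are locally of finite presentation. -/
def fppfTopology : GrothendieckTopology (LocNoethOver S) :=
  (Scheme.fppfPrecoverage.comap (LocNoethOver.toScheme S)).toGrothendieck

theorem zariskiTopology_le_etaleTopology : zariskiTopology S ≤ etaleTopology S :=
  Precoverage.toGrothendieck_mono fun _ _ h =>
    Scheme.precoverage_mono (P := @IsOpenImmersion) (Q := @Etale) (fun _ _ _ _ => inferInstance) _ h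

theorem etaleTopology_le_fppfTopology : etaleTopology S ≤ fppfTopology S :=
  Precoverage.toGrothendieck_mono fun _ _ h =>
    Scheme.precoverage_mono (P := @Etale) (fun _ _ _ _ => ⟨inferInstance, inferInstance⟩) _ h

/-- The sheaf associated to the relative Picard functor in the Zariski topology. -/
noncomputable def picZar : (LocNoethOver S)ᵒᵖ ⥤ AddCommGrpCat.{u + 1} :=
  sheafify (zariskiTopology S) (relPicFunctor f)

/-- The sheaf associated to the relative Picard functor in the étale topology. -/
noncomputable def picEt : (LocNoethOver S)ᵒᵖ ⥤ AddCommGrpCat.{u + 1} :=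
  sheafify (etaleTopology S) (relPicFunctor f)

/-- The sheaf associated to the relative Picard functor in the fppf topology. -/
noncomputable def picFppf : (LocNoethOver S)ᵒᵖ ⥤ AddCommGrpCat.{u + 1} :=
  sheafify (fppfTopology S) (relPicFunctor f)

theorem isSheaf_picEt : Presheaf.IsSheaf (zariskiTopology S) (picEt f) :=
  fun E => Presieve.isSheaf_of_le _ zariskiTopology_le_etaleTopology (((presheafToSheaf _ _).obj (relPicFunctor f)).property E)

theorem isSheaf_picFppf : Presheaf.IsSheaf (etaleTopology S) (picFppf f) :=
  fun E => Presieve.isSheaf_of_le _ etaleTopology_le_fppfTopology (((presheafToSheaf _ _).obj (relPicFunctor f)).property E)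

/-- The natural map from the relative Picard functor to its associated Zariski sheaf. -/
noncomputable def toPicZar : relPicFunctor f ⟶ picZar f :=
  toSheafify (zariskiTopology S) (relPicFunctor f)

/-- The natural map from the associated Zariski sheaf to the associated étale sheaf: the unique map
compatible with the canonical maps from the relative Picard functor. -/
noncomputable def picZarToPicEt : picZar f ⟶ picEt f :=
  sheafifyLift (zariskiTopology S) (toSheafify (etaleTopology S) (relPicFunctor f)) (isSheaf_picEt f)

/-- The natural map from the associated étale sheaf to the associated fppf sheaf: the unique map
compatible with the canonical maps from the relative Picard functor. -/
noncomputable def picEtToPicFppf : picEt f ⟶ picFppf f :=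
  sheafifyLift (etaleTopology S) (toSheafify (fppfTopology S) (relPicFunctor f)) (isSheaf_picFppf f)

/-- The structure sheaf condition `𝒪_S ≅ f_* 𝒪_X` holds universally: for every locally
Noetherian `S`-scheme `T`, the comorphism `𝒪_T ⟶ (f_T)_* 𝒪_{X_T}` of the projection
`f_T : X_T ⟶ T` is an isomorphism. -/
def UniversallyComorphismIso : Prop :=
  ∀ T : LocNoethOver S, IsIso (pullback.snd f T.obj.hom).c

/-- The morphism `f : X ⟶ S` has a section. -/
def HasSection : Prop := ∃ g : S ⟶ X, g ≫ f = 𝟙 S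

/-- The morphism `f : X ⟶ S` has a section locally for a class `K` of covering families:
there is a covering family of `S` in `K` such that the base change of `f` to every member `U` of
the family has a section, that is, such that `U ⟶ S` lifts to `X`. -/
def HasSectionLocally (K : Precoverage Scheme.{u}) : Prop :=
  ∃ 𝒰 ∈ K S, ∀ ⦃U : Scheme.{u}⦄ (p : U ⟶ S), 𝒰 p → ∃ g : U ⟶ X, g ≫ f = p

end
end PicardFunctor

/-!
A line bundle on a locally Noetherian scheme `Z` is the same as a torsor under `𝔾ₘ` for the fppf
topology. A line bundle `L` gives the torsor of isomorphisms from its pullbacks to the structure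
sheaf (`PicardFunctor.coframeTorsor`). Conversely, a torsor has sections locally in the Zariski
topology by Hilbert 90 (`PicardFunctor.GmTorsor.exists_sec_opens`), and such sections differ by a
cocycle of units, which defines a line bundle. Under this correspondence
(`PicardFunctor.Represents`) the trivial class corresponds to the torsors with a global section, and
pullback of classes to pullback of torsors. Torsors satisfy fppf descent by construction, and this is
the only form in which descent of line bundles enters. Hilbert 90 itself needs no descent of modules:
for a flat algebra `A` over `R` and a cocycle `v` in `(A ⊗ A)ˣ`, the elements `m` of `A` with
`v (m ⊗ 1) = 1 ⊗ m` generate the unit ideal (`PicardFunctor.span_eq_top_of_cocycle`).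

The relative Picard functor is separated for the fppf topology (`PicardFunctor.relPic_ext`). Suppose
that a class `a` in `Pic X_T` comes, fppf locally on `T`, from the base. Then a torsor `P`
representing `a` has sections over `X_{T'}` for the members `T'` of an fppf covering of `T`. Since
the units on `X_{T'}` are those of `T'`, the assignment of the sections of `P` over `X_{T'}` to `T'`
is a torsor over `T`, the Weil restriction of `P`, and its pullback to `X_T` is `P`. So `a` comes from
`Pic T` (`PicardFunctor.mem_range_picMap_of_locally`). Hence the functor embeds into its associated
sheaf for every topology coarser than the fppf topology, and the maps between associated sheaves are
injective as well.

If `X_T ⟶ T` has a section, every section over `T` of an associated sheaf comes from `Pic X_T`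
(`PicardFunctor.surjective_toSheafify_relPicFunctor`). Indeed, it is given by classes on the members
of a covering of `T` which agree on the overlaps up to classes from the base. After twisting by
classes from the base they become trivial along the section, and then agree. Torsors representing
them have trivializations along the section; isomorphisms on the overlaps that respect these
trivializations exist and are unique, because the automorphisms of a torsor are the units, which come
from the base and are detected along the section. By uniqueness they form a descent datum, and the
torsor descends to `X_T` (`PicardFunctor.exists_pic_of_section`).

With a global section this makes all the maps bijective. If `f` has a section locally for the Zariski
or the étale topology, then every `T` is covered in this topology by schemes with a lift to `X`, that
is, with a section of the base change of `f` (`PicardFunctor.liftSieve_mem`). Over these the sheaf for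
a finer topology is reached by the relative Picard functor, so the comparison map of sheaves is locally
surjective as well as injective (`PicardFunctor.isIso_sheafifyLift`).
-/

namespace PicardFunctor

/-! ### Functions and units are sheaves for the fppf topology -/

/-- A family of morphisms of schemes is an fppf covering if its members are flat and locally of
finite presentation and their images cover the target. -/
structure IsFppfCover {ι : Type*} {Y : Scheme.{u}} {Z : ι → Scheme.{u}} (k : ∀ i, Z i ⟶ Y) :
    Prop where
  flat : ∀ i, Flat (k i)
  lfp : ∀ i, LocallyOfFinitePresentation (k i)
  exists_eq : ∀ y : Y, ∃ (i : ι) (z : Z i), k i z = y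

namespace IsFppfCover

variable {ι : Type*} {Y : Scheme.{u}} {Z : ι → Scheme.{u}} {k : ∀ i, Z i ⟶ Y}

theorem isLocallyNoetherian (hk : IsFppfCover k) [IsLocallyNoetherian Y] (i : ι) :
    IsLocallyNoetherian (Z i) :=
  have := hk.lfp i
  LocallyOfFiniteType.isLocallyNoetherian (k i)

theorem of_isPullback (hk : IsFppfCover k) {W : Scheme.{u}} {f : W ⟶ Y} {P : ι → Scheme.{u}}
    {p : ∀ i, P i ⟶ W} {q : ∀ i, P i ⟶ Z i} (h : ∀ i, IsPullback (p i) (q i) f (k i)) :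
    IsFppfCover p where
  flat i := by
    have := hk.flat i
    exact MorphismProperty.of_isPullback (P := @Flat) (h i).flip this
  lfp i := by
    have := hk.lfp i
    exact MorphismProperty.of_isPullback (P := @LocallyOfFinitePresentation) (h i).flip this
  exists_eq w := by
    obtain ⟨i, z, hz⟩ := hk.exists_eq (f w)
    obtain ⟨x, hx, -⟩ := Scheme.Pullback.exists_preimage_pullback w z hz.symm
    refine ⟨i, (h i).isoPullback.inv x, ?_⟩
    rw [← Scheme.Hom.comp_apply, IsPullback.isoPullback_inv_fst, hx]

theorem pullback_fst (hk : IsFppfCover k) {W : Scheme.{u}} (f : W ⟶ Y) :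
    IsFppfCover (fun i => pullback.fst f (k i)) :=
  hk.of_isPullback (fun _ => IsPullback.of_hasPullback _ _)

theorem of_opens {U : ι → Y.Opens} (h : ∀ y, ∃ i, y ∈ U i) :
    IsFppfCover (fun i => (U i).ι) where
  flat _ := inferInstance
  lfp _ := inferInstance
  exists_eq y := by
    obtain ⟨i, hi⟩ := h y
    exact ⟨i, ⟨y, hi⟩, rfl⟩

end IsFppfCover

/-- The restriction of a function on an open set `V` to a scheme mapping into `V`. -/
noncomputable abbrev ev {Y W : Scheme.{u}} (l : W ⟶ Y) {V : Y.Opens} (h : ⊤ ≤ l ⁻¹ᵁ V)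
    (s : Γ(Y, V)) : Γ(W, ⊤) := l.appLE V ⊤ h s

theorem ev_comp {Y W W' : Scheme.{u}} (l : W ⟶ Y) (m : W' ⟶ W) {V : Y.Opens} (h : ⊤ ≤ l ⁻¹ᵁ V)
    (h' : ⊤ ≤ (m ≫ l) ⁻¹ᵁ V) (s : Γ(Y, V)) : ev (m ≫ l) h' s = m.appTop (ev l h s) := by
  have e : l.appLE V ⊤ h ≫ m.appTop = (m ≫ l).appLE V ⊤ h' := by
    have := Scheme.Hom.appLE_comp_appLE m l V ⊤ ⊤ h le_rfl
    rw [← this]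
    exact congrArg _ (Scheme.Hom.appLE_eq_app m (U := ⊤)).symm
  exact (congrArg (fun f => f s) e).symm

theorem ev_app {Y Z W : Scheme.{u}} (k : Z ⟶ Y) (l : W ⟶ Z) {V : Y.Opens}
    (h : ⊤ ≤ l ⁻¹ᵁ (k ⁻¹ᵁ V)) (h' : ⊤ ≤ (l ≫ k) ⁻¹ᵁ V) (s : Γ(Y, V)) :
    ev l h (k.app V s) = ev (l ≫ k) h' s := by
  rw [ev, ev, ← Scheme.Hom.appLE_eq_app, ← CommRingCat.comp_apply, Scheme.Hom.appLE_comp_appLE]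

theorem ev_map {Y W : Scheme.{u}} (l : W ⟶ Y) {V V' : Y.Opens} (i : V' ⟶ V) (h : ⊤ ≤ l ⁻¹ᵁ V)
    (h' : ⊤ ≤ l ⁻¹ᵁ V') (s : Γ(Y, V)) : ev l h' (Y.presheaf.map i.op s) = ev l h s := by
  rw [ev, ev, ← CommRingCat.comp_apply, Scheme.Hom.map_appLE]

theorem ev_congr {Y W : Scheme.{u}} {l l' : W ⟶ Y} (e : l = l') {V : Y.Opens} (h : ⊤ ≤ l ⁻¹ᵁ V)
    (h' : ⊤ ≤ l' ⁻¹ᵁ V) (s : Γ(Y, V)) : ev l h s = ev l' h' s := by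
  subst e; rfl

theorem ev_top {Y W : Scheme.{u}} (l : W ⟶ Y) (h : ⊤ ≤ l ⁻¹ᵁ ⊤) (s : Γ(Y, ⊤)) :
    ev l h s = l.appTop s := by
  exact congrArg (fun f : Γ(Y, ⊤) ⟶ Γ(W, ⊤) => f s) (Scheme.Hom.appLE_eq_app l (U := ⊤))

theorem top_le_ι {Y : Scheme.{u}} {V V' : Y.Opens} (h : V ≤ V') : ⊤ ≤ V.ι ⁻¹ᵁ V' :=
  fun x _ => h x.2

theorem bijective_ev_ι {Y : Scheme.{u}} (V : Y.Opens) :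
    Function.Bijective (ev V.ι (top_le_ι le_rfl) : Γ(Y, V) → Γ(V, ⊤)) := by
  have : IsIso (V.ι.appLE V ⊤ (top_le_ι le_rfl)) := by
    rw [Scheme.Opens.ι_appLE]
    have : V.ι ''ᵁ ⊤ = V := by simp
    exact (Y.presheaf.mapIso (eqToIso this).op).isIso_hom
  exact (ConcreteCategory.isIso_iff_bijective _).1 this

/-- A morphism whose image lies in an open subscheme, as a morphism to that subscheme. -/
noncomputable def liftOpens {Y W : Scheme.{u}} (l : W ⟶ Y) {V : Y.Opens} (h : ⊤ ≤ l ⁻¹ᵁ V) :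
    W ⟶ V :=
  IsOpenImmersion.lift V.ι l (by
    rintro _ ⟨x, rfl⟩
    simpa using h (Opens.mem_top x))

@[simp]
theorem liftOpens_ι {Y W : Scheme.{u}} (l : W ⟶ Y) {V : Y.Opens} (h : ⊤ ≤ l ⁻¹ᵁ V) :
    liftOpens l h ≫ V.ι = l := IsOpenImmersion.lift_fac _ _ _

/-- Functions form a sheaf for the fppf topology: they are the morphisms to the affine line, and the
fppf topology is subcanonical. -/
theorem existsUnique_glue_top {ι : Type*} {Y : Scheme.{u}} {Z : ι → Scheme.{u}}
    {k : ∀ i, Z i ⟶ Y} (hk : IsFppfCover k) (a : ∀ i, Γ(Z i, ⊤))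
    (ha : ∀ i j, (pullback.fst (k i) (k j)).appTop (a i) = (pullback.snd (k i) (k j)).appTop (a j)) :
    ∃! s : Γ(Y, ⊤), ∀ i, (k i).appTop s = a i := by
  have h1 : Presieve.ofArrows Z k ∈ Scheme.fppfPrecoverage Y :=
    (Scheme.ofArrows_mem_precoverage_iff _).2 ⟨fun x => by
      obtain ⟨i, z, hz⟩ := hk.exists_eq x
      exact ⟨i, z, hz⟩, fun i => ⟨hk.flat i, hk.lfp i⟩⟩
  have h2 := ((GrothendieckTopology.Subcanonical.isSheaf_of_isRepresentable
    (J := Scheme.fppfTopology.{u})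
    (yoneda.obj (Spec (.of (MvPolynomial PUnit.{u + 1} (ULift.{u} ℤ))))))).isSheafFor _
    (Precoverage.generate_mem_toGrothendieck h1)
  rw [Presieve.isSheafFor_arrows_iff_pullbacks] at h2
  let E {W : Scheme.{u}} := AffineSpace.toSpecMvPolyIntEquiv PUnit.{u + 1} (X := W)
  have hE {W W' : Scheme.{u}} (f : W ⟶ W')
      (g : W' ⟶ Spec (.of (MvPolynomial PUnit.{u + 1} (ULift.{u} ℤ)))) (i) :
      E (f ≫ g) i = f.appTop (E g i) := AffineSpace.toSpecMvPolyIntEquiv_comp _ _ _ _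
  obtain ⟨t, ht, hu⟩ := h2 (fun i => E.symm (fun _ => a i)) (fun i j => E.injective (by
    funext x
    refine (hE _ _ _).trans (Eq.trans ?_ (hE _ _ _).symm)
    rw [Equiv.apply_symm_apply, Equiv.apply_symm_apply]
    exact ha i j))
  refine ⟨E t PUnit.unit, fun i => ?_, fun s hs => ?_⟩
  · have := congrArg (fun f => E f PUnit.unit) (ht i)
    dsimp only at this
    rw [Equiv.apply_symm_apply] at this
    rw [← this]
    exact (hE _ _ _).symm
  · rw [← hu (E.symm (fun _ => s)) fun i => E.injective ?_, Equiv.apply_symm_apply]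
    rw [Equiv.apply_symm_apply]
    funext x
    refine (hE _ _ _).trans ?_
    rw [Equiv.apply_symm_apply]
    exact hs i

/-- Gluing of functions on an open set, with the agreement required only on locally Noetherian
schemes over the overlaps. -/
theorem existsUnique_glue {ι : Type*} {Y : Scheme.{u}} {Z : ι → Scheme.{u}}
    {k : ∀ i, Z i ⟶ Y} (hk : IsFppfCover k) [∀ i, IsLocallyNoetherian (Z i)] (V : Y.Opens)
    (a : ∀ i, Γ(Z i, k i ⁻¹ᵁ V))
    (ha : ∀ i j {W : Scheme.{u}} [IsLocallyNoetherian W] (p : W ⟶ Z i) (q : W ⟶ Z j)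
      (_ : p ≫ k i = q ≫ k j) (hp : ⊤ ≤ p ⁻¹ᵁ (k i ⁻¹ᵁ V)) (hq : ⊤ ≤ q ⁻¹ᵁ (k j ⁻¹ᵁ V)),
      ev p hp (a i) = ev q hq (a j)) :
    ∃! s : Γ(Y, V), ∀ i, (k i).app V s = a i := by
  have hV : IsFppfCover (fun i => k i ∣_ V) :=
    hk.of_isPullback (fun i => (isPullback_morphismRestrict (k i) V))
  obtain ⟨s, hs, hu⟩ := existsUnique_glue_top hV
    (fun i => ev (k i ⁻¹ᵁ V).ι (top_le_ι le_rfl) (a i)) (fun i j => by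
      have := hV.lfp j
      have : IsLocallyNoetherian (pullback (k i ∣_ V) (k j ∣_ V)) :=
        LocallyOfFiniteType.isLocallyNoetherian (pullback.fst (k i ∣_ V) (k j ∣_ V))
      rw [← ev_comp, ← ev_comp]
      · refine ha i j _ _ ?_ _ _
        rw [Category.assoc, Category.assoc, ← morphismRestrict_ι, ← morphismRestrict_ι,
          pullback.condition_assoc]
      · exact fun x _ => ((pullback.snd (k i ∣_ V) (k j ∣_ V)) x).2
      · exact fun x _ => ((pullback.fst (k i ∣_ V) (k j ∣_ V)) x).2)
  have key (i) (s : Γ(Y, V)) : ev (k i ⁻¹ᵁ V).ι (top_le_ι le_rfl) ((k i).app V s) =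
      (k i ∣_ V).appTop (ev V.ι (top_le_ι le_rfl) s) := by
    have h : ⊤ ≤ ((k i ∣_ V) ≫ V.ι) ⁻¹ᵁ V := fun x _ => ((k i ∣_ V) x).2
    rw [← ev_comp _ _ _ h, ev_app _ _ _ (by rw [← morphismRestrict_ι]; exact h)]
    exact ev_congr (morphismRestrict_ι _ _).symm _ _ _
  obtain ⟨t, rfl⟩ := (bijective_ev_ι V).2 s
  refine ⟨t, fun i => (bijective_ev_ι _).1 ?_, fun t' ht' => (bijective_ev_ι V).1 (hu _ fun i => ?_)⟩
  · rw [key, hs]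
  · dsimp only
    rw [← key, ht']

/-- Functions that agree on the members of an fppf covering are equal. -/
theorem IsFppfCover.ext {ι : Type*} {Y : Scheme.{u}} {Z : ι → Scheme.{u}}
    {k : ∀ i, Z i ⟶ Y} (hk : IsFppfCover k) {s t : Γ(Y, ⊤)}
    (h : ∀ i, (k i).appTop s = (k i).appTop t) : s = t :=
  (existsUnique_glue_top hk (fun i => (k i).appTop t) (fun i j => by
    have := congrArg (fun f => f.appTop t) (pullback.condition (f := k i) (g := k j))
    rw [Scheme.Hom.comp_appTop, Scheme.Hom.comp_appTop] at this
    exact this)).unique h (fun _ => rfl)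

/-- The group of units of the ring of functions on a scheme. -/
abbrev gm (Y : Scheme.{u}) : Type u := Γ(Y, ⊤)ˣ

/-- Restriction of units. -/
noncomputable def gmMap {Y Z : Scheme.{u}} (k : Z ⟶ Y) : gm Y →* gm Z := Units.map k.appTop.hom

@[simp]
theorem val_gmMap {Y Z : Scheme.{u}} (k : Z ⟶ Y) (c : gm Y) :
    (gmMap k c : Γ(Z, ⊤)) = k.appTop (c : Γ(Y, ⊤)) := rfl

theorem gmMap_comp {Y Z W : Scheme.{u}} (k : Z ⟶ Y) (l : W ⟶ Z) (c : gm Y) :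
    gmMap (l ≫ k) c = gmMap l (gmMap k c) := by
  ext
  rw [val_gmMap, val_gmMap, val_gmMap, Scheme.Hom.comp_appTop]
  rfl

@[simp]
theorem gmMap_id {Y : Scheme.{u}} (c : gm Y) : gmMap (𝟙 Y) c = c := by
  ext; simp

theorem IsFppfCover.gm_ext {ι : Type*} {Y : Scheme.{u}} {Z : ι → Scheme.{u}}
    {k : ∀ i, Z i ⟶ Y} (hk : IsFppfCover k) {s t : gm Y}
    (h : ∀ i, gmMap (k i) s = gmMap (k i) t) : s = t :=
  Units.ext (hk.ext fun i => congrArg Units.val (h i))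

theorem IsFppfCover.exists_gm {ι : Type*} {Y : Scheme.{u}} {Z : ι → Scheme.{u}}
    {k : ∀ i, Z i ⟶ Y} (hk : IsFppfCover k) [∀ i, IsLocallyNoetherian (Z i)] (a : ∀ i, gm (Z i))
    (ha : ∀ i j {W : Scheme.{u}} [IsLocallyNoetherian W] (p : W ⟶ Z i) (q : W ⟶ Z j)
      (_ : p ≫ k i = q ≫ k j), gmMap p (a i) = gmMap q (a j)) :
    ∃ s : gm Y, ∀ i, gmMap (k i) s = a i := by
  have hp (j : ι) := hk.lfp j
  have (i j : ι) : IsLocallyNoetherian (pullback (k i) (k j)) :=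
    LocallyOfFiniteType.isLocallyNoetherian (pullback.fst (k i) (k j))
  obtain ⟨s, hs, -⟩ := existsUnique_glue_top hk (fun i => (a i : Γ(Z i, ⊤)))
    (fun i j => congrArg Units.val (ha i j _ _ pullback.condition))
  obtain ⟨t, ht, -⟩ := existsUnique_glue_top hk (fun i => ((a i)⁻¹ : gm (Z i)).val)
    (fun i j => congrArg (fun c : gm _ => (c⁻¹).val) (ha i j _ _ pullback.condition))
  have hst : s * t = 1 := hk.ext fun i => by
    rw [map_mul, map_one, hs, ht, Units.mul_inv]
  exact ⟨⟨s, t, hst, by rw [mul_comm, hst]⟩, fun i => Units.ext (hs i)⟩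

/-! ### Torsors under the multiplicative group -/

/-- A `𝔾ₘ`-torsor over `X` for the fppf topology. It has a set of sections over every locally
Noetherian scheme `h : Y ⟶ X` over `X`, on which the units of `Y` act simply transitively; sections
glue along fppf coverings, and exist fppf locally on `X`. Restriction along `k : Z ⟶ Y` takes values
in the sections over any `h'` equal to `k ≫ h`, so that no transport along equalities of morphisms
is needed. -/
structure GmTorsor (X : Scheme.{u}) where
  sec {Y : Scheme.{u}} [IsLocallyNoetherian Y] (h : Y ⟶ X) : Type u
  act {Y : Scheme.{u}} [IsLocallyNoetherian Y] (h : Y ⟶ X) : MulAction (gm Y) (sec h)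
  res {Y Z : Scheme.{u}} [IsLocallyNoetherian Y] [IsLocallyNoetherian Z] (k : Z ⟶ Y)
    {h : Y ⟶ X} {h' : Z ⟶ X} (w : k ≫ h = h') : sec h → sec h'
  res_id {Y : Scheme.{u}} [IsLocallyNoetherian Y] {h : Y ⟶ X} (w : 𝟙 Y ≫ h = h) (s : sec h) :
    res (𝟙 Y) w s = s
  res_res {Y Z W : Scheme.{u}} [IsLocallyNoetherian Y] [IsLocallyNoetherian Z]
    [IsLocallyNoetherian W] (k : Z ⟶ Y) (l : W ⟶ Z) {h : Y ⟶ X} {h' : Z ⟶ X} {h'' : W ⟶ X}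
    (w : k ≫ h = h') (w' : l ≫ h' = h'') (w'' : (l ≫ k) ≫ h = h'') (s : sec h) :
    res l w' (res k w s) = res (l ≫ k) w'' s
  res_smul {Y Z : Scheme.{u}} [IsLocallyNoetherian Y] [IsLocallyNoetherian Z] (k : Z ⟶ Y)
    {h : Y ⟶ X} {h' : Z ⟶ X} (w : k ≫ h = h') (c : gm Y) (s : sec h) :
    res k w (c • s) = gmMap k c • res k w s
  existsUnique_smul {Y : Scheme.{u}} [IsLocallyNoetherian Y] {h : Y ⟶ X} (s t : sec h) :
    ∃! c : gm Y, c • s = t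
  glue {ι : Type u} {Y : Scheme.{u}} [IsLocallyNoetherian Y] {Z : ι → Scheme.{u}}
    [∀ i, IsLocallyNoetherian (Z i)] {k : ∀ i, Z i ⟶ Y} (hk : IsFppfCover k) (h : Y ⟶ X)
    (s : ∀ i, sec (k i ≫ h))
    (hs : ∀ i j {W : Scheme.{u}} [IsLocallyNoetherian W] (p : W ⟶ Z i) (q : W ⟶ Z j)
      (_ : p ≫ k i = q ≫ k j) (h' : W ⟶ X) (wp : p ≫ k i ≫ h = h') (wq : q ≫ k j ≫ h = h'),
      res p wp (s i) = res q wq (s j)) :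
    ∃ t : sec h, ∀ i, res (k i) rfl t = s i
  locally_nonempty (x : X) : ∃ (Y : Scheme.{u}) (_ : IsLocallyNoetherian Y) (k : Y ⟶ X)
    (_ : Flat k) (_ : LocallyOfFinitePresentation k) (y : Y), k y = x ∧ Nonempty (sec k)

namespace GmTorsor

attribute [instance] GmTorsor.act

variable {X : Scheme.{u}}

section
variable (P : GmTorsor X)
variable {Y Z : Scheme.{u}} [IsLocallyNoetherian Y] [IsLocallyNoetherian Z]

/-- The unit by which two sections of a torsor differ. -/
noncomputable def div {h : Y ⟶ X} (t s : P.sec h) : gm Y := (P.existsUnique_smul s t).choose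

@[simp]
theorem div_smul {h : Y ⟶ X} (t s : P.sec h) : P.div t s • s = t :=
  (P.existsUnique_smul s t).choose_spec.1

theorem eq_div {h : Y ⟶ X} {t s : P.sec h} {c : gm Y} (hc : c • s = t) : c = P.div t s :=
  (P.existsUnique_smul s t).choose_spec.2 c hc

theorem smul_left_cancel {h : Y ⟶ X} {s : P.sec h} {c c' : gm Y} (hc : c • s = c' • s) : c = c' :=
  (P.eq_div hc).trans (P.eq_div rfl).symm

theorem gmMap_div (k : Z ⟶ Y) {h : Y ⟶ X} {h' : Z ⟶ X} (w : k ≫ h = h') (t s : P.sec h) :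
    gmMap k (P.div t s) = P.div (P.res k w t) (P.res k w s) :=
  P.eq_div (by rw [← P.res_smul, P.div_smul])

theorem res_congr {k k' : Z ⟶ Y} (e : k = k') {h : Y ⟶ X} {h' : Z ⟶ X} (w : k ≫ h = h')
    (w' : k' ≫ h = h') (s : P.sec h) : P.res k w s = P.res k' w' s := by
  subst e; rfl

theorem ext {ι : Type*} {Z : ι → Scheme.{u}} [∀ i, IsLocallyNoetherian (Z i)]
    {k : ∀ i, Z i ⟶ Y} (hk : IsFppfCover k) {h : Y ⟶ X} {s t : P.sec h}
    (hst : ∀ i, P.res (k i) rfl s = P.res (k i) rfl t) : s = t := by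
  rw [← P.div_smul s t, hk.gm_ext (s := P.div s t) (t := 1) fun i => ?_, one_smul]
  rw [map_one, P.gmMap_div (k i) rfl, hst]
  exact (P.eq_div (one_smul _ _)).symm

theorem exists_cover : ∃ (Z : X → Scheme.{u}) (_ : ∀ x, IsLocallyNoetherian (Z x))
    (k : ∀ x, Z x ⟶ X), IsFppfCover k ∧ ∀ x, Nonempty (P.sec (k x)) := by
  choose Z hZ k h1 h2 z h3 h4 using P.locally_nonempty
  exact ⟨Z, hZ, k, ⟨h1, h2, fun x => ⟨x, z x, h3 x⟩⟩, h4⟩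

end

/-- A morphism of torsors: a natural equivariant map. It is automatically bijective. -/
structure Hom (P Q : GmTorsor X) where
  app {Y : Scheme.{u}} [IsLocallyNoetherian Y] {h : Y ⟶ X} : P.sec h → Q.sec h
  app_res {Y Z : Scheme.{u}} [IsLocallyNoetherian Y] [IsLocallyNoetherian Z] (k : Z ⟶ Y)
    {h : Y ⟶ X} {h' : Z ⟶ X} (w : k ≫ h = h') (s : P.sec h) :
    app (P.res k w s) = Q.res k w (app s)
  app_smul {Y : Scheme.{u}} [IsLocallyNoetherian Y] {h : Y ⟶ X} (c : gm Y) (s : P.sec h) :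
    app (c • s) = c • app s

namespace Hom

variable {P Q R : GmTorsor X}

/-- Composition of morphisms of torsors. -/
def comp (Φ : Hom P Q) (Ψ : Hom Q R) : Hom P R where
  app s := Ψ.app (Φ.app s)
  app_res k _ _ w s := by rw [Φ.app_res, Ψ.app_res]
  app_smul c s := by rw [Φ.app_smul, Ψ.app_smul]

variable (P) in
/-- The identity of a torsor. -/
def id : Hom P P where
  app s := s
  app_res _ _ _ _ _ := rfl
  app_smul _ _ := rfl

/-- The composition of a morphism of torsors with multiplication by a unit on the base. -/
noncomputable def twist (Φ : Hom P Q) (c : gm X) : Hom P Q where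
  app {_ _ h} s := gmMap h c • Φ.app s
  app_res k _ _ w s := by
    subst w
    rw [Φ.app_res, Q.res_smul, gmMap_comp]
  app_smul d s := by rw [Φ.app_smul, smul_smul, smul_smul, mul_comm]

variable {Y : Scheme.{u}} [IsLocallyNoetherian Y] {h : Y ⟶ X}

theorem div_app (Φ : Hom P Q) (s t : P.sec h) : Q.div (Φ.app s) (Φ.app t) = P.div s t :=
  (Q.eq_div (by rw [← Φ.app_smul, P.div_smul])).symm

theorem injective_app (Φ : Hom P Q) : Function.Injective (Φ.app : P.sec h → Q.sec h) := by
  intro s t hst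
  have := Φ.div_app s t
  rw [hst, ← Q.eq_div (one_smul _ _)] at this
  rw [← P.div_smul s t, ← this, one_smul]

/-- A morphism of torsors is surjective, by gluing of the preimages, which exist wherever the source
has sections. -/
theorem surjective_app [IsLocallyNoetherian X] (Φ : Hom P Q) :
    Function.Surjective (Φ.app : P.sec h → Q.sec h) := by
  intro t
  obtain ⟨Z, hZ, k, hk, hs⟩ := P.exists_cover
  have hk' := hk.pullback_fst h
  have := hk'.isLocallyNoetherian
  let s (x) : P.sec (pullback.fst h (k x) ≫ h) :=
    P.res (pullback.snd h (k x)) pullback.condition.symm (hs x).some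
  let s' (x) : P.sec (pullback.fst h (k x) ≫ h) :=
    Q.div (Q.res (pullback.fst h (k x)) rfl t) (Φ.app (s x)) • s x
  have hs' (x) : Φ.app (s' x) = Q.res (pullback.fst h (k x)) rfl t := by
    rw [Φ.app_smul, Q.div_smul]
  obtain ⟨r, hr⟩ := P.glue hk' h s' (fun i j W _ p q e h' wp wq => by
    apply Φ.injective_app
    rw [Φ.app_res, Φ.app_res, hs', hs', Q.res_res _ _ _ _ ((Category.assoc _ _ _).trans wp),
      Q.res_res _ _ _ _ ((Category.assoc _ _ _).trans wq)]
    exact Q.res_congr e _ _ _)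
  exact ⟨r, Q.ext hk' fun x => by rw [← Φ.app_res, hr, hs']⟩

/-- The inverse of a morphism of torsors. -/
noncomputable def symm [IsLocallyNoetherian X] (Φ : Hom P Q) : Hom Q P where
  app t := (Φ.surjective_app t).choose
  app_res k _ _ w t := Φ.injective_app (by
    rw [Φ.app_res, (Φ.surjective_app _).choose_spec, (Φ.surjective_app _).choose_spec])
  app_smul c t := Φ.injective_app (by
    rw [Φ.app_smul, (Φ.surjective_app _).choose_spec, (Φ.surjective_app _).choose_spec])

/-- Two morphisms of torsors differ by a unit on the base. -/
theorem exists_twist (Φ Ψ : Hom P Q) : ∃ c : gm X,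
    ∀ {Y : Scheme.{u}} [IsLocallyNoetherian Y] {h : Y ⟶ X} (s : P.sec h),
      Ψ.app s = gmMap h c • Φ.app s := by
  obtain ⟨Z, hZ, k, hk, hs⟩ := P.exists_cover
  have key {Y : Scheme.{u}} [IsLocallyNoetherian Y] {h : Y ⟶ X} (s t : P.sec h) :
      Q.div (Ψ.app s) (Φ.app s) = Q.div (Ψ.app t) (Φ.app t) := by
    refine (Q.eq_div ?_).symm
    nth_rw 1 [← P.div_smul s t]
    rw [Φ.app_smul, smul_comm, Q.div_smul, ← Ψ.app_smul, P.div_smul]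
  obtain ⟨c, hc⟩ := hk.exists_gm (fun x => Q.div (Ψ.app (hs x).some) (Φ.app (hs x).some))
    (fun i j W _ p q e => by
      rw [Q.gmMap_div p rfl, Q.gmMap_div q e.symm, ← Φ.app_res, ← Φ.app_res, ← Ψ.app_res,
        ← Ψ.app_res]
      exact key _ _)
  refine ⟨c, fun {Y} _ {h} s => ?_⟩
  suffices gmMap h c = Q.div (Ψ.app s) (Φ.app s) by rw [this, Q.div_smul]
  have hk' := hk.pullback_fst h
  have := hk'.isLocallyNoetherian
  refine hk'.gm_ext fun x => ?_
  rw [← gmMap_comp, pullback.condition, gmMap_comp, hc,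
    Q.gmMap_div (pullback.snd h (k x)) pullback.condition.symm,
    Q.gmMap_div (pullback.fst h (k x)) rfl, ← Φ.app_res, ← Φ.app_res, ← Ψ.app_res, ← Ψ.app_res]
  exact key _ _

/-- Morphisms of torsors that are given on local sections glue: it suffices to know the images
`r i` of a family of sections `q i` over a covering, provided that relations between the `q i` also
hold between the `r i`. -/
theorem exists_of_cover [IsLocallyNoetherian X] {ι : Type u} {Z : ι → Scheme.{u}}
    [∀ i, IsLocallyNoetherian (Z i)]
    {k : ∀ i, Z i ⟶ X} (hk : IsFppfCover k) (q : ∀ i, P.sec (k i)) (r : ∀ i, Q.sec (k i))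
    (H : ∀ i j {W : Scheme.{u}} [IsLocallyNoetherian W] (a : W ⟶ Z i) (b : W ⟶ Z j)
      (e : b ≫ k j = a ≫ k i) (c : gm W), P.res a rfl (q i) = c • P.res b e (q j) →
      Q.res a rfl (r i) = c • Q.res b e (r j)) :
    Nonempty (Hom P Q) := by
  have main {Y : Scheme.{u}} [IsLocallyNoetherian Y] {h : Y ⟶ X} (s : P.sec h) : ∃ t : Q.sec h,
      ∀ i {W : Scheme.{u}} [IsLocallyNoetherian W] (a : W ⟶ Y) (b : W ⟶ Z i)
        (h' : W ⟶ X) (w : a ≫ h = h') (e : b ≫ k i = h') (c : gm W),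
        P.res a w s = c • P.res b e (q i) → Q.res a w t = c • Q.res b e (r i) := by
    have hk' := hk.pullback_fst h
    have := hk'.isLocallyNoetherian
    let c (i) : gm (pullback h (k i)) := P.div (P.res (pullback.fst h (k i)) rfl s)
      (P.res (pullback.snd h (k i)) pullback.condition.symm (q i))
    obtain ⟨t, ht⟩ := Q.glue hk' h
      (fun i => c i • Q.res (pullback.snd h (k i)) pullback.condition.symm (r i))
      (fun i j W _ a b e h' wa wb => by
        have hh : (a ≫ pullback.snd h (k i)) ≫ k i = h' := by
          rw [Category.assoc, ← pullback.condition, wa]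
        subst hh
        have hb : (b ≫ pullback.snd h (k j)) ≫ k j = (a ≫ pullback.snd h (k i)) ≫ k i := by
          rw [Category.assoc, ← pullback.condition, wb]
        rw [Q.res_smul, Q.res_smul, Q.res_res _ _ _ _ rfl, Q.res_res _ _ _ _ hb]
        rw [H i j (a ≫ pullback.snd h (k i)) (b ≫ pullback.snd h (k j)) hb
          ((gmMap a (c i))⁻¹ * gmMap b (c j)), smul_smul, mul_inv_cancel_left]
        rw [mul_smul, eq_inv_smul_iff, ← P.res_res _ a pullback.condition.symm wa,
          ← P.res_res _ b pullback.condition.symm wb, ← P.res_smul, ← P.res_smul, P.div_smul,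
          P.div_smul, P.res_res _ _ _ _ ((Category.assoc _ _ _).trans wa),
          P.res_res _ _ _ _ ((Category.assoc _ _ _).trans wb)]
        exact P.res_congr e _ _ _)
    refine ⟨t, fun i W _ a b h' wa e d hd => ?_⟩
    subst wa
    have e1 : pullback.lift a b e.symm ≫ pullback.fst h (k i) = a := pullback.lift_fst _ _ _
    have e2 : pullback.lift a b e.symm ≫ pullback.snd h (k i) = b := pullback.lift_snd _ _ _
    have w : pullback.lift a b e.symm ≫ pullback.fst h (k i) ≫ h = a ≫ h := by
      rw [← Category.assoc, e1]
    have w' : (pullback.lift a b e.symm ≫ pullback.snd h (k i)) ≫ k i = a ≫ h := by rw [e2, e]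
    have h1 := congrArg (Q.res (pullback.lift a b e.symm) w) (ht i)
    rw [Q.res_res _ _ _ _ ((Category.assoc _ _ _).trans w), Q.res_smul,
      Q.res_res _ _ _ _ w', Q.res_congr e1 _ rfl, Q.res_congr e2 _ e] at h1
    rw [h1]
    congr 1
    rw [P.gmMap_div _ w, P.res_res _ _ _ _ ((Category.assoc _ _ _).trans w),
      P.res_res _ _ _ _ w', P.res_congr e1 _ rfl, P.res_congr e2 _ e]
    exact (P.eq_div hd.symm).symm
  have uniq {Y : Scheme.{u}} [IsLocallyNoetherian Y] {h : Y ⟶ X} (s : P.sec h) {t t' : Q.sec h}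
      (ht : ∀ i {W : Scheme.{u}} [IsLocallyNoetherian W] (a : W ⟶ Y) (b : W ⟶ Z i)
        (h' : W ⟶ X) (w : a ≫ h = h') (e : b ≫ k i = h') (c : gm W),
        P.res a w s = c • P.res b e (q i) → Q.res a w t = c • Q.res b e (r i))
      (ht' : ∀ i {W : Scheme.{u}} [IsLocallyNoetherian W] (a : W ⟶ Y) (b : W ⟶ Z i)
        (h' : W ⟶ X) (w : a ≫ h = h') (e : b ≫ k i = h') (c : gm W),
        P.res a w s = c • P.res b e (q i) → Q.res a w t' = c • Q.res b e (r i)) : t = t' := by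
    have hk' := hk.pullback_fst h
    have := hk'.isLocallyNoetherian
    refine Q.ext hk' fun i => ?_
    rw [ht i _ (pullback.snd h (k i)) _ rfl pullback.condition.symm _ (P.div_smul _ _).symm,
      ht' i _ (pullback.snd h (k i)) _ rfl pullback.condition.symm _ (P.div_smul _ _).symm]
  refine ⟨⟨fun s => (main s).choose, fun {Y Z'} _ _ f {h h'} w s => ?_, fun {Y} _ {h} d s => ?_⟩⟩
  · refine uniq _ (main _).choose_spec fun i {W} _ a b h'' wa e c hc => ?_
    have w1 : (a ≫ f) ≫ h = h'' := by rw [Category.assoc, w, wa]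
    rw [Q.res_res _ _ _ _ w1]
    rw [P.res_res _ _ _ _ w1] at hc
    exact (main s).choose_spec i (a ≫ f) b h'' w1 e c hc
  · refine uniq _ (main _).choose_spec fun i {W} _ a b h'' wa e c hc => ?_
    rw [Q.res_smul, (main s).choose_spec i a b h'' wa e ((gmMap a d)⁻¹ * c), smul_smul,
      mul_inv_cancel_left]
    rw [mul_smul, ← hc, P.res_smul, inv_smul_smul]

end Hom

section
variable {X' : Scheme.{u}} [IsLocallyNoetherian X']

/-- The pullback of a torsor along `q : X' ⟶ X`: its sections over `h` are the sections of the
given torsor over `h ≫ q`. -/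
noncomputable def restrict (P : GmTorsor X) (q : X' ⟶ X) : GmTorsor X' where
  sec h := P.sec (h ≫ q)
  act h := P.act (h ≫ q)
  res k _ _ w := P.res k (by rw [← w, Category.assoc])
  res_id w s := P.res_id _ s
  res_res k l _ _ _ w w' w'' s := P.res_res k l _ _ _ s
  res_smul k _ _ w c s := P.res_smul k _ c s
  existsUnique_smul s t := P.existsUnique_smul s t
  glue {ι Y _ Z _ k} hk h s hs := by
    have w (i) : 𝟙 _ ≫ (k i ≫ h) ≫ q = k i ≫ (h ≫ q) := by simp
    obtain ⟨t, ht⟩ := P.glue hk (h ≫ q) (fun i => P.res (𝟙 _) (w i) (s i))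
      (fun i j W _ a b e h' wa wb => by
        have wa' : a ≫ (k i ≫ h) ≫ q = h' := by rw [← wa]; simp
        have wb' : b ≫ (k j ≫ h) ≫ q = h' := by rw [← wb]; simp
        have h1 : b ≫ k j ≫ h = a ≫ k i ≫ h := by
          rw [← Category.assoc, ← e, Category.assoc]
        have := congrArg (P.res (𝟙 W) (h := (a ≫ k i ≫ h) ≫ q) (h' := h') (by rw [← wa']; simp))
          (hs i j a b e _ rfl h1)
        rw [P.res_res _ _ _ _ (by simpa using wa'), P.res_res _ _ _ _ (by simpa using wb')] at this
        rw [P.res_res _ _ _ _ (by simpa using wa'), P.res_res _ _ _ _ (by simpa using wb')]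
        simpa using this)
    refine ⟨t, fun i => ?_⟩
    have := congrArg (P.res (𝟙 _) (h' := (k i ≫ h) ≫ q) (by simp)) (ht i)
    rw [P.res_res _ _ _ _ (by simp), P.res_res _ _ _ _ (by simp)] at this
    simpa [P.res_id] using this
  locally_nonempty x := by
    obtain ⟨Y, hY, k, h1, h2, y, hy, ⟨s⟩⟩ := P.locally_nonempty (q x)
    obtain ⟨z, hz, -⟩ := Scheme.Pullback.exists_preimage_pullback x y hy.symm
    have : IsLocallyNoetherian (pullback q k) :=
      LocallyOfFiniteType.isLocallyNoetherian (pullback.fst q k)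
    exact ⟨pullback q k, this, pullback.fst q k, inferInstance, inferInstance, z, hz,
      ⟨P.res (pullback.snd q k) pullback.condition.symm s⟩⟩

/-- The pullback of a morphism of torsors. -/
noncomputable def Hom.restrict {P Q : GmTorsor X} (Φ : Hom P Q) (q : X' ⟶ X) :
    Hom (P.restrict q) (Q.restrict q) where
  app s := Φ.app s
  app_res k _ _ _ s := Φ.app_res k _ s
  app_smul c s := Φ.app_smul c s

end

end GmTorsor

/-! ### Hilbert 90 -/

section
open TensorProduct

/-- Hilbert 90 for a flat algebra `A`: if `v` is a cocycle, that is, a unit of `A ⊗ A` with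
`v₂₃ v₁₂ = v₁₃`, then the elements `m` with `v (m ⊗ 1) = 1 ⊗ m` generate the unit ideal of `A`.
Indeed, by flatness the tensors `∑ bᵢ ⊗ aᵢ` with `aᵢ` in this submodule are cut out in `A ⊗ A` by the
same equation, which is satisfied by `v`; and multiplication maps `v` to `1`. -/
theorem span_eq_top_of_cocycle {R A : Type*} [CommRing R] [CommRing A] [Algebra R A]
    [Module.Flat R A] (v : (A ⊗[R] A)ˣ)
    (hv : (Algebra.TensorProduct.includeRight (R := R) (A := A) (B := A ⊗[R] A)) v *
      (Algebra.TensorProduct.map (AlgHom.id R A)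
        (Algebra.TensorProduct.includeLeft (R := R) (S := R) (A := A) (B := A))) v =
      (Algebra.TensorProduct.map (AlgHom.id R A)
        (Algebra.TensorProduct.includeRight (R := R) (A := A) (B := A))) v) :
    Ideal.span {m : A | (v : A ⊗[R] A) * (m ⊗ₜ 1) = 1 ⊗ₜ m} = ⊤ := by
  let δ : A →ₗ[R] A ⊗[R] A :=
    (LinearMap.mulLeft R (v : A ⊗[R] A)) ∘ₗ
        (Algebra.TensorProduct.includeLeft (R := R) (S := R) (A := A) (B := A)).toLinearMap -
      (Algebra.TensorProduct.includeRight (R := R) (A := A) (B := A)).toLinearMap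
  have hδ (m : A) : δ m = (v : A ⊗[R] A) * (m ⊗ₜ 1) - 1 ⊗ₜ m := rfl
  have key (w : A ⊗[R] A) : TensorProduct.AlgebraTensorModule.lTensor A A δ w =
      (Algebra.TensorProduct.includeRight (R := R) (A := A) (B := A ⊗[R] A)) v *
      (Algebra.TensorProduct.map (AlgHom.id R A)
        (Algebra.TensorProduct.includeLeft (R := R) (S := R) (A := A) (B := A))) w -
      (Algebra.TensorProduct.map (AlgHom.id R A)
        (Algebra.TensorProduct.includeRight (R := R) (A := A) (B := A))) w := by
    induction w using TensorProduct.induction_on with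
    | zero => simp
    | tmul b a =>
      simp [hδ, TensorProduct.tmul_sub]
    | add x y hx hy =>
      rw [map_add, hx, hy, map_add, map_add]
      ring
  have hker : (v : A ⊗[R] A) ∈ LinearMap.ker (TensorProduct.AlgebraTensorModule.lTensor A A δ) := by
    rw [LinearMap.mem_ker, key, hv, sub_self]
  rw [Module.Flat.ker_lTensor_eq] at hker
  obtain ⟨t, ht⟩ := hker
  have hμ : Algebra.TensorProduct.lmul' R (S := A) (v : A ⊗[R] A) = 1 := by
    let μ₃ : A ⊗[R] (A ⊗[R] A) →ₐ[R] A :=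
      (Algebra.TensorProduct.lmul' R).comp
        (Algebra.TensorProduct.map (AlgHom.id R A) (Algebra.TensorProduct.lmul' R))
    have h1 : μ₃.comp (Algebra.TensorProduct.includeRight (R := R) (A := A) (B := A ⊗[R] A)) =
        Algebra.TensorProduct.lmul' R := by ext <;> simp [μ₃]
    have h2 : μ₃.comp (Algebra.TensorProduct.map (AlgHom.id R A)
        (Algebra.TensorProduct.includeLeft (R := R) (S := R) (A := A) (B := A))) =
        Algebra.TensorProduct.lmul' R := by ext <;> simp [μ₃]
    have h3 : μ₃.comp (Algebra.TensorProduct.map (AlgHom.id R A)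
        (Algebra.TensorProduct.includeRight (R := R) (A := A) (B := A))) =
        Algebra.TensorProduct.lmul' R := by ext <;> simp [μ₃]
    have h := congrArg μ₃ hv
    rw [map_mul] at h
    have h1' := DFunLike.congr_fun h1 (v : A ⊗[R] A)
    have h2' := DFunLike.congr_fun h2 (v : A ⊗[R] A)
    have h3' := DFunLike.congr_fun h3 (v : A ⊗[R] A)
    rw [AlgHom.comp_apply] at h1' h2' h3'
    rw [h1', h2', h3'] at h
    exact (v.isUnit.map (Algebra.TensorProduct.lmul' R (S := A))).mul_left_cancel
      (h.trans (mul_one _).symm)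
  have hmem (t : A ⊗[R] LinearMap.ker δ) : Algebra.TensorProduct.lmul' R (S := A)
      (TensorProduct.AlgebraTensorModule.lTensor A A (LinearMap.ker δ).subtype t) ∈
        Ideal.span {m : A | (v : A ⊗[R] A) * (m ⊗ₜ 1) = 1 ⊗ₜ m} := by
    induction t using TensorProduct.induction_on with
    | zero => simp
    | tmul b m =>
      have : (m : A) ∈ Ideal.span {m : A | (v : A ⊗[R] A) * (m ⊗ₜ 1) = 1 ⊗ₜ m} :=
        Ideal.subset_span (sub_eq_zero.1 ((hδ m).symm.trans m.2))
      simpa using Ideal.mul_mem_left _ b this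
    | add x y hx hy =>
      rw [map_add, map_add]
      exact Ideal.add_mem _ hx hy
  have h1 := hmem t
  rw [ht, hμ] at h1
  exact (Ideal.eq_top_iff_one _).2 h1

end

theorem isUnit_of_le_basicOpen {Y : Scheme.{u}} {V : Y.Opens} (a : Γ(Y, V))
    (h : V ≤ Y.basicOpen a) : IsUnit a := by
  have h1 := RingedSpace.isUnit_res_basicOpen Y.toRingedSpace a
  have e : Y.basicOpen a = V := le_antisymm (Y.basicOpen_le a) h
  have := h1.map (Y.presheaf.map (eqToHom e.symm).op).hom
  convert! this
  refine Eq.trans ?_ (CommRingCat.comp_apply _ _ _)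
  erw [← Y.presheaf.map_comp]
  exact (congrArg (fun f : Γ(Y, V) ⟶ Γ(Y, V) => f a) (Y.presheaf.map_id _)).symm

theorem isUnit_appTop {Y Z : Scheme.{u}} (l : Z ⟶ Y) (a : Γ(Y, ⊤))
    (h : ∀ z, l z ∈ Y.basicOpen a) : IsUnit (l.appTop a) := by
  refine isUnit_of_le_basicOpen _ ?_
  rw [← Scheme.preimage_basicOpen_top]
  exact fun z _ => h z

/-- The pullback of an element of a ring `A` along a morphism to the spectrum of `A`. -/
noncomputable def specFn {A : CommRingCat.{u}} {Z : Scheme.{u}} (f : Z ⟶ Spec A) : A →+* Γ(Z, ⊤) :=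
  ((Scheme.ΓSpecIso A).inv ≫ f.appTop).hom

theorem specFn_comp {A : CommRingCat.{u}} {Z W : Scheme.{u}} (f : Z ⟶ Spec A) (g : W ⟶ Z) (a : A) :
    specFn (g ≫ f) a = g.appTop (specFn f a) := by
  simp only [specFn, Scheme.Hom.comp_appTop]
  rfl

theorem specFn_map {A B : CommRingCat.{u}} (φ : A ⟶ B) {Z : Scheme.{u}} (f : Z ⟶ Spec B) (a : A) :
    specFn (f ≫ Spec.map φ) a = specFn f (φ a) := by
  have := congrArg (fun g => (g ≫ f.appTop) a) (Scheme.ΓSpecIso_inv_naturality φ)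
  simp only [specFn, Scheme.Hom.comp_appTop]
  exact this.symm

theorem bijective_specFn_id (A : CommRingCat.{u}) : Function.Bijective (specFn (𝟙 (Spec A))) := by
  have : IsIso ((Scheme.ΓSpecIso A).inv ≫ (𝟙 (Spec A) : Spec A ⟶ Spec A).appTop) := by
    rw [Scheme.Hom.id_appTop]
    infer_instance
  exact (ConcreteCategory.isIso_iff_bijective _).1 this

namespace GmTorsor

variable {X : Scheme.{u}} (P : GmTorsor X)

open TensorProduct in
/-- Hilbert 90 for torsors, affine case: a section over a flat affine scheme over an affine open
gives rise to a section over an open neighbourhood of any point in the image. -/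
theorem exists_sec_of_affine [IsLocallyNoetherian X] {R A : Type u} [CommRing R] [CommRing A]
    [Algebra R A] [IsNoetherianRing R] [Algebra.FiniteType R A] [Module.Flat R A]
    [IsLocallyNoetherian (Spec (.of A))]
    (j : Spec (.of R) ⟶ X) [IsOpenImmersion j]
    (s : P.sec (Spec.map (CommRingCat.ofHom (algebraMap R A)) ≫ j)) (x : Spec (.of A)) :
    ∃ U : X.Opens, (Spec.map (CommRingCat.ofHom (algebraMap R A)) ≫ j) x ∈ U ∧
      Nonempty (P.sec U.ι) := by
  set φ := Spec.map (CommRingCat.ofHom (algebraMap R A)) with hφ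
  have : Algebra.FiniteType R (A ⊗[R] A) :=
    Algebra.FiniteType.trans (S := A) ‹_› (Algebra.FiniteType.baseChange A)
  have : Algebra.FiniteType R (A ⊗[R] (A ⊗[R] A)) :=
    Algebra.FiniteType.trans (S := A) ‹_› (Algebra.FiniteType.baseChange A)
  have : IsNoetherianRing (A ⊗[R] A) := Algebra.FiniteType.isNoetherianRing R _
  have : IsNoetherianRing (A ⊗[R] (A ⊗[R] A)) := Algebra.FiniteType.isNoetherianRing R _
  have : IsLocallyNoetherian (Spec (.of (A ⊗[R] A))) := inferInstance
  have : IsLocallyNoetherian (Spec (.of (A ⊗[R] (A ⊗[R] A)))) := inferInstance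
  -- the section differs by the unit `v` from itself over `Spec (A ⊗ A)`
  let f₁ : Spec (.of (A ⊗[R] A)) ⟶ Spec (.of A) :=
    Spec.map (CommRingCat.ofHom Algebra.TensorProduct.includeLeftRingHom)
  let f₂ : Spec (.of (A ⊗[R] A)) ⟶ Spec (.of A) :=
    Spec.map (CommRingCat.ofHom (Algebra.TensorProduct.includeRight (R := R) (A := A)).toRingHom)
  have hpb : IsPullback f₁ f₂ φ φ := isPullback_SpecMap_of_isPushout _ _ _ _
    (CommRingCat.isPushout_tensorProduct R A A)
  have w₂ : f₂ ≫ φ ≫ j = f₁ ≫ φ ≫ j := by rw [← Category.assoc, ← hpb.w, Category.assoc]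
  let c : gm (Spec (.of (A ⊗[R] A))) := P.div (P.res f₂ w₂ s) (P.res f₁ rfl s)
  let E : (A ⊗[R] A) ≃+* Γ(Spec (.of (A ⊗[R] A)), ⊤) :=
    RingEquiv.ofBijective _ (bijective_specFn_id (.of (A ⊗[R] A)))
  let v : (A ⊗[R] A)ˣ := Units.map E.symm.toMonoidHom c
  have hvc : specFn (𝟙 (Spec (.of (A ⊗[R] A)))) (v : A ⊗[R] A) = c := E.apply_symm_apply _
  have hv' {Z : Scheme.{u}} (g : Z ⟶ Spec (.of (A ⊗[R] A))) : specFn g (v : A ⊗[R] A) =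
      (gmMap g c : gm Z) := by
    rw [val_gmMap, ← hvc]
    exact (congrArg (fun g => specFn g (v : A ⊗[R] A)) (Category.comp_id g).symm).trans
      (specFn_comp _ _ _)
  have hc {Z : Scheme.{u}} [IsLocallyNoetherian Z] (g : Z ⟶ Spec (.of (A ⊗[R] A))) {h₁ h₂ : Z ⟶ _}
      (e₁ : g ≫ f₁ = h₁) (e₂ : g ≫ f₂ = h₂) {h : Z ⟶ X} (w : h₁ ≫ φ ≫ j = h)
      (w' : h₂ ≫ φ ≫ j = h) : P.res h₂ w' s = gmMap g c • P.res h₁ w s := by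
    subst e₁ e₂
    rw [← P.res_res _ g w₂ (by rw [← w, Category.assoc]),
      ← P.res_res _ g rfl (by rw [← w, Category.assoc]), P.gmMap_div, P.div_smul]
  -- it is a cocycle
  have hv : (Algebra.TensorProduct.includeRight (R := R) (A := A) (B := A ⊗[R] A)) v *
      (Algebra.TensorProduct.map (AlgHom.id R A)
        (Algebra.TensorProduct.includeLeft (R := R) (S := R) (A := A) (B := A))) v =
      (Algebra.TensorProduct.map (AlgHom.id R A)
        (Algebra.TensorProduct.includeRight (R := R) (A := A) (B := A))) v := by
    let p₂₃ : Spec (.of (A ⊗[R] (A ⊗[R] A))) ⟶ Spec (.of (A ⊗[R] A)) :=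
      Spec.map (CommRingCat.ofHom
        (Algebra.TensorProduct.includeRight (R := R) (A := A) (B := A ⊗[R] A)).toRingHom)
    let p₁₂ : Spec (.of (A ⊗[R] (A ⊗[R] A))) ⟶ Spec (.of (A ⊗[R] A)) :=
      Spec.map (CommRingCat.ofHom (Algebra.TensorProduct.map (AlgHom.id R A)
        (Algebra.TensorProduct.includeLeft (R := R) (S := R) (A := A) (B := A))).toRingHom)
    let p₁₃ : Spec (.of (A ⊗[R] (A ⊗[R] A))) ⟶ Spec (.of (A ⊗[R] A)) :=
      Spec.map (CommRingCat.ofHom (Algebra.TensorProduct.map (AlgHom.id R A)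
        (Algebra.TensorProduct.includeRight (R := R) (A := A) (B := A))).toRingHom)
    have e1 : p₁₃ ≫ f₁ = p₁₂ ≫ f₁ := by
      simp only [p₁₃, p₁₂, f₁, ← Spec.map_comp]
      congr 1
    have e2 : p₂₃ ≫ f₁ = p₁₂ ≫ f₂ := by
      simp only [p₂₃, p₁₂, f₁, f₂, ← Spec.map_comp]
      congr 1
    have e3 : p₁₃ ≫ f₂ = p₂₃ ≫ f₂ := by
      simp only [p₁₃, p₂₃, f₂, ← Spec.map_comp]
      congr 1
    have w12 : (p₁₂ ≫ f₂) ≫ φ ≫ j = (p₁₂ ≫ f₁) ≫ φ ≫ j := by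
      rw [Category.assoc, w₂, Category.assoc]
    have w23 : (p₂₃ ≫ f₂) ≫ φ ≫ j = (p₁₂ ≫ f₁) ≫ φ ≫ j := by
      rw [Category.assoc, w₂, ← Category.assoc, e2, w12]
    have h12 := hc p₁₂ rfl rfl rfl w12
    have h23 := hc p₂₃ e2 rfl w12 w23
    have h13 := hc p₁₃ e1 e3 rfl w23
    rw [h12, h13, smul_smul] at h23
    have h := congrArg Units.val (P.smul_left_cancel h23)
    rw [Units.val_mul, ← hv', ← hv', ← hv'] at h
    apply (bijective_specFn_id (.of (A ⊗[R] (A ⊗[R] A)))).1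
    rw [map_mul]
    have hid {p} (φ' : CommRingCat.of (A ⊗[R] A) ⟶ .of (A ⊗[R] (A ⊗[R] A)))
        (hp : Spec.map φ' = p) : specFn (𝟙 _) (φ' (v : A ⊗[R] A)) = specFn p (v : A ⊗[R] A) := by
      subst hp
      rw [← specFn_map, Category.id_comp]
    exact (congrArg₂ (· * ·) (hid (p := p₂₃) _ rfl) (hid (p := p₁₂) _ rfl)).trans
      (h.symm.trans (hid (p := p₁₃) _ rfl).symm)
  -- choose an element as in Hilbert 90 that does not vanish at the given point
  obtain ⟨m, hm, hmx⟩ : ∃ m : A, (v : A ⊗[R] A) * (m ⊗ₜ 1) = 1 ⊗ₜ m ∧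
      m ∉ (x : PrimeSpectrum A).asIdeal := by
    by_contra! hcon
    have : Ideal.span {m : A | (v : A ⊗[R] A) * (m ⊗ₜ 1) = 1 ⊗ₜ m} ≤
        (x : PrimeSpectrum A).asIdeal := Ideal.span_le.2 hcon
    rw [span_eq_top_of_cocycle v hv] at this
    exact (x : PrimeSpectrum A).isPrime.ne_top (top_le_iff.1 this)
  let D : (Spec (.of A)).Opens := PrimeSpectrum.basicOpen (R := A) m
  have hD : (Spec (.of A)).basicOpen ((Scheme.ΓSpecIso (.of A)).inv m) = D := basicOpen_eq_of_affine _
  have hu : IsUnit (specFn D.ι m) := isUnit_appTop D.ι ((Scheme.ΓSpecIso (.of A)).inv m)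
    fun z => by rw [hD]; exact z.2
  obtain ⟨d, hd⟩ := hu
  have : Flat φ := Flat.SpecMap_iff.2 (RingHom.flat_algebraMap_iff.2 ‹_›)
  have : LocallyOfFinitePresentation φ := (LocallyOfFinitePresentation.SpecMap_iff _).2
    (RingHom.finitePresentation_algebraMap.2 (Algebra.FinitePresentation.of_finiteType.1 ‹_›))
  let ψ : (D : Scheme.{u}) ⟶ X := D.ι ≫ φ ≫ j
  let U : X.Opens := ⟨Set.range ψ, ψ.isOpenMap.isOpen_range⟩
  refine ⟨U, ⟨⟨x, hmx⟩, rfl⟩, ?_⟩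
  have hcov : IsFppfCover (fun _ : PUnit.{u + 1} => pullback.fst U.ι ψ) :=
    { flat := fun _ => inferInstance
      lfp := fun _ => inferInstance
      exists_eq := fun y => by
        obtain ⟨z, hz⟩ := y.2
        obtain ⟨t, ht, -⟩ := Scheme.Pullback.exists_preimage_pullback (f := U.ι) (g := ψ) y z hz.symm
        exact ⟨⟨⟩, t, ht⟩ }
  have := hcov.isLocallyNoetherian
  let t : P.sec ψ := d⁻¹ • P.res D.ι rfl s
  obtain ⟨r, -⟩ := P.glue hcov U.ι (fun _ => P.res (pullback.snd U.ι ψ) pullback.condition.symm t)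
    (fun _ _ W _ a b e h' wa wb => by
      have wa' : (a ≫ pullback.snd U.ι ψ ≫ D.ι) ≫ φ ≫ j = h' := by
        rw [← wa, pullback.condition]; simp [ψ]
      have wb' : (b ≫ pullback.snd U.ι ψ ≫ D.ι) ≫ φ ≫ j = h' := by
        rw [← wb, pullback.condition]; simp [ψ]
      have hw : (a ≫ pullback.snd U.ι ψ ≫ D.ι) ≫ φ = (b ≫ pullback.snd U.ι ψ ≫ D.ι) ≫ φ := by
        rw [← cancel_mono j, Category.assoc, wa', Category.assoc, wb']
      have hg := hc (hpb.lift _ _ hw) (hpb.lift_fst _ _ hw) (hpb.lift_snd _ _ hw) wa' wb'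
      have wa'' : (a ≫ pullback.snd U.ι ψ) ≫ ψ = h' := by
        rw [← wa, pullback.condition, Category.assoc]
      have wb'' : (b ≫ pullback.snd U.ι ψ) ≫ ψ = h' := by
        rw [← wb, pullback.condition, Category.assoc]
      rw [P.res_res _ _ _ _ wa'', P.res_res _ _ _ _ wb'', P.res_smul, P.res_smul,
        P.res_res _ _ _ _ (by simpa using wa'), P.res_res _ _ _ _ (by simpa using wb'),
        map_inv, map_inv, inv_smul_eq_iff, smul_smul, mul_comm, mul_smul, eq_inv_smul_iff,
        P.res_congr (Category.assoc _ _ _) _ wa', P.res_congr (Category.assoc _ _ _) _ wb', hg,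
        smul_smul]
      congr 1
      ext
      have h1 := congrArg (specFn (hpb.lift _ _ hw)) hm
      rw [map_mul, hv'] at h1
      have h2 : specFn (hpb.lift _ _ hw) (m ⊗ₜ[R] 1 : A ⊗[R] A) =
          (gmMap (a ≫ pullback.snd U.ι ψ) d : gm W) := by
        rw [val_gmMap, hd, ← specFn_comp, Category.assoc]
        refine (specFn_map (CommRingCat.ofHom Algebra.TensorProduct.includeLeftRingHom)
          (hpb.lift _ _ hw) m).symm.trans ?_
        exact congrArg (fun g => specFn (A := .of A) g m) (hpb.lift_fst _ _ hw)
      have h3 : specFn (hpb.lift _ _ hw) (1 ⊗ₜ[R] m : A ⊗[R] A) =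
          (gmMap (b ≫ pullback.snd U.ι ψ) d : gm W) := by
        rw [val_gmMap, hd, ← specFn_comp, Category.assoc]
        refine (specFn_map (CommRingCat.ofHom
          (Algebra.TensorProduct.includeRight (R := R) (A := A)).toRingHom)
          (hpb.lift _ _ hw) m).symm.trans ?_
        exact congrArg (fun g => specFn (A := .of A) g m) (hpb.lift_snd _ _ hw)
      rw [h2, h3] at h1
      rw [← h1, mul_comm]
      rfl)
  exact ⟨r⟩

/-- Hilbert 90 for torsors: an fppf torsor has sections locally in the Zariski topology. -/
theorem exists_sec_opens [IsLocallyNoetherian X] (x : X) :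
    ∃ U : X.Opens, x ∈ U ∧ Nonempty (P.sec U.ι) := by
  obtain ⟨Y, hY, k, h1, h2, y, rfl, ⟨s⟩⟩ := P.locally_nonempty x
  obtain ⟨V, hV, hxV, -⟩ := exists_isAffineOpen_mem_and_subset (Opens.mem_top (k y))
  obtain ⟨W, hW, hyW, hWV⟩ := exists_isAffineOpen_mem_and_subset (U := k ⁻¹ᵁ V) (x := y) hxV
  let φ := k.appLE V W hWV
  algebraize [φ.hom]
  have : IsNoetherianRing Γ(X, V) := IsLocallyNoetherian.component_noetherian ⟨V, hV⟩
  have : Algebra.FinitePresentation Γ(X, V) Γ(Y, W) := k.finitePresentation_appLE hV hW hWV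
  have : Module.Flat Γ(X, V) Γ(Y, W) := k.flat_appLE hV hW hWV
  have : IsNoetherianRing Γ(Y, W) := Algebra.FiniteType.isNoetherianRing Γ(X, V) _
  have hYn : IsLocallyNoetherian (Spec (.of Γ(Y, W))) := inferInstance
  have e : hW.fromSpec ≫ k = Spec.map φ ≫ hV.fromSpec := (hV.SpecMap_appLE_fromSpec k hW hWV).symm
  obtain ⟨z, rfl⟩ : y ∈ Set.range hW.fromSpec := by rw [hW.range_fromSpec]; exact hyW
  have : IsLocallyNoetherian (Spec Γ(Y, W)) := hYn
  obtain ⟨U, hU, hs⟩ := P.exists_sec_of_affine (R := Γ(X, V)) (A := Γ(Y, W)) hV.fromSpec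
    (P.res hW.fromSpec e s) z
  refine ⟨U, ?_, hs⟩
  rw [← Scheme.Hom.comp_apply, e]
  exact hU

end GmTorsor

/-! ### The torsor of a line bundle -/

section
variable {X : Scheme.{u}} (L : X.Modules)

/-- Restriction of sections of a sheaf of modules. -/
noncomputable def mres {U V : X.Opens} (i : V ≤ U) (m : Γ(L, U)) : Γ(L, V) :=
  L.presheaf.map (homOfLE i).op m

theorem mres_mres {U V W : X.Opens} (i : V ≤ U) (j : W ≤ V) (m : Γ(L, U)) :
    mres L j (mres L i m) = mres L (j.trans i) m := by
  have := L.presheaf.map_comp (homOfLE i).op (homOfLE j).op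
  exact (congrArg (fun f => f m) this).symm

@[simp]
theorem mres_self {U : X.Opens} (i : U ≤ U) (m : Γ(L, U)) : mres L i m = m :=
  congrArg (fun f => f m) (L.presheaf.map_id (op U))

theorem mres_add {U V : X.Opens} (i : V ≤ U) (m n : Γ(L, U)) :
    mres L i (m + n) = mres L i m + mres L i n := map_add _ _ _

theorem mres_smul {U V : X.Opens} (i : V ≤ U) (a : Γ(X, U)) (m : Γ(L, U)) :
    mres L i (a • m) = X.presheaf.map (homOfLE i).op a • mres L i m :=
  Scheme.Modules.map_smul _ _ _ _

theorem mres_app {L L' : X.Modules} (f : L ⟶ L') {U V : X.Opens} (i : V ≤ U) (m : Γ(L, U)) :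
    f.app V (mres L i m) = mres L' i (f.app U m) :=
  congrArg (fun g => g m) (f.mapPresheaf.naturality (homOfLE i).op)

variable {L}

/-- A section over `U` generates `L` over `U` if over every smaller open set each section of `L` is
a unique multiple of it. -/
def IsGenerator {U : X.Opens} (e : Γ(L, U)) : Prop :=
  ∀ ⦃V : X.Opens⦄ (i : V ≤ U), Function.Bijective (fun a : Γ(X, V) => a • mres L i e)

variable (L) in
/-- A sheaf of modules is a line bundle if it is generated locally by one section. -/
def IsLineBundle : Prop := ∀ x : X, ∃ (U : X.Opens) (_ : x ∈ U) (e : Γ(L, U)), IsGenerator e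

theorem IsGenerator.mres {U V : X.Opens} {e : Γ(L, U)} (he : IsGenerator e) (i : V ≤ U) :
    IsGenerator (mres L i e) := by
  intro W j
  rw [mres_mres]
  exact he _

/-- The coefficient of a section with respect to a generator, over the intersection of their
domains. -/
noncomputable def IsGenerator.coeff {U : X.Opens} {e : Γ(L, U)} (he : IsGenerator e) {V : X.Opens}
    (m : Γ(L, V)) : Γ(X, V ⊓ U) :=
  ((he (inf_le_right : V ⊓ U ≤ U)).2 (PicardFunctor.mres L inf_le_left m)).choose

theorem IsGenerator.coeff_smul {U : X.Opens} {e : Γ(L, U)} (he : IsGenerator e) {V : X.Opens}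
    (m : Γ(L, V)) :
    he.coeff m • PicardFunctor.mres L inf_le_right e = PicardFunctor.mres L inf_le_left m :=
  ((he (inf_le_right : V ⊓ U ≤ U)).2 (PicardFunctor.mres L inf_le_left m)).choose_spec

theorem IsGenerator.eq_coeff {U : X.Opens} {e : Γ(L, U)} (he : IsGenerator e) {V : X.Opens}
    {m : Γ(L, V)} {a : Γ(X, V ⊓ U)}
    (ha : a • PicardFunctor.mres L inf_le_right e = PicardFunctor.mres L inf_le_left m) :
    he.coeff m = a :=
  (he (inf_le_right : V ⊓ U ≤ U)).1 ((he.coeff_smul m).trans ha.symm)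

end

section
variable {X Y Z : Scheme.{u}}

/-- A coframe of a sheaf of modules `L` on `X` over `h : Y ⟶ X`: an `𝒪_X`-linear map from `L` to
`h_* 𝒪_Y` such that the values of `L` generate `𝒪_Y`. For a line bundle these are the isomorphisms
from `h^* L` to `𝒪_Y`. -/
structure Coframe (L : X.Modules) (h : Y ⟶ X) where
  toFun {V : X.Opens} (m : Γ(L, V)) : Γ(Y, h ⁻¹ᵁ V)
  map_add {V : X.Opens} (m n : Γ(L, V)) : toFun (m + n) = toFun m + toFun n
  map_smul {V : X.Opens} (a : Γ(X, V)) (m : Γ(L, V)) : toFun (a • m) = h.app V a * toFun m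
  map_res {U V : X.Opens} (i : V ≤ U) (m : Γ(L, U)) :
    toFun (mres L i m) = Y.presheaf.map (homOfLE (h.preimage_mono i)).op (toFun m)
  frame (y : Y) : ∃ (V : X.Opens) (m : Γ(L, V)), y ∈ Y.basicOpen (toFun m)

namespace Coframe

variable {L : X.Modules} {h : Y ⟶ X}

@[ext]
theorem ext {ψ χ : Coframe L h} (H : ∀ {V : X.Opens} (m : Γ(L, V)), ψ.toFun m = χ.toFun m) :
    ψ = χ := by
  cases ψ; cases χ
  congr 1
  funext V m
  exact H m

theorem top_le_preimage {l : Z ⟶ Y} {h : Y ⟶ X} {V : X.Opens} (hl : ∀ z, h (l z) ∈ V) :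
    ⊤ ≤ l ⁻¹ᵁ (h ⁻¹ᵁ V) := fun z _ => hl z

theorem top_le_comp_preimage {l : Z ⟶ Y} {h : Y ⟶ X} {V : X.Opens} (hl : ∀ z, h (l z) ∈ V) :
    ⊤ ≤ (l ≫ h) ⁻¹ᵁ V := fun z _ => hl z

theorem mem_of_subtype (h : Y ⟶ X) (V : X.Opens) (z : (h ⁻¹ᵁ V : Y.Opens).toScheme) :
    h ((h ⁻¹ᵁ V).ι z) ∈ V := z.2

/-- The value of a coframe on a section, pulled back to a scheme mapping to the preimage of the
domain of the section. -/
noncomputable def val (ψ : Coframe L h) (l : Z ⟶ Y) {V : X.Opens} (hl : ∀ z, h (l z) ∈ V)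
    (m : Γ(L, V)) : Γ(Z, ⊤) := ev l (top_le_preimage hl) (ψ.toFun m)

theorem val_smul (ψ : Coframe L h) (l : Z ⟶ Y) {V : X.Opens} (hl : ∀ z, h (l z) ∈ V)
    (a : Γ(X, V)) (m : Γ(L, V)) :
    ψ.val l hl (a • m) = ev (l ≫ h) (top_le_comp_preimage hl) a * ψ.val l hl m := by
  have h1 := ev_app h l (top_le_preimage hl) (top_le_comp_preimage hl) a
  rw [← h1]
  exact (congrArg _ (ψ.map_smul a m)).trans (RingHom.map_mul _ _ _)

theorem val_add (ψ : Coframe L h) (l : Z ⟶ Y) {V : X.Opens} (hl : ∀ z, h (l z) ∈ V)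
    (m n : Γ(L, V)) : ψ.val l hl (m + n) = ψ.val l hl m + ψ.val l hl n :=
  (congrArg _ (ψ.map_add m n)).trans (RingHom.map_add _ _ _)

theorem val_mres (ψ : Coframe L h) (l : Z ⟶ Y) {U V : X.Opens} (i : V ≤ U)
    (hl : ∀ z, h (l z) ∈ V) (m : Γ(L, U)) :
    ψ.val l hl (mres L i m) = ψ.val l (fun z => i (hl z)) m :=
  (congrArg _ (ψ.map_res i m)).trans
    (ev_map l _ (top_le_preimage fun z => i (hl z)) (top_le_preimage hl) _)

theorem val_comp (ψ : Coframe L h) (l : Z ⟶ Y) {W : Scheme.{u}} (k : W ⟶ Z) {V : X.Opens}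
    (hl : ∀ z, h (l z) ∈ V) (hl' : ∀ z, h ((k ≫ l) z) ∈ V) (m : Γ(L, V)) :
    ψ.val (k ≫ l) hl' m = k.appTop (ψ.val l hl m) := ev_comp _ _ _ _ _

theorem val_congr (ψ : Coframe L h) {l l' : Z ⟶ Y} (e : l = l') {V : X.Opens}
    (hl : ∀ z, h (l z) ∈ V) (hl' : ∀ z, h (l' z) ∈ V) (m : Γ(L, V)) :
    ψ.val l hl m = ψ.val l' hl' m := ev_congr e _ _ _

theorem ext_val {ψ χ : Coframe L h} (H : ∀ {V : X.Opens} (m : Γ(L, V)),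
    ψ.val (h ⁻¹ᵁ V).ι (mem_of_subtype h V) m = χ.val (h ⁻¹ᵁ V).ι (mem_of_subtype h V) m) :
    ψ = χ :=
  ext fun m => (bijective_ev_ι _).1 (H m)

/-- Restriction of a coframe. -/
noncomputable def res (k : Z ⟶ Y) {h' : Z ⟶ X} (w : k ≫ h = h') (ψ : Coframe L h) :
    Coframe L h' where
  toFun {V} m := k.appLE (h ⁻¹ᵁ V) (h' ⁻¹ᵁ V) (by rw [← w]; rfl) (ψ.toFun m)
  map_add m n := by rw [ψ.map_add]; exact RingHom.map_add _ _ _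
  map_smul {V} a m := by
    subst w
    rw [ψ.map_smul]
    refine (RingHom.map_mul _ _ _).trans ?_
    refine congrArg (· * _) ?_
    rw [Scheme.Hom.comp_app]
    exact congrArg (fun f => f (h.app V a)) (Scheme.Hom.appLE_eq_app k)
  map_res i m := by
    subst w
    rw [ψ.map_res, ← CommRingCat.comp_apply, ← CommRingCat.comp_apply, Scheme.Hom.map_appLE,
      Scheme.Hom.appLE_map]
  frame z := by
    subst w
    obtain ⟨V, m, hm⟩ := ψ.frame (k z)
    refine ⟨V, m, ?_⟩
    rw [Scheme.basicOpen_appLE]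
    exact ⟨Y.basicOpen_le _ hm, hm⟩

theorem val_res (k : Z ⟶ Y) {h' : Z ⟶ X} (w : k ≫ h = h') (ψ : Coframe L h) {W : Scheme.{u}}
    (l : W ⟶ Z) {V : X.Opens} (hl : ∀ z, h' (l z) ∈ V) (hl' : ∀ z, h ((l ≫ k) z) ∈ V)
    (m : Γ(L, V)) : (ψ.res k w).val l hl m = ψ.val (l ≫ k) hl' m := by
  have := Scheme.Hom.appLE_comp_appLE l k (h ⁻¹ᵁ V) (h' ⁻¹ᵁ V) ⊤ (by rw [← w]; rfl)
    (top_le_preimage hl)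
  exact congrArg (fun f => f (ψ.toFun m)) this

/-- Multiplication of a coframe by a unit. -/
noncomputable def unitSMul (c : gm Y) (ψ : Coframe L h) : Coframe L h where
  toFun {V} m := Y.presheaf.map (homOfLE le_top).op (c : Γ(Y, ⊤)) * ψ.toFun m
  map_add m n := by rw [ψ.map_add, mul_add]
  map_smul a m := by rw [ψ.map_smul]; ring
  map_res i m := by
    rw [ψ.map_res, _root_.map_mul, ← CommRingCat.comp_apply, ← Functor.map_comp]
    rfl
  frame y := by
    obtain ⟨V, m, hm⟩ := ψ.frame y
    refine ⟨V, m, ?_⟩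
    rw [Scheme.basicOpen_mul, Scheme.basicOpen_of_isUnit _ (c.isUnit.map _)]
    exact ⟨Y.basicOpen_le _ hm, hm⟩

theorem val_unitSMul (c : gm Y) (ψ : Coframe L h) (l : Z ⟶ Y) {V : X.Opens}
    (hl : ∀ z, h (l z) ∈ V) (m : Γ(L, V)) :
    (ψ.unitSMul c).val l hl m = (gmMap l c : Γ(Z, ⊤)) * ψ.val l hl m := by
  refine (RingHom.map_mul _ _ _).trans ?_
  refine congrArg (· * _) ?_
  exact (ev_map l _ le_top (top_le_preimage hl) _).trans (ev_top _ _ _)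

noncomputable instance : MulAction (gm Y) (Coframe L h) where
  smul := unitSMul
  one_smul ψ := ext_val fun m => by
    refine (val_unitSMul _ _ _ _ _).trans ?_
    rw [_root_.map_one, Units.val_one, one_mul]
  mul_smul c d ψ := ext_val fun m => by
    refine (val_unitSMul _ _ _ _ _).trans (Eq.trans ?_ (val_unitSMul _ _ _ _ _).symm)
    refine Eq.trans ?_ (congrArg _ (val_unitSMul _ _ _ _ _).symm)
    rw [_root_.map_mul, Units.val_mul, mul_assoc]

theorem val_gm_smul (c : gm Y) (ψ : Coframe L h) (l : Z ⟶ Y) {V : X.Opens}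
    (hl : ∀ z, h (l z) ∈ V) (m : Γ(L, V)) :
    (c • ψ).val l hl m = (gmMap l c : Γ(Z, ⊤)) * ψ.val l hl m := val_unitSMul _ _ _ _ _

theorem isUnit_toFun (ψ : Coframe L h) {U : X.Opens} {e : Γ(L, U)} (he : IsGenerator e) :
    IsUnit (ψ.toFun e) := by
  refine isUnit_of_le_basicOpen _ fun y hy => ?_
  obtain ⟨V, m, hm⟩ := ψ.frame y
  have h1 : ψ.toFun (mres L (inf_le_left : V ⊓ U ≤ V) m) =
      h.app _ (he.coeff m) * ψ.toFun (mres L (inf_le_right : V ⊓ U ≤ U) e) := by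
    rw [← he.coeff_smul, ψ.map_smul]
  rw [ψ.map_res, ψ.map_res] at h1
  have h2 := congrArg Y.basicOpen h1
  rw [Scheme.basicOpen_mul, Scheme.basicOpen_res, Scheme.basicOpen_res] at h2
  have h3 : y ∈ h ⁻¹ᵁ (V ⊓ U) ⊓ Y.basicOpen (ψ.toFun m) := ⟨⟨Y.basicOpen_le _ hm, hy⟩, hm⟩
  rw [h2] at h3
  exact h3.2.2

theorem isUnit_val (ψ : Coframe L h) {U : X.Opens} {e : Γ(L, U)} (he : IsGenerator e) (l : Z ⟶ Y)
    (hl : ∀ z, h (l z) ∈ U) : IsUnit (ψ.val l hl e) := (ψ.isUnit_toFun he).map _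

/-- The values of coframes are determined by the values on local generators. -/
theorem val_eq_coeff_mul (ψ : Coframe L h) {U V : X.Opens} {e : Γ(L, U)} (he : IsGenerator e)
    (l : Z ⟶ Y) (hV : ∀ z, h (l z) ∈ V) (hU : ∀ z, h (l z) ∈ U) (m : Γ(L, V)) :
    ψ.val l hV m = ev (l ≫ h) (top_le_comp_preimage (V := V ⊓ U) fun z => ⟨hV z, hU z⟩)
      (he.coeff m) * ψ.val l hU e := by
  have hl : ∀ z, h (l z) ∈ V ⊓ U := fun z => ⟨hV z, hU z⟩
  rw [← ψ.val_mres l (inf_le_left : V ⊓ U ≤ V) hl m, ← ψ.val_mres l (inf_le_right : V ⊓ U ≤ U) hl e,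
    ← he.coeff_smul, val_smul]

/-- Two coframes that take the same values on local generators are equal. -/
theorem ext_generator {ψ χ : Coframe L h} (U : Y → X.Opens) (hU : ∀ y, h y ∈ U y)
    (e : ∀ y, Γ(L, U y)) (he : ∀ y, IsGenerator (e y))
    (H : ∀ y, ψ.val (h ⁻¹ᵁ U y).ι (mem_of_subtype h (U y)) (e y) =
      χ.val (h ⁻¹ᵁ U y).ι (mem_of_subtype h (U y)) (e y)) : ψ = χ := by
  refine ext_val fun {V} m => ?_
  have hc : IsFppfCover (fun y : (h ⁻¹ᵁ V : Y.Opens) => ((h ⁻¹ᵁ V).ι ⁻¹ᵁ (h ⁻¹ᵁ U y.1)).ι) :=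
    IsFppfCover.of_opens fun y => ⟨y, hU y.1⟩
  refine hc.ext fun y => ?_
  set l := ((h ⁻¹ᵁ V).ι ⁻¹ᵁ (h ⁻¹ᵁ U y.1)).ι with hl
  have hlV (z) : h ((l ≫ (h ⁻¹ᵁ V).ι) z) ∈ V := (l z).2
  have hlU (z) : h ((l ≫ (h ⁻¹ᵁ V).ι) z) ∈ U y.1 := z.2
  have e1 := liftOpens_ι (l ≫ (h ⁻¹ᵁ V).ι) (V := h ⁻¹ᵁ U y.1) (fun z _ => hlU z)
  have hlU' (z) : h ((liftOpens (l ≫ (h ⁻¹ᵁ V).ι) (V := h ⁻¹ᵁ U y.1) (fun z _ => hlU z) ≫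
      (h ⁻¹ᵁ U y.1).ι) z) ∈ U y.1 := by
    rw [e1]; exact hlU z
  have key (ψ : Coframe L h) := (ψ.val_congr e1.symm hlU hlU' (e y)).trans
    (ψ.val_comp _ _ (mem_of_subtype h _) hlU' (e y))
  refine (ψ.val_comp _ l (mem_of_subtype h _) hlV m).symm.trans
    (Eq.trans ?_ (χ.val_comp _ l (mem_of_subtype h _) hlV m))
  rw [ψ.val_eq_coeff_mul (he y) _ hlV hlU, χ.val_eq_coeff_mul (he y) _ hlV hlU, key ψ, key χ, H]

theorem existsUnique_smul (hL : IsLineBundle L) [IsLocallyNoetherian Y] (ψ χ : Coframe L h) :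
    ∃! c : gm Y, c • ψ = χ := by
  choose U hU e he using fun y : Y => hL (h y)
  have hc : IsFppfCover (fun y : Y => (h ⁻¹ᵁ U y).ι) := IsFppfCover.of_opens fun y => ⟨y, hU y⟩
  have := hc.isLocallyNoetherian
  let a (ψ : Coframe L h) (y : Y) : gm (h ⁻¹ᵁ U y : Y.Opens) :=
    (ψ.isUnit_val (he y) (h ⁻¹ᵁ U y).ι (mem_of_subtype h _)).unit
  have ha0 (ψ : Coframe L h) (y : Y) :
      (a ψ y).val = ψ.val (h ⁻¹ᵁ U y).ι (mem_of_subtype h _) (e y) := rfl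
  have ha (ψ : Coframe L h) (y : Y) {W : Scheme.{u}} (p : W ⟶ (h ⁻¹ᵁ U y : Y.Opens)) {l : W ⟶ Y}
      (e' : p ≫ (h ⁻¹ᵁ U y).ι = l) (hl : ∀ z, h (l z) ∈ U y) :
      (gmMap p (a ψ y) : Γ(W, ⊤)) = ψ.val l hl (e y) := by
    subst e'
    rw [val_gmMap, ha0]
    exact (ψ.val_comp _ p (mem_of_subtype h _) hl (e y)).symm
  clear_value a
  obtain ⟨c, hc'⟩ := hc.exists_gm (fun y => (a ψ y)⁻¹ * a χ y) (fun y z W _ p q epq => by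
    obtain ⟨l, hl⟩ : ∃ l, p ≫ (h ⁻¹ᵁ U y).ι = l := ⟨_, rfl⟩
    have hl' := epq.symm.trans hl
    have hy (w) : h (l w) ∈ U y := by rw [← hl]; exact (p w).2
    have hz (w) : h (l w) ∈ U z := by rw [← hl']; exact (q w).2
    rw [_root_.map_mul, _root_.map_mul, map_inv, map_inv, inv_mul_eq_iff_eq_mul, mul_left_comm,
      eq_inv_mul_iff_mul_eq]
    ext
    rw [Units.val_mul, Units.val_mul, ha ψ y p hl hy, ha ψ z q hl' hz, ha χ y p hl hy,
      ha χ z q hl' hz, ψ.val_eq_coeff_mul (he z) l hy hz, χ.val_eq_coeff_mul (he z) l hy hz]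
    ring)
  refine ⟨c, ?_, fun d hd => hc.gm_ext fun y => ?_⟩
  · refine ext_generator U hU e he fun y => ?_
    rw [val_gm_smul, hc', ← ha0, ← ha0, ← Units.val_mul, mul_right_comm, inv_mul_cancel, one_mul]
  · rw [hc', eq_inv_mul_iff_mul_eq, ← hd]
    ext
    rw [Units.val_mul, ha0, ha0, val_gm_smul, mul_comm]

theorem glue [IsLocallyNoetherian Y] {ι : Type u} {Z : ι → Scheme.{u}}
    [∀ i, IsLocallyNoetherian (Z i)] {k : ∀ i, Z i ⟶ Y} (hk : IsFppfCover k)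
    (s : ∀ i, Coframe L (k i ≫ h))
    (hs : ∀ i j {W : Scheme.{u}} [IsLocallyNoetherian W] (p : W ⟶ Z i) (q : W ⟶ Z j)
      (_ : p ≫ k i = q ≫ k j) (h' : W ⟶ X) (wp : p ≫ k i ≫ h = h') (wq : q ≫ k j ≫ h = h'),
      (s i).res p wp = (s j).res q wq) :
    ∃ t : Coframe L h, ∀ i, t.res (k i) rfl = s i := by
  have main (V : X.Opens) (m : Γ(L, V)) := existsUnique_glue hk (h ⁻¹ᵁ V) (fun i => (s i).toFun m)
    (fun i j W _ p q e hp hq => by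
      have h1 := hs i j p q e _ rfl (by rw [← Category.assoc, ← e, Category.assoc])
      have hp' (z) : (p ≫ k i ≫ h) ((𝟙 W : W ⟶ W) z) ∈ V := hp (x := z) trivial
      have e1 := Category.id_comp p
      have e2 := Category.id_comp q
      have hp1 (z) : (k i ≫ h) ((𝟙 W ≫ p) z) ∈ V := hp (x := z) trivial
      have hq1 (z) : (k j ≫ h) ((𝟙 W ≫ q) z) ∈ V := hq (x := z) trivial
      exact ((val_congr _ e1 hp1 (fun z => hp (x := z) trivial) m).symm.trans
        (val_res _ _ _ _ hp' hp1 m).symm).trans ((congrArg (fun ψ => ψ.val (𝟙 W) hp' m) h1).trans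
        ((val_res _ _ _ _ hp' hq1 m).trans (val_congr _ e2 hq1 (fun z => hq (x := z) trivial) m))))
  choose f hf huniq using main
  have hf' (V m i) : (k i).app (h ⁻¹ᵁ V) (f V m) = (s i).toFun m := hf V m i
  refine ⟨⟨fun {V} m => f V m, fun {V} m n => ?_, fun {V} a m => ?_, fun {U V} i m => ?_,
    fun y => ?_⟩, fun i => ?_⟩
  · refine (huniq V (m + n) _ fun i => ?_).symm
    refine (RingHom.map_add _ _ _).trans ?_
    exact (congrArg₂ _ (hf' V m i) (hf' V n i)).trans ((s i).map_add m n).symm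
  · refine (huniq V (a • m) _ fun i => ?_).symm
    refine (RingHom.map_mul _ _ _).trans (Eq.trans ?_ ((s i).map_smul a m).symm)
    refine congrArg₂ _ ?_ (hf' V m i)
    rw [Scheme.Hom.comp_app]
    rfl
  · refine (huniq V (mres L i m) _ fun j => ?_).symm
    refine Eq.trans ?_ ((s j).map_res i m).symm
    rw [← hf' U m j]
    exact congrArg (fun g => g (f U m)) ((k j).naturality (homOfLE (h.preimage_mono i)).op)
  · obtain ⟨i, z, rfl⟩ := hk.exists_eq y
    obtain ⟨V, m, hm⟩ := (s i).frame z
    refine ⟨V, m, ?_⟩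
    rw [← hf' V m i] at hm
    exact (Scheme.preimage_basicOpen (k i) (f V m)).ge hm
  · ext V m
    exact Eq.trans (congrArg (fun g => g (f V m)) (Scheme.Hom.appLE_eq_app (k i))) (hf' V m i)

theorem preimage_ι_le (V U : X.Opens) : U.ι ⁻¹ᵁ V ≤ U.ι ⁻¹ᵁ (V ⊓ U) := fun x hx => ⟨hx, x.2⟩

/-- The coframe with value `1` on a generator. -/
noncomputable def ofGenerator {U : X.Opens} {e : Γ(L, U)} (he : IsGenerator e) : Coframe L U.ι where
  toFun {V} m := U.ι.appLE (V ⊓ U) (U.ι ⁻¹ᵁ V) (preimage_ι_le V U) (he.coeff m)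
  map_add {V} m n := by
    rw [← _root_.map_add]
    congr 1
    exact he.eq_coeff (by rw [add_smul, he.coeff_smul, he.coeff_smul, mres_add])
  map_smul {V} a m := by
    have : he.coeff (a • m) =
        X.presheaf.map (homOfLE (inf_le_left : V ⊓ U ≤ V)).op a * he.coeff m :=
      he.eq_coeff (by rw [mul_smul, he.coeff_smul, mres_smul])
    rw [this, _root_.map_mul, ← CommRingCat.comp_apply, Scheme.Hom.map_appLE, Scheme.Hom.appLE_eq_app]
  map_res {V V'} i m := by
    have : he.coeff (mres L i m) =
        X.presheaf.map (homOfLE (inf_le_inf_right U i)).op (he.coeff m) :=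
      he.eq_coeff (by
        have := congrArg (mres L (inf_le_inf_right U i)) (he.coeff_smul m)
        rw [mres_smul, mres_mres, mres_mres] at this
        rw [this, mres_mres])
    rw [this, ← CommRingCat.comp_apply, ← CommRingCat.comp_apply, Scheme.Hom.map_appLE,
      Scheme.Hom.appLE_map]
  frame y := by
    refine ⟨U, e, ?_⟩
    rw [he.eq_coeff (a := 1) (by rw [one_smul]), _root_.map_one, Scheme.basicOpen_one]
    exact y.2

end Coframe

/-- The torsor of coframes of a line bundle. -/
noncomputable def coframeTorsor [IsLocallyNoetherian X] (L : X.Modules) (hL : IsLineBundle L) :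
    GmTorsor X where
  sec h := Coframe L h
  act h := inferInstance
  res k _ _ w ψ := ψ.res k w
  res_id {Y _ h} w ψ := by
    refine Coframe.ext_val fun {V} m => ?_
    have e := Category.comp_id (h ⁻¹ᵁ V).ι
    have hl (z) : h (((h ⁻¹ᵁ V).ι ≫ 𝟙 Y) z) ∈ V := by rw [e]; exact z.2
    exact (Coframe.val_res _ _ _ _ _ hl _).trans (Coframe.val_congr _ e hl _ _)
  res_res k l h h' h'' w w' w'' ψ := by
    subst w w'
    refine Coframe.ext_val fun {V} m => ?_
    have hl := Coframe.mem_of_subtype (l ≫ k ≫ h) V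
    have h1 (z) : (k ≫ h) ((((l ≫ k ≫ h) ⁻¹ᵁ V).ι ≫ l) z) ∈ V := hl z
    have h2 (z) : h (((((l ≫ k ≫ h) ⁻¹ᵁ V).ι ≫ l) ≫ k) z) ∈ V := hl z
    have h3 (z) : h ((((l ≫ k ≫ h) ⁻¹ᵁ V).ι ≫ l ≫ k) z) ∈ V := hl z
    rw [Coframe.val_res _ _ _ _ hl h1, Coframe.val_res _ _ _ _ h1 h2,
      Coframe.val_res _ _ _ _ hl h3]
    exact Coframe.val_congr _ (Category.assoc _ _ _) h2 h3 _
  res_smul k h h' w c ψ := by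
    subst w
    refine Coframe.ext_val fun {V} m => ?_
    have hl := Coframe.mem_of_subtype (k ≫ h) V
    have hl' (z) : h ((((k ≫ h) ⁻¹ᵁ V).ι ≫ k) z) ∈ V := hl z
    rw [Coframe.val_res _ _ _ _ hl hl', Coframe.val_gm_smul, Coframe.val_gm_smul, gmMap_comp,
      Coframe.val_res _ _ _ _ hl hl']
  existsUnique_smul ψ χ := Coframe.existsUnique_smul hL ψ χ
  glue hk h s hs := Coframe.glue hk s hs
  locally_nonempty x := by
    obtain ⟨U, hU, e, he⟩ := hL x
    exact ⟨U, inferInstance, U.ι, inferInstance, inferInstance, ⟨x, hU⟩, rfl,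
      ⟨Coframe.ofGenerator he⟩⟩

end

/-! ### Functoriality of the torsor of a line bundle -/

section
variable {X Y Z : Scheme.{u}}

/-- A morphism of sheaves of modules, given on sections. -/
noncomputable def mkHom {L L' : X.Modules} (φ : ∀ V : X.Opens, Γ(L, V) → Γ(L', V))
    (h_add : ∀ V m n, φ V (m + n) = φ V m + φ V n)
    (h_smul : ∀ V (a : Γ(X, V)) m, φ V (a • m) = a • φ V m)
    (h_res : ∀ {U V : X.Opens} (i : V ≤ U) m, φ V (mres L i m) = mres L' i (φ U m)) : L ⟶ L' :=
  SheafOfModules.Hom.mk (PresheafOfModules.homMk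
    { app := fun V => AddCommGrpCat.ofHom (AddMonoidHom.mk' (φ V.unop) (h_add V.unop))
      naturality := fun U V i => by
        ext m
        exact h_res (leOfHom i.unop) m }
    (fun V a m => h_smul V.unop a m))

theorem app_add {L L' : X.Modules} (f : L ⟶ L') {V : X.Opens} (m n : Γ(L, V)) :
    f.app V (m + n) = f.app V m + f.app V n := map_add _ _ _

theorem isIso_of_bijective_app {L L' : X.Modules} (f : L ⟶ L')
    (hf : ∀ V, Function.Bijective (f.app V)) : IsIso f :=
  Scheme.Modules.Hom.isIso_iff_isIso_app.2 fun V =>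
    (ConcreteCategory.isIso_iff_bijective _).2 (hf V)

theorem bijective_app {L L' : X.Modules} (f : L ⟶ L') [IsIso f] (V : X.Opens) :
    Function.Bijective (f.app V) :=
  (ConcreteCategory.isIso_iff_bijective _).1 inferInstance

/-- The composition of a coframe with an isomorphism. -/
noncomputable def Coframe.precomp {L L' : X.Modules} {h : Y ⟶ X} (ψ : Coframe L' h) (f : L ≅ L') :
    Coframe L h where
  toFun {V} m := ψ.toFun (f.hom.app V m)
  map_add m n := by rw [app_add, ψ.map_add]
  map_smul a m := by rw [Scheme.Modules.Hom.app_smul, ψ.map_smul]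
  map_res i m := by rw [mres_app, ψ.map_res]
  frame y := by
    obtain ⟨V, m, hm⟩ := ψ.frame y
    obtain ⟨n, rfl⟩ := (bijective_app f.hom V).2 m
    exact ⟨V, n, hm⟩

/-- The torsors of isomorphic line bundles are isomorphic. -/
noncomputable def coframeTorsorMap [IsLocallyNoetherian X] {L L' : X.Modules} (hL : IsLineBundle L)
    (hL' : IsLineBundle L') (f : L ≅ L') :
    GmTorsor.Hom (coframeTorsor L' hL') (coframeTorsor L hL) where
  app ψ := Coframe.precomp ψ f
  app_res _ _ _ _ _ := rfl
  app_smul _ _ := rfl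

theorem isGenerator_one (U : X.Opens) :
    IsGenerator (L := structureSheaf X) (U := U) (1 : Γ(X, U)) := by
  intro V i
  have : (fun a : Γ(X, V) => a • mres (structureSheaf X) i (1 : Γ(X, U))) = fun a => a := by
    funext a
    have h1 : mres (structureSheaf X) i (1 : Γ(X, U)) = (1 : Γ(X, V)) :=
      map_one (X.presheaf.map (homOfLE i).op).hom
    rw [h1]
    exact mul_one (a : Γ(X, V))
  rw [this]
  exact Function.bijective_id

theorem isLineBundle_structureSheaf : IsLineBundle (structureSheaf X) := fun _ =>
  ⟨⊤, trivial, _, isGenerator_one ⊤⟩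

variable (X) in
/-- The identity of the structure sheaf as a coframe. -/
noncomputable def unitCoframe : Coframe (structureSheaf X) (𝟙 X) where
  toFun {V} m := (show Γ(X, V) from m)
  map_add m n := rfl
  map_smul a m := by rw [Scheme.Hom.id_app]; rfl
  map_res i m := rfl
  frame y := ⟨⊤, (1 : Γ(X, ⊤)), by
    change y ∈ X.basicOpen (1 : Γ(X, ⊤))
    rw [Scheme.basicOpen_one]; trivial⟩

/-- A coframe as a morphism of sheaves of modules. -/
noncomputable def Coframe.toHom {L : X.Modules} {h : Y ⟶ X} (ψ : Coframe L h) :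
    L ⟶ (Scheme.Modules.pushforward h).obj (structureSheaf Y) :=
  mkHom (fun V m => (show Γ(Y, h ⁻¹ᵁ V) from ψ.toFun m)) (fun _ m n => ψ.map_add m n)
    (fun _ a m => ψ.map_smul a m) (fun i m => ψ.map_res i m)

/-- The pullback of a section of a sheaf of modules. -/
noncomputable def pullSection (L : X.Modules) (k : Z ⟶ X) {V : X.Opens} (m : Γ(L, V)) :
    Γ((Scheme.Modules.pullback k).obj L, k ⁻¹ᵁ V) :=
  ((Scheme.Modules.pullbackPushforwardAdjunction k).unit.app L).app V m

theorem hom_ext_pullSection {L : X.Modules} {k : Z ⟶ X} {M : Z.Modules}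
    {f g : (Scheme.Modules.pullback k).obj L ⟶ M} (H : ∀ (V : X.Opens) (m : Γ(L, V)),
      f.app (k ⁻¹ᵁ V) (pullSection L k m) = g.app (k ⁻¹ᵁ V) (pullSection L k m)) : f = g := by
  apply ((Scheme.Modules.pullbackPushforwardAdjunction k).homEquiv _ _).injective
  rw [Adjunction.homEquiv_unit, Adjunction.homEquiv_unit]
  ext V m
  exact H V m

namespace Coframe

variable {L : X.Modules} {k : Z ⟶ X} {h : Y ⟶ Z}

theorem ext_pullSection {χ χ' : Coframe ((Scheme.Modules.pullback k).obj L) h}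
    (H : ∀ (V : X.Opens) (m : Γ(L, V)),
      χ.toFun (pullSection L k m) = χ'.toFun (pullSection L k m)) : χ = χ' := by
  have : χ.toHom = χ'.toHom := hom_ext_pullSection H
  ext V m
  exact congrArg (fun f => f.app V m) this

/-- By adjunction, a coframe of `L` over a morphism that factors through `k` induces a coframe of
`k^* L`. -/
theorem exists_transpose (ψ : Coframe L (h ≫ k)) :
    ∃ χ : Coframe ((Scheme.Modules.pullback k).obj L) h,
      ∀ (V : X.Opens) (m : Γ(L, V)), χ.toFun (pullSection L k m) = ψ.toFun m := by
  let ψ' : L ⟶ (Scheme.Modules.pushforward k).obj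
      ((Scheme.Modules.pushforward h).obj (structureSheaf Y)) :=
    mkHom (fun V m => (show Γ(Y, h ⁻¹ᵁ k ⁻¹ᵁ V) from ψ.toFun m)) (fun V m n => ψ.map_add m n)
      (fun V a m => (ψ.map_smul a m).trans (by rw [Scheme.Hom.comp_app]; rfl))
      (fun i m => ψ.map_res i m)
  let g := ((Scheme.Modules.pullbackPushforwardAdjunction k).homEquiv _ _).symm ψ'
  have hg (V : X.Opens) (m : Γ(L, V)) : g.app (k ⁻¹ᵁ V) (pullSection L k m) = ψ.toFun m := by
    have h1 := ((Scheme.Modules.pullbackPushforwardAdjunction k).homEquiv _ _).apply_symm_apply ψ'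
    rw [Adjunction.homEquiv_unit] at h1
    exact congrArg (fun f => f.app V m) h1
  exact ⟨{ toFun := fun {V} m => (show Γ(Y, h ⁻¹ᵁ V) from g.app V m)
           map_add := fun m n => app_add g m n
           map_smul := fun a m => Scheme.Modules.Hom.app_smul g a m
           map_res := fun i m => mres_app g i m
           frame := fun y => by
            obtain ⟨V, m, hm⟩ := ψ.frame y
            refine ⟨k ⁻¹ᵁ V, pullSection L k m, ?_⟩
            rw [← hg V m] at hm
            exact hm }, hg⟩

/-- The transposed coframe. -/
noncomputable def transpose (ψ : Coframe L (h ≫ k)) :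
    Coframe ((Scheme.Modules.pullback k).obj L) h := ψ.exists_transpose.choose

theorem transpose_toFun (ψ : Coframe L (h ≫ k)) {V : X.Opens} (m : Γ(L, V)) :
    ψ.transpose.toFun (pullSection L k m) = ψ.toFun m := ψ.exists_transpose.choose_spec V m

theorem transpose_res (ψ : Coframe L (h ≫ k)) {W : Scheme.{u}} (l : W ⟶ Y) {h' : W ⟶ Z}
    (w : l ≫ h = h') (w' : l ≫ h ≫ k = h' ≫ k) :
    (ψ.res l w').transpose = ψ.transpose.res l w := by
  refine ext_pullSection fun V m => ?_
  rw [transpose_toFun]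
  have hV : h' ⁻¹ᵁ (k ⁻¹ᵁ V) ≤ l ⁻¹ᵁ (h ⁻¹ᵁ (k ⁻¹ᵁ V)) := by rw [← w]; rfl
  have h1 : (ψ.transpose.res l w).toFun (pullSection L k m) =
      l.appLE (h ⁻¹ᵁ (k ⁻¹ᵁ V)) (h' ⁻¹ᵁ (k ⁻¹ᵁ V)) hV (ψ.transpose.toFun (pullSection L k m)) := rfl
  rw [h1, transpose_toFun]
  rfl

theorem transpose_smul (ψ : Coframe L (h ≫ k)) (c : gm Y) :
    (c • ψ).transpose = c • ψ.transpose := by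
  refine ext_pullSection fun V m => ?_
  rw [transpose_toFun]
  have h1 : (c • ψ.transpose).toFun (pullSection L k m) =
      Y.presheaf.map (homOfLE le_top).op (c : Γ(Y, ⊤)) *
        (ψ.transpose.toFun (pullSection L k m)) := rfl
  rw [h1, transpose_toFun]
  rfl

end Coframe

/-- The torsor of the pullback of a line bundle is the pullback of its torsor. -/
noncomputable def coframeTorsorPullback [IsLocallyNoetherian X] [IsLocallyNoetherian Z]
    {L : X.Modules} (hL : IsLineBundle L) (k : Z ⟶ X)
    (hkL : IsLineBundle ((Scheme.Modules.pullback k).obj L)) :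
    GmTorsor.Hom ((coframeTorsor L hL).restrict k) (coframeTorsor _ hkL) where
  app ψ := Coframe.transpose ψ
  app_res l _ _ w ψ := Coframe.transpose_res ψ l w (by rw [← w, Category.assoc])
  app_smul c ψ := Coframe.transpose_smul ψ c

/-! ### Generators and isomorphisms of line bundles -/

theorem isGenerator_of_restrict {L : X.Modules} {U : X.Opens}
    (g : L.restrict U.ι ≅ structureSheaf U.toScheme) :
    ∃ e : Γ(L, U.ι ''ᵁ ⊤), IsGenerator e := by
  obtain ⟨e, he⟩ := (bijective_app g.hom ⊤).2 (1 : Γ(U.toScheme, ⊤))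
  refine ⟨e, fun V i => ?_⟩
  obtain ⟨W, rfl⟩ : ∃ W : U.toScheme.Opens, V = U.ι ''ᵁ W := ⟨U.ι ⁻¹ᵁ V, by
    rw [Scheme.Hom.image_preimage_eq_opensRange_inf]
    have : V ≤ U := by simpa using i
    simpa using this⟩
  have h1 : g.hom.app W (mres (L.restrict U.ι) (le_top : W ≤ ⊤) e) = (1 : Γ(U.toScheme, W)) := by
    rw [mres_app, he]
    exact map_one (U.toScheme.presheaf.map (homOfLE (le_top : W ≤ ⊤)).op).hom
  have key (a : Γ(U.toScheme, W)) : g.hom.app W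
      (show Γ(L.restrict U.ι, W) from ((U.ι.appIso W).inv a : Γ(X, U.ι ''ᵁ W)) • mres L i e) =
      (show Γ(structureSheaf U.toScheme, W) from a) := by
    refine (Scheme.Modules.Hom.app_smul g.hom a (mres (L.restrict U.ι) (le_top : W ≤ ⊤) e)).trans ?_
    rw [h1]
    exact mul_one a
  have h2 : Function.Bijective (fun a : Γ(U.toScheme, W) =>
      (show Γ(L.restrict U.ι, W) from ((U.ι.appIso W).inv a : Γ(X, U.ι ''ᵁ W)) • mres L i e)) := by
    refine (Function.Bijective.of_comp_iff' (bijective_app g.hom W) _).1 ?_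
    convert! Function.bijective_id (α := Γ(U.toScheme, W)) using 1
    funext a
    exact key a
  refine (Function.Bijective.of_comp_iff _
    ((ConcreteCategory.isIso_iff_bijective (U.ι.appIso W).inv).1 inferInstance)).1 h2

theorem nonempty_restrict_iso {L : X.Modules} {U : X.Opens} {e : Γ(L, U)} (he : IsGenerator e) :
    Nonempty (L.restrict U.ι ≅ structureSheaf U.toScheme) := by
  have hW (W : U.toScheme.Opens) : U.ι ''ᵁ W ≤ U := by
    rintro _ ⟨x, -, rfl⟩
    exact x.2
  let φ : structureSheaf U.toScheme ⟶ L.restrict U.ι := mkHom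
    (fun W (a : Γ(U.toScheme, W)) => ((U.ι.appIso W).inv a : Γ(X, U.ι ''ᵁ W)) • mres L (hW W) e)
    (fun W a b => (congrArg (· • mres L (hW W) e) (map_add (U.ι.appIso W).inv.hom a b)).trans
      (add_smul _ _ _))
    (fun W a b => (congrArg (· • mres L (hW W) e) (map_mul (U.ι.appIso W).inv.hom a b)).trans
      (mul_smul _ _ _))
    (fun {W W'} i a => by
      have h1 : mres L (hW W') e = mres L (U.ι.image_mono i) (mres L (hW W) e) :=
        (mres_mres L _ _ _).symm
      have h2 := congrArg (fun f => f a) (U.ι.appIso_inv_naturality (homOfLE i).op)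
      rw [h1]
      refine Eq.trans ?_ (mres_smul L (U.ι.image_mono i) _ _).symm
      exact congrArg (· • _) h2)
  have : IsIso φ := isIso_of_bijective_app φ fun W => by
    exact (he (hW W)).comp
      ((ConcreteCategory.isIso_iff_bijective (U.ι.appIso W).inv).1 inferInstance)
  exact ⟨(asIso φ).symm⟩

end

/-! ### The line bundle of a cocycle -/

section
variable {X : Scheme.{u}}

/-- Restriction of functions. -/
noncomputable def rs {U V : X.Opens} (i : V ≤ U) : Γ(X, U) →+* Γ(X, V) :=
  (X.presheaf.map (homOfLE i).op).hom

@[simp]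
theorem rs_rs {U V W : X.Opens} (i : V ≤ U) (j : W ≤ V) (a : Γ(X, U)) :
    rs j (rs i a) = rs (j.trans i) a := by
  have := X.presheaf.map_comp (homOfLE i).op (homOfLE j).op
  exact (congrArg (fun f => f a) this).symm

@[simp]
theorem rs_self {U : X.Opens} (i : U ≤ U) (a : Γ(X, U)) : rs i a = a :=
  congrArg (fun f => f a) (X.presheaf.map_id (op U))

theorem rs_ext {ι : Type*} {V : X.Opens} {W : ι → X.Opens} (hW : ∀ i, W i ≤ V)
    (hV : ∀ x ∈ V, ∃ i, x ∈ W i) {a b : Γ(X, V)} (h : ∀ i, rs (hW i) a = rs (hW i) b) : a = b :=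
  X.sheaf.eq_of_locally_eq' W V (fun i => homOfLE (hW i))
    (fun x hx => Opens.mem_iSup.2 (hV x hx)) a b h

theorem existsUnique_rs {ι : Type*} {V : X.Opens} {W : ι → X.Opens} (hW : ∀ i, W i ≤ V)
    (hV : ∀ x ∈ V, ∃ i, x ∈ W i) (a : ∀ i, Γ(X, W i))
    (ha : ∀ i j, rs inf_le_left (a i) = (rs inf_le_right (a j) : Γ(X, W i ⊓ W j))) :
    ∃! b : Γ(X, V), ∀ i, rs (hW i) b = a i :=
  X.sheaf.existsUnique_gluing' W V (fun i => homOfLE (hW i))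
    (fun x hx => Opens.mem_iSup.2 (hV x hx)) a ha

variable {I : Type u} {U : I → X.Opens} (g : ∀ i j, Γ(X, U i ⊓ U j))

/-- The cocycle condition, for functions on the intersections of the members of a covering. -/
structure IsCocycle : Prop where
  cover : ∀ x, ∃ i, x ∈ U i
  self : ∀ i, g i i = 1
  mul : ∀ i j l (W : X.Opens) (hij : W ≤ U i ⊓ U j) (hjl : W ≤ U j ⊓ U l) (hil : W ≤ U i ⊓ U l),
    rs hij (g i j) * rs hjl (g j l) = rs hil (g i l)

/-- The sections over `V` of the line bundle of a cocycle: families of functions `a i` on `U i ⊓ V`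
with `a i = g i j * a j`. -/
def cocycleSections (V : X.Opens) : AddSubgroup (∀ i, Γ(X, U i ⊓ V)) where
  carrier := {a | ∀ i j (W : X.Opens) (hi : W ≤ U i ⊓ V) (hj : W ≤ U j ⊓ V) (hij : W ≤ U i ⊓ U j),
    rs hi (a i) = rs hij (g i j) * rs hj (a j)}
  zero_mem' i j W hi hj hij := by simp
  add_mem' {a b} ha hb i j W hi hj hij := by
    rw [Pi.add_apply, Pi.add_apply, map_add, map_add, ha i j W hi hj hij, hb i j W hi hj hij,
      mul_add]
  neg_mem' {a} ha i j W hi hj hij := by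
    rw [Pi.neg_apply, Pi.neg_apply, map_neg, map_neg, ha i j W hi hj hij, mul_neg]

noncomputable instance (V : X.Opens) : SMul Γ(X, V) (cocycleSections g V) where
  smul c a := ⟨fun i => rs inf_le_right c * a.1 i, fun i j W hi hj hij => by
    rw [map_mul, map_mul, rs_rs, rs_rs, a.2 i j W hi hj hij, mul_left_comm]⟩

theorem cocycleSections_smul_val {V : X.Opens} (c : Γ(X, V)) (a : cocycleSections g V) (i : I) :
    (c • a).1 i = rs inf_le_right c * a.1 i := rfl

noncomputable instance (V : X.Opens) : Module Γ(X, V) (cocycleSections g V) where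
  one_smul a := Subtype.ext <| funext fun i => by
    rw [cocycleSections_smul_val, map_one, one_mul]
  mul_smul c d a := Subtype.ext <| funext fun i => by
    rw [cocycleSections_smul_val, cocycleSections_smul_val, cocycleSections_smul_val, map_mul,
      mul_assoc]
  smul_zero c := Subtype.ext <| funext fun i => mul_zero _
  smul_add c a b := Subtype.ext <| funext fun i => mul_add _ _ _
  add_smul c d a := Subtype.ext <| funext fun i => by
    rw [cocycleSections_smul_val, map_add, add_mul]; rfl
  zero_smul a := Subtype.ext <| funext fun i => by
    rw [cocycleSections_smul_val, map_zero, zero_mul]; rfl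

/-- Restriction of the sections of the line bundle of a cocycle. -/
noncomputable def cocycleRes {V V' : X.Opens} (h : V' ≤ V) :
    cocycleSections g V →+ cocycleSections g V' where
  toFun a := ⟨fun i => rs (inf_le_inf_left _ h) (a.1 i), fun i j W hi hj hij => by
    rw [rs_rs, rs_rs]
    exact a.2 i j W _ _ hij⟩
  map_zero' := Subtype.ext <| funext fun i => map_zero _
  map_add' a b := Subtype.ext <| funext fun i => map_add _ _ _

theorem cocycleRes_val {V V' : X.Opens} (h : V' ≤ V) (a : cocycleSections g V) (i : I) :
    (cocycleRes g h a).1 i = rs (inf_le_inf_left _ h) (a.1 i) := rfl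

/-- The presheaf of abelian groups underlying the line bundle of a cocycle. -/
noncomputable def cocyclePresheaf : TopCat.Presheaf Ab.{u} X where
  obj V := AddCommGrpCat.of (cocycleSections g V.unop)
  map i := AddCommGrpCat.ofHom (cocycleRes g (leOfHom i.unop))
  map_id V := by
    exact AddCommGrpCat.hom_ext (AddMonoidHom.ext fun (a : cocycleSections g V.unop) =>
      Subtype.ext (funext fun i => rs_self le_rfl (a.1 i)))
  map_comp {V V' V''} i j := by
    exact AddCommGrpCat.hom_ext (AddMonoidHom.ext fun (a : cocycleSections g V.unop) =>
      Subtype.ext (funext fun l => (rs_rs (inf_le_inf_left _ (leOfHom i.unop))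
        (inf_le_inf_left _ (leOfHom j.unop)) (a.1 l)).symm))

theorem isSheaf_cocyclePresheaf : (cocyclePresheaf g).IsSheaf := by
  rw [TopCat.Presheaf.isSheaf_iff_isSheafUniqueGluing]
  intro ι V a ha
  have hVs (s : ι) : V s ≤ iSup V := le_iSup V s
  have hcov (W : X.Opens) (hW : W ≤ iSup V) : ∀ x ∈ W, ∃ s, x ∈ W ⊓ V s := fun x hx => by
    obtain ⟨s, hs⟩ := Opens.mem_iSup.1 (hW hx)
    exact ⟨s, hx, hs⟩
  have hcov' (i : I) : ∀ x ∈ U i ⊓ iSup V, ∃ s, x ∈ U i ⊓ V s := fun x hx => by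
    obtain ⟨s, hs⟩ := Opens.mem_iSup.1 hx.2
    exact ⟨s, hx.1, hs⟩
  let a' (s : ι) : cocycleSections g (V s) := a s
  have ha' (s t : ι) (i : I) (W : X.Opens) (hs : W ≤ U i ⊓ V s) (ht : W ≤ U i ⊓ V t) :
      rs hs ((a' s).1 i) = rs ht ((a' t).1 i) := by
    have h1 : cocycleRes g inf_le_left (a' s) = cocycleRes g inf_le_right (a' t) := ha s t
    have h2 := congrFun (congrArg Subtype.val h1) i
    rw [cocycleRes_val, cocycleRes_val] at h2
    have h3 : W ≤ U i ⊓ (V s ⊓ V t) :=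
      le_inf (hs.trans inf_le_left) (le_inf (hs.trans inf_le_right) (ht.trans inf_le_right))
    have h4 := congrArg (rs h3) h2
    rwa [rs_rs, rs_rs] at h4
  choose b hb hb' using fun i => existsUnique_rs (fun s => inf_le_inf_left (U i) (hVs s)) (hcov' i)
    (fun s => (a' s).1 i) (fun s t => ha' s t i _ _ _)
  refine ⟨(⟨b, fun i j W hi hj hij => ?_⟩ : cocycleSections g (iSup V)), fun s => ?_, fun c hc => ?_⟩
  · refine rs_ext (fun s => (inf_le_left : W ⊓ V s ≤ W)) (hcov W (hi.trans inf_le_right)) fun s => ?_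
    have h1 (i : I) (hi : W ≤ U i ⊓ iSup V) (hi' : W ⊓ V s ≤ U i ⊓ V s) :
        rs (inf_le_left : W ⊓ V s ≤ W) (rs hi (b i)) = rs hi' ((a' s).1 i) := by
      rw [← hb i s, rs_rs, rs_rs]
    rw [map_mul, h1 i hi (inf_le_inf_right _ (hi.trans inf_le_left)),
      h1 j hj (inf_le_inf_right _ (hj.trans inf_le_left)), rs_rs]
    exact (a' s).2 i j _ _ _ _
  · exact Subtype.ext <| funext fun i => hb i s
  · refine Subtype.ext <| funext fun i => hb' i _ fun s => ?_
    exact congrFun (congrArg Subtype.val (hc s)) i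

noncomputable instance (V : (Opens X)ᵒᵖ) :
    Module (X.ringCatSheaf.obj.obj V) ((cocyclePresheaf g).obj V) :=
  inferInstanceAs (Module Γ(X, V.unop) (cocycleSections g V.unop))

/-- The line bundle of a cocycle. -/
noncomputable def cocycleModule : X.Modules :=
  SheafOfModules.mk (PresheafOfModules.ofPresheaf (R := X.ringCatSheaf.obj) (cocyclePresheaf g)
    (fun V W f r m => Subtype.ext <| funext fun i => by
      refine (map_mul (rs _) _ _).trans ?_
      refine congrArg (· * _) ?_
      refine (rs_rs _ _ _).trans (Eq.symm ?_)
      exact (rs_rs (leOfHom f.unop) _ _))) (isSheaf_cocyclePresheaf g)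

variable {g}

/-- The section of the line bundle of a cocycle over the `i`-th open set that has `i`-th component
equal to `1`. -/
noncomputable def IsCocycle.gen (hg : IsCocycle g) (i : I) : Γ(cocycleModule g, U i) :=
  (⟨fun j => g j i, fun j l W hj hl hjl => (hg.mul j l i W hjl hl hj).symm⟩ :
    cocycleSections g (U i))

theorem IsCocycle.isGenerator_gen (hg : IsCocycle g) (i : I) : IsGenerator (hg.gen i) := by
  intro V hV
  have key (a : Γ(X, V)) (j : I) :
      ((show cocycleSections g V from a • mres (cocycleModule g) hV (hg.gen i))).1 j =
        rs inf_le_right a * rs (inf_le_inf_left _ hV) (g j i) := rfl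
  constructor
  · intro a b hab
    have h1 := congrFun (congrArg Subtype.val hab) i
    rw [key, key, hg.self, map_one, mul_one, mul_one] at h1
    have h2 := congrArg (rs (le_inf hV le_rfl : V ≤ U i ⊓ V)) h1
    rwa [rs_rs, rs_rs, rs_self, rs_self] at h2
  · intro m
    let m' : cocycleSections g V := m
    refine ⟨rs (le_inf hV le_rfl) (m'.1 i), ?_⟩
    refine Subtype.ext <| funext fun j => ?_
    rw [key, rs_rs]
    have h1 := m'.2 j i (U j ⊓ V) le_rfl (inf_le_right.trans (le_inf hV le_rfl))
      (inf_le_inf_left _ hV)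
    rw [rs_self] at h1
    exact ((mul_comm _ _).trans h1.symm)

theorem IsCocycle.isLineBundle (hg : IsCocycle g) : IsLineBundle (cocycleModule g) := fun x => by
  obtain ⟨i, hi⟩ := hg.cover x
  exact ⟨U i, hi, _, hg.isGenerator_gen i⟩

end

/-! ### Criteria for isomorphisms of line bundles -/

section
variable {X : Scheme.{u}}

/-- A morphism of sheaves of modules is an isomorphism if locally it maps some generator to a
generator. -/
theorem isIso_of_isGenerator {L M : X.Modules} (f : L ⟶ M)
    (H : ∀ x : X, ∃ (U : X.Opens) (_ : x ∈ U) (e : Γ(L, U)), IsGenerator e ∧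
      IsGenerator (f.app U e)) : IsIso f := by
  have h1 : IsLocIso ((toPMod X).map f) := by
    refine (isLocIso_iff _).2 ⟨fun V m hm x hx => ?_, fun V n x hx => ?_⟩
    · obtain ⟨U, hU, e, he, hfe⟩ := H x
      refine ⟨V ⊓ U, homOfLE inf_le_left, ⟨hx, hU⟩, ?_⟩
      obtain ⟨a, ha⟩ := (he (inf_le_right : V ⊓ U ≤ U)).2 (mres L inf_le_left m)
      replace ha : a • mres L inf_le_right e = mres L inf_le_left m := ha
      have h2 : a • mres M (inf_le_right : V ⊓ U ≤ U) (f.app U e) = 0 := by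
        rw [← mres_app, ← Scheme.Modules.Hom.app_smul, ha]
        exact (mres_app f inf_le_left (show Γ(L, V) from m)).trans
          ((congrArg (mres M inf_le_left) hm).trans (map_zero _))
      have h3 : a = 0 := (hfe (inf_le_right : V ⊓ U ≤ U)).1 (h2.trans (zero_smul _ _).symm)
      rw [h3, zero_smul] at ha
      exact ha.symm
    · obtain ⟨U, hU, e, he, hfe⟩ := H x
      obtain ⟨a, ha⟩ := (hfe (inf_le_right : V ⊓ U ≤ U)).2 (mres M inf_le_left n)
      replace ha : a • mres M inf_le_right (f.app U e) = mres M inf_le_left n := ha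
      refine ⟨V ⊓ U, homOfLE inf_le_left, ⟨hx, hU⟩, a • mres L inf_le_right e, ?_⟩
      refine Eq.trans (Scheme.Modules.Hom.app_smul f a (mres L inf_le_right e)) ?_
      rw [mres_app]
      exact ha
  have h2 := (isIso_sheafification_map_iff _).2 h1
  have h3 := (sheafificationAdj X).counit.naturality f
  have h4 : f = inv ((sheafificationAdj X).counit.app L) ≫
      (sheafification X).map ((toPMod X).map f) ≫ (sheafificationAdj X).counit.app M := by
    rw [IsIso.eq_inv_comp]
    exact h3.symm
  rw [h4]
  infer_instance

/-- The morphism from the tensor product given by a bilinear map on sections. -/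
noncomputable def tensorHom {L M K : X.Modules} (μ : ∀ V : X.Opens, Γ(L, V) → Γ(M, V) → Γ(K, V))
    (h_add : ∀ V l l' m, μ V (l + l') m = μ V l m + μ V l' m)
    (h_smul : ∀ V (a : Γ(X, V)) l m, μ V (a • l) m = a • μ V l m)
    (h_add' : ∀ V l m m', μ V l (m + m') = μ V l m + μ V l m')
    (h_smul' : ∀ V (a : Γ(X, V)) l m, μ V l (a • m) = a • μ V l m)
    (h_res : ∀ {U V : X.Opens} (i : V ≤ U) l m,
      μ V (mres L i l) (mres M i m) = mres K i (μ U l m)) :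
    ((toPMod X).obj L ⊗ (toPMod X).obj M : PMod X.presheaf) ⟶ (toPMod X).obj K where
  app V := (ModuleCat.homAddEquiv
      (M := ((toPMod X).obj L ⊗ (toPMod X).obj M : PMod X.presheaf).obj V)
      (N := ((toPMod X).obj K).obj V)).symm
    (TensorProduct.lift (LinearMap.mk₂ (M := ((toPMod X).obj L).obj V)
      (Nₗ := ((toPMod X).obj M).obj V) (Pₗ := ((toPMod X).obj K).obj V) (X.presheaf.obj V)
      (μ V.unop) (h_add _) (h_smul _) (h_add' _) (h_smul' _)))
  naturality i := ModuleCat.MonoidalCategory.tensor_ext (fun l m => h_res (leOfHom i.unop) l m)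

/-- A morphism from a tensor product to a line bundle induces an isomorphism on the associated
sheaves if locally it maps the product of some generators to a generator. -/
theorem nonempty_tensor_iso {L M K : X.Modules}
    (φ : ((toPMod X).obj L ⊗ (toPMod X).obj M : PMod X.presheaf) ⟶ (toPMod X).obj K)
    (H : ∀ x : X, ∃ (U : X.Opens) (_ : x ∈ U) (e : Γ(L, U)) (e' : Γ(M, U)), IsGenerator e ∧
      IsGenerator e' ∧ IsGenerator (L := K) (U := U) (φ.app (op U)
        (TensorProduct.tmul (X.presheaf.obj (op U)) (M := ((toPMod X).obj L).obj (op U))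
          (N := ((toPMod X).obj M).obj (op U)) e e'))) :
    Nonempty (tensor L M ≅ K) := by
  have h1 : IsLocIso φ := by
    have gen {V : X.Opens} (e : Γ(L, V)) (e' : Γ(M, V)) (he : IsGenerator e) (he' : IsGenerator e')
        (t : TensorProduct (X.presheaf.obj (op V)) (((toPMod X).obj L).obj (op V))
          (((toPMod X).obj M).obj (op V))) : ∃ a : X.presheaf.obj (op V),
          t = a • TensorProduct.tmul (X.presheaf.obj (op V)) (M := ((toPMod X).obj L).obj (op V))
            (N := ((toPMod X).obj M).obj (op V)) e e' := by
      induction t using TensorProduct.induction_on with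
      | zero => exact ⟨0, (zero_smul _ _).symm⟩
      | tmul l m =>
        obtain ⟨a, rfl⟩ := (he le_rfl).2 l
        obtain ⟨b, rfl⟩ := (he' le_rfl).2 m
        rw [mres_self, mres_self]
        refine ⟨a * b, ?_⟩
        exact TensorProduct.smul_tmul_smul _ _ _ _
      | add s t hs ht =>
        obtain ⟨a, rfl⟩ := hs
        obtain ⟨b, rfl⟩ := ht
        exact ⟨a + b, (add_smul _ _ _).symm⟩
    have hres {V W : X.Opens} (i : W ≤ V) (e : Γ(L, V)) (e' : Γ(M, V)) :
        (φ.app (op W) (TensorProduct.tmul (X.presheaf.obj (op W))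
          (M := ((toPMod X).obj L).obj (op W)) (N := ((toPMod X).obj M).obj (op W))
            (mres L i e) (mres M i e')) : Γ(K, W)) =
        mres K i (φ.app (op V) (TensorProduct.tmul (X.presheaf.obj (op V))
          (M := ((toPMod X).obj L).obj (op V)) (N := ((toPMod X).obj M).obj (op V)) e e')) :=
      (congrArg (φ.app (op W)) (presheaf_map_tmul ((toPMod X).obj L) ((toPMod X).obj M)
        (homOfLE i) e e').symm).trans (app_res φ (homOfLE i) _)
    refine (isLocIso_iff _).2 ⟨fun V t ht x hx => ?_, fun V n x hx => ?_⟩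
    · obtain ⟨U, hU, e, e', he, he', hφ⟩ := H x
      have i : V ⊓ U ≤ U := inf_le_right
      refine ⟨V ⊓ U, homOfLE inf_le_left, ⟨hx, hU⟩, ?_⟩
      obtain ⟨a, ha⟩ := gen (mres L i e) (mres M i e') (he.mres i) (he'.mres i)
        (res _ (homOfLE (inf_le_left : V ⊓ U ≤ V)) t)
      have h1 : φ.app (op (V ⊓ U)) (res _ (homOfLE (inf_le_left : V ⊓ U ≤ V)) t) = 0 := by
        rw [app_res, ht]
        exact map_zero (((toPMod X).obj K).presheaf.map _).hom
      rw [ha] at h1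
      have h2 := ((φ.app (op (V ⊓ U))).hom.map_smul a _).symm.trans h1
      have h3 : a • mres K i (φ.app (op U) (TensorProduct.tmul (X.presheaf.obj (op U))
          (M := ((toPMod X).obj L).obj (op U)) (N := ((toPMod X).obj M).obj (op U)) e e')) = 0 :=
        (congrArg (a • ·) (hres i e e').symm).trans h2
      have h4 : a = 0 := (hφ i).1 (h3.trans (zero_smul _ _).symm)
      rw [h4] at ha
      exact ha.trans (zero_smul _ _)
    · obtain ⟨U, hU, e, e', he, he', hφ⟩ := H x
      have i : V ⊓ U ≤ U := inf_le_right
      obtain ⟨a, ha⟩ := (hφ i).2 (mres K inf_le_left n)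
      refine ⟨V ⊓ U, homOfLE inf_le_left, ⟨hx, hU⟩,
        a • TensorProduct.tmul (X.presheaf.obj (op (V ⊓ U)))
          (M := ((toPMod X).obj L).obj (op (V ⊓ U))) (N := ((toPMod X).obj M).obj (op (V ⊓ U)))
          (mres L i e) (mres M i e'), ?_⟩
      refine ((φ.app (op (V ⊓ U))).hom.map_smul a _).trans ?_
      exact (congrArg (a • ·) (hres i e e')).trans ha
  have h2 := (isIso_sheafification_map_iff _).2 h1
  exact ⟨@asIso _ _ _ _ _ h2 ≪≫ sheafificationObjIso K⟩

/-! ### The Picard group and line bundles -/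

theorem isLineBundle_of_mk_eq {a : Pic X} {L : X.Modules} (h : a.1.val = .mk L) :
    IsLineBundle L := fun x => by
  obtain ⟨U, hU, hUa⟩ := a.2 x
  have h1 : ModuleClass.map U.ι a.1.val = 1 := congrArg Units.val hUa
  rw [h, ModuleClass.map_mk] at h1
  obtain ⟨f⟩ := ModuleClass.mk_eq_mk_iff.1 h1
  obtain ⟨e, he⟩ := isGenerator_of_restrict
    ((Scheme.Modules.restrictFunctorIsoPullback U.ι).app L ≪≫ f)
  exact ⟨U.ι ''ᵁ ⊤, ⟨⟨x, hU⟩, trivial, rfl⟩, e, he⟩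

theorem mem_picSubgroup {u : (ModuleClass X)ˣ} {L : X.Modules} (hL : IsLineBundle L)
    (h : u.val = .mk L) : u ∈ picSubgroup X := fun x => by
  obtain ⟨U, hU, e, he⟩ := hL x
  refine ⟨U, hU, Units.ext ?_⟩
  obtain ⟨f⟩ := nonempty_restrict_iso he
  refine (congrArg (ModuleClass.map U.ι) h).trans ?_
  exact ModuleClass.mk_eq_mk_iff.2 ⟨((Scheme.Modules.restrictFunctorIsoPullback U.ι).app L).symm ≪≫ f⟩

section
variable {I : Type u} {U : I → X.Opens} {g g' : ∀ i j, Γ(X, U i ⊓ U j)}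

theorem IsCocycle.one (hU : ∀ x : X, ∃ i, x ∈ U i) :
    IsCocycle (fun i j => (1 : Γ(X, U i ⊓ U j))) where
  cover := hU
  self _ := rfl
  mul _ _ _ _ _ _ _ := by simp

theorem nonempty_cocycleModule_one (hU : ∀ x : X, ∃ i, x ∈ U i) :
    Nonempty (structureSheaf X ≅ cocycleModule (fun i j => (1 : Γ(X, U i ⊓ U j)))) := by
  let φ : structureSheaf X ⟶ cocycleModule (fun i j => (1 : Γ(X, U i ⊓ U j))) := mkHom
    (fun V (a : Γ(X, V)) => (⟨fun i => rs inf_le_right a, fun i j W hi hj hij => by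
      rw [rs_rs, rs_rs, map_one, one_mul]⟩ : cocycleSections _ V))
    (fun V a b => Subtype.ext <| funext fun i => map_add (rs _) a b)
    (fun V a b => Subtype.ext <| funext fun i => map_mul (rs _) a b)
    (fun {V V'} i a => Subtype.ext <| funext fun j => by
      exact (rs_rs i inf_le_right a).trans (rs_rs inf_le_right (inf_le_inf_left (U j) i) a).symm)
  have : IsIso φ := isIso_of_isGenerator φ fun x => by
    obtain ⟨i, hi⟩ := hU x
    refine ⟨U i, hi, (1 : Γ(X, U i)), isGenerator_one _, ?_⟩
    have h1 : φ.app (U i) (1 : Γ(X, U i)) = (IsCocycle.one hU).gen i :=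
      Subtype.ext <| funext fun j => map_one (rs _)
    rw [h1]
    exact (IsCocycle.one hU).isGenerator_gen i
  exact ⟨asIso φ⟩

/-- The product of the sections of the line bundles of two cocycles that are inverse to each
other. -/
noncomputable def cocycleMul (h : ∀ i j, g i j * g' i j = 1) (V : X.Opens)
    (a : cocycleSections g V) (b : cocycleSections g' V) :
    cocycleSections (fun i j => (1 : Γ(X, U i ⊓ U j))) V :=
  ⟨fun i => a.1 i * b.1 i, fun i j W hi hj hij => by
    rw [map_mul, map_mul, map_one, one_mul, a.2 i j W hi hj hij, b.2 i j W hi hj hij,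
      mul_mul_mul_comm, ← map_mul, h, map_one, one_mul]⟩

/-- The morphism induced by the product of sections. -/
noncomputable def cocycleMulHom (h : ∀ i j, g i j * g' i j = 1) :
    ((toPMod X).obj (cocycleModule g) ⊗ (toPMod X).obj (cocycleModule g') : PMod X.presheaf) ⟶
      (toPMod X).obj (cocycleModule (fun i j => (1 : Γ(X, U i ⊓ U j)))) :=
  tensorHom (L := cocycleModule g) (M := cocycleModule g')
    (K := cocycleModule (fun i j => (1 : Γ(X, U i ⊓ U j)))) (cocycleMul h)
    (fun _ _ _ _ => Subtype.ext <| funext fun _ => add_mul _ _ _)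
    (fun _ _ _ _ => Subtype.ext <| funext fun _ => mul_assoc _ _ _)
    (fun _ _ _ _ => Subtype.ext <| funext fun _ => mul_add _ _ _)
    (fun _ _ _ _ => Subtype.ext <| funext fun _ => mul_left_comm _ _ _)
    (fun _ _ _ => Subtype.ext <| funext fun _ => (map_mul (rs _) _ _).symm)

/-- The line bundle of an invertible cocycle has a class in the Picard group. -/
theorem IsCocycle.exists_pic (hg : IsCocycle g) (hg' : IsCocycle g')
    (h : ∀ i j, g i j * g' i j = 1) : ∃ a : Pic X, a.1.val = .mk (cocycleModule g) := by
  have h1 : Nonempty (tensor (cocycleModule g) (cocycleModule g') ≅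
      cocycleModule (fun i j => (1 : Γ(X, U i ⊓ U j)))) := by
    refine nonempty_tensor_iso (cocycleMulHom h) fun x => ?_
    obtain ⟨i, hi⟩ := hg.cover x
    refine ⟨U i, hi, hg.gen i, hg'.gen i, hg.isGenerator_gen i, hg'.isGenerator_gen i, ?_⟩
    have h1 : cocycleMul h (U i) (hg.gen i) (hg'.gen i) = (IsCocycle.one hg.cover).gen i :=
      Subtype.ext <| funext fun j => h j i
    have h2 := (IsCocycle.one hg.cover).isGenerator_gen i
    rw [← h1] at h2
    exact h2
  obtain ⟨f⟩ := h1
  obtain ⟨f'⟩ := nonempty_cocycleModule_one (U := U) hg.cover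
  have h2 : ModuleClass.mk (cocycleModule g) * .mk (cocycleModule g') = 1 :=
    ModuleClass.mk_eq_mk_iff.2 ⟨f ≪≫ f'.symm⟩
  exact ⟨⟨⟨.mk (cocycleModule g), .mk (cocycleModule g'), h2, (mul_comm _ _).trans h2⟩,
    mem_picSubgroup hg.isLineBundle rfl⟩, rfl⟩

end

end

/-! ### The line bundle of a torsor -/

theorem IsGenerator.unit_smul {X : Scheme.{u}} {L : X.Modules} {U : X.Opens} {e : Γ(L, U)}
    (he : IsGenerator e) {a : Γ(X, U)} (ha : IsUnit a) : IsGenerator (a • e) := by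
  intro V i
  have h1 : IsUnit (rs i a) := ha.map _
  have h2 : (fun b : Γ(X, V) => b • PicardFunctor.mres L i (a • e)) =
      (fun b : Γ(X, V) => b • PicardFunctor.mres L i e) ∘ (fun b => b * rs i a) := by
    funext b
    exact (congrArg (b • ·) (mres_smul L i a e)).trans (mul_smul b (rs i a) _).symm
  rw [h2]
  exact (he i).comp (IsUnit.isUnit_iff_mulRight_bijective.1 h1)

theorem IsCocycle.eq_smul_gen {X : Scheme.{u}} {I : Type u} {U : I → X.Opens}
    {g : ∀ i j, Γ(X, U i ⊓ U j)} (hg : IsCocycle g) {i : I} {V : X.Opens} (hV : V ≤ U i)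
    (m : cocycleSections g V) :
    (show Γ(cocycleModule g, V) from m) =
      rs (le_inf hV le_rfl) (m.1 i) • mres (cocycleModule g) hV (hg.gen i) := by
  refine Subtype.ext <| funext fun j => ?_
  have h1 := m.2 j i (U j ⊓ V) le_rfl (inf_le_right.trans (le_inf hV le_rfl))
    (inf_le_inf_left _ hV)
  rw [rs_self] at h1
  refine h1.trans ((mul_comm _ _).trans ?_)
  exact congrArg (· * _) (rs_rs (le_inf hV le_rfl) inf_le_right (m.1 i)).symm

theorem ev_rs {X W : Scheme.{u}} (l : W ⟶ X) {V V' : X.Opens} (i : V' ≤ V) (h : ⊤ ≤ l ⁻¹ᵁ V)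
    (h' : ⊤ ≤ l ⁻¹ᵁ V') (s : Γ(X, V)) : ev l h' (rs i s) = ev l h s := ev_map l _ h h' s

theorem ev_mul {X W : Scheme.{u}} (l : W ⟶ X) {V : X.Opens} (h : ⊤ ≤ l ⁻¹ᵁ V) (s t : Γ(X, V)) :
    ev l h (s * t) = ev l h s * ev l h t := RingHom.map_mul _ _ _

theorem ev_one {X W : Scheme.{u}} (l : W ⟶ X) {V : X.Opens} (h : ⊤ ≤ l ⁻¹ᵁ V) :
    ev l h (1 : Γ(X, V)) = 1 := RingHom.map_one _

namespace Coframe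

variable {X Y Z : Scheme.{u}} {L : X.Modules} {h : Y ⟶ X}

theorem val_id_res (k : Z ⟶ Y) {h' : Z ⟶ X} (w : k ≫ h = h') (ψ : Coframe L h) {V : X.Opens}
    (hl : ∀ z, h' ((𝟙 Z : Z ⟶ Z) z) ∈ V) (hl' : ∀ z, h (k z) ∈ V) (m : Γ(L, V)) :
    (ψ.res k w).val (𝟙 Z) hl m = ψ.val k hl' m :=
  have e := Category.id_comp k
  have h1 : ∀ z, h ((𝟙 Z ≫ k) z) ∈ V := by rw [e]; exact hl'
  (val_res k w ψ (𝟙 Z) hl h1 m).trans (ψ.val_congr e h1 hl' m)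

end Coframe

namespace GmTorsor

theorem div_mul_div {X : Scheme.{u}} (P : GmTorsor X) {Y : Scheme.{u}} [IsLocallyNoetherian Y]
    {h : Y ⟶ X} (r s t : P.sec h) : P.div r s * P.div s t = P.div r t :=
  P.eq_div (by rw [mul_smul, P.div_smul, P.div_smul])

theorem div_self {X : Scheme.{u}} (P : GmTorsor X) {Y : Scheme.{u}} [IsLocallyNoetherian Y]
    {h : Y ⟶ X} (s : P.sec h) : P.div s s = 1 := (P.eq_div (one_smul _ _)).symm

/-- A family of sections of a torsor over the members of a covering by open sets. -/
structure LocalSections {X : Scheme.{u}} [IsLocallyNoetherian X] (P : GmTorsor X) where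
  U : X → X.Opens
  mem (x : X) : x ∈ U x
  sec (x : X) : P.sec (U x).ι

variable {X : Scheme.{u}} [IsLocallyNoetherian X] (P : GmTorsor X)

theorem nonempty_localSections : Nonempty P.LocalSections := by
  choose U hU p using P.exists_sec_opens
  exact ⟨⟨U, hU, fun x => (p x).some⟩⟩

namespace LocalSections

variable {P} (p : P.LocalSections) {W W' : Scheme.{u}} [IsLocallyNoetherian W]
  [IsLocallyNoetherian W']

/-- The restriction of a local section to a scheme mapping into its domain. -/
noncomputable def pull (x : X) (l : W ⟶ X) (hl : ⊤ ≤ l ⁻¹ᵁ p.U x) : P.sec l :=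
  P.res (liftOpens l hl) (liftOpens_ι l hl) (p.sec x)

theorem pull_eq (x : X) {l : W ⟶ X} (b : W ⟶ (p.U x).toScheme) (hb : b ≫ (p.U x).ι = l)
    (hl : ⊤ ≤ l ⁻¹ᵁ p.U x) : p.pull x l hl = P.res b hb (p.sec x) :=
  P.res_congr ((cancel_mono (p.U x).ι).1 ((liftOpens_ι l hl).trans hb.symm)) _ _ _

theorem res_pull (x : X) (l : W ⟶ X) (hl : ⊤ ≤ l ⁻¹ᵁ p.U x) (k : W' ⟶ W) {l' : W' ⟶ X}
    (w : k ≫ l = l') (hl' : ⊤ ≤ l' ⁻¹ᵁ p.U x) : P.res k w (p.pull x l hl) = p.pull x l' hl' := by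
  have h1 : (k ≫ liftOpens l hl) ≫ (p.U x).ι = l' := by rw [Category.assoc, liftOpens_ι, w]
  rw [p.pull_eq x _ h1, pull, P.res_res _ _ _ _ h1]

/-- The `n`-th power of the cocycle of quotients of local sections of a torsor. -/
noncomputable def cocycle (n : ℤ) (x y : X) : Γ(X, p.U x ⊓ p.U y) :=
  ((bijective_ev_ι (p.U x ⊓ p.U y)).2 ((P.div (p.pull x _ (top_le_ι inf_le_left))
    (p.pull y _ (top_le_ι inf_le_right)) ^ n : gm _) : Γ((p.U x ⊓ p.U y).toScheme, ⊤))).choose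

theorem ev_ι_cocycle (n : ℤ) (x y : X) : ev (p.U x ⊓ p.U y).ι (top_le_ι le_rfl) (p.cocycle n x y) =
    ((P.div (p.pull x _ (top_le_ι inf_le_left)) (p.pull y _ (top_le_ι inf_le_right)) ^ n : gm _) :
      Γ((p.U x ⊓ p.U y).toScheme, ⊤)) :=
  ((bijective_ev_ι (p.U x ⊓ p.U y)).2 _).choose_spec

theorem ev_cocycle (n : ℤ) (x y : X) (l : W ⟶ X) (hx : ⊤ ≤ l ⁻¹ᵁ p.U x) (hy : ⊤ ≤ l ⁻¹ᵁ p.U y)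
    (h : ⊤ ≤ l ⁻¹ᵁ (p.U x ⊓ p.U y)) : ev l h (p.cocycle n x y) =
      ((P.div (p.pull x l hx) (p.pull y l hy) ^ n : gm W) : Γ(W, ⊤)) := by
  have e := liftOpens_ι l h
  have h' : ⊤ ≤ (liftOpens l h ≫ (p.U x ⊓ p.U y).ι) ⁻¹ᵁ (p.U x ⊓ p.U y) := by rw [e]; exact h
  rw [ev_congr e.symm h h', ev_comp _ _ (top_le_ι le_rfl) h', ev_ι_cocycle, ← val_gmMap, map_zpow,
    P.gmMap_div _ e, p.res_pull _ _ _ _ _ hx, p.res_pull _ _ _ _ _ hy]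

theorem isCocycle (n : ℤ) : IsCocycle (p.cocycle n) where
  cover x := ⟨x, p.mem x⟩
  self x := by
    apply (bijective_ev_ι _).1
    rw [ev_ι_cocycle, ev_one, div_self, one_zpow, Units.val_one]
  mul x y z V hxy hyz hxz := by
    apply (bijective_ev_ι _).1
    have hx : ⊤ ≤ V.ι ⁻¹ᵁ p.U x := top_le_ι (hxy.trans inf_le_left)
    have hy : ⊤ ≤ V.ι ⁻¹ᵁ p.U y := top_le_ι (hxy.trans inf_le_right)
    have hz : ⊤ ≤ V.ι ⁻¹ᵁ p.U z := top_le_ι (hyz.trans inf_le_right)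
    rw [ev_mul, ev_rs _ _ (top_le_ι hxy), ev_rs _ _ (top_le_ι hyz), ev_rs _ _ (top_le_ι hxz),
      p.ev_cocycle _ _ _ _ hx hy, p.ev_cocycle _ _ _ _ hy hz, p.ev_cocycle _ _ _ _ hx hz,
      ← Units.val_mul, ← mul_zpow, div_mul_div]

theorem cocycle_mul_cocycle (x y : X) : p.cocycle 1 x y * p.cocycle (-1) x y = 1 := by
  apply (bijective_ev_ι _).1
  rw [ev_mul, ev_ι_cocycle, ev_ι_cocycle, ← Units.val_mul, ← zpow_add, add_neg_cancel, zpow_zero,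
    ev_one, Units.val_one]

/-- The line bundle of a torsor with given local sections. -/
noncomputable abbrev lineBundle : X.Modules := cocycleModule (p.cocycle 1)

omit [IsLocallyNoetherian X] in
theorem preimage_ι_le_inf (U V : X.Opens) : U.ι ⁻¹ᵁ V ≤ U.ι ⁻¹ᵁ (U ⊓ V) := fun x hx => ⟨x.2, hx⟩

/-- The coframe of the line bundle of a torsor given by the `x`-th component of sections. -/
noncomputable def coframe (x : X) : Coframe p.lineBundle (p.U x).ι where
  toFun {V} (m : cocycleSections (p.cocycle 1) V) :=
    (p.U x).ι.appLE (p.U x ⊓ V) ((p.U x).ι ⁻¹ᵁ V) (preimage_ι_le_inf _ _) (m.1 x)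
  map_add m n := map_add _ _ _
  map_smul {V} a (m : cocycleSections (p.cocycle 1) V) := by
    refine (map_mul ((p.U x).ι.appLE _ _ _).hom (rs inf_le_right a) (m.1 x)).trans ?_
    refine congrArg (· * _) ?_
    have h1 := Scheme.Hom.map_appLE (p.U x).ι (preimage_ι_le_inf _ V)
      (homOfLE (inf_le_right : p.U x ⊓ V ≤ V)).op
    rw [Scheme.Hom.appLE_eq_app] at h1
    exact congrArg (fun f => f a) h1
  map_res {V V'} i (m : cocycleSections (p.cocycle 1) V) := by
    have h1 := Scheme.Hom.map_appLE (p.U x).ι (preimage_ι_le_inf _ V')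
      (homOfLE (inf_le_inf_left (p.U x) i)).op
    have h2 := Scheme.Hom.appLE_map (p.U x).ι (preimage_ι_le_inf _ V)
      (homOfLE ((p.U x).ι.preimage_mono i)).op
    exact congrArg (fun f => f (m.1 x)) (h1.trans h2.symm)
  frame y := by
    refine ⟨p.U x, (p.isCocycle 1).gen x, ?_⟩
    have h1 : (show cocycleSections (p.cocycle 1) (p.U x) from (p.isCocycle 1).gen x).1 x = 1 :=
      (p.isCocycle 1).self x
    have h2 : ((p.U x).ι.appLE (p.U x ⊓ p.U x) ((p.U x).ι ⁻¹ᵁ p.U x) (preimage_ι_le_inf _ _))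
        ((show cocycleSections (p.cocycle 1) (p.U x) from (p.isCocycle 1).gen x).1 x) = 1 := by
      rw [h1, map_one]
    have h3 : y ∈ (p.U x).toScheme.basicOpen (1 : Γ((p.U x).toScheme, (p.U x).ι ⁻¹ᵁ p.U x)) := by
      rw [Scheme.basicOpen_one]
      exact y.2
    rw [← h2] at h3
    exact h3

omit [IsLocallyNoetherian W] in
theorem coframe_val (x : X) (b : W ⟶ (p.U x).toScheme) {V : X.Opens}
    (hV : ∀ z, (p.U x).ι (b z) ∈ V) (h : ⊤ ≤ (b ≫ (p.U x).ι) ⁻¹ᵁ (p.U x ⊓ V))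
    (m : cocycleSections (p.cocycle 1) V) :
    (p.coframe x).val b hV (show Γ(p.lineBundle, V) from m) = ev (b ≫ (p.U x).ι) h (m.1 x) := by
  have := Scheme.Hom.appLE_comp_appLE b (p.U x).ι (p.U x ⊓ V) ((p.U x).ι ⁻¹ᵁ V) ⊤
    (preimage_ι_le_inf _ _) (Coframe.top_le_preimage hV)
  exact congrArg (fun f => f (m.1 x)) this

theorem ev_component {V : X.Opens} (m : cocycleSections (p.cocycle 1) V) (x y : X) (l : W ⟶ X)
    (hx : ⊤ ≤ l ⁻¹ᵁ p.U x) (hy : ⊤ ≤ l ⁻¹ᵁ p.U y) (hxV : ⊤ ≤ l ⁻¹ᵁ (p.U x ⊓ V))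
    (hyV : ⊤ ≤ l ⁻¹ᵁ (p.U y ⊓ V)) :
    ev l hxV (m.1 x) = (P.div (p.pull x l hx) (p.pull y l hy) : Γ(W, ⊤)) * ev l hyV (m.1 y) := by
  have h1 := m.2 x y ((p.U x ⊓ p.U y) ⊓ V) (inf_le_inf_right _ inf_le_left)
    (inf_le_inf_right _ inf_le_right) inf_le_left
  have hxy : ⊤ ≤ l ⁻¹ᵁ (p.U x ⊓ p.U y) := fun z hz => ⟨hx hz, hy hz⟩
  have h : ⊤ ≤ l ⁻¹ᵁ ((p.U x ⊓ p.U y) ⊓ V) := fun z hz => ⟨hxy hz, (hxV hz).2⟩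
  have h2 := congrArg (ev l h) h1
  rwa [ev_mul, ev_rs _ _ hxV, ev_rs _ _ hxy, ev_rs _ _ hyV, p.ev_cocycle 1 x y l hx hy,
    zpow_one] at h2

/-- A torsor is isomorphic to the torsor of its line bundle. -/
theorem nonempty_hom_lineBundle :
    Nonempty (Hom P (coframeTorsor p.lineBundle (p.isCocycle 1).isLineBundle)) := by
  refine Hom.exists_of_cover (k := fun x => (p.U x).ι) (IsFppfCover.of_opens fun x => ⟨x, p.mem x⟩)
    p.sec p.coframe fun x y W _ a b e c hc => Coframe.ext_val fun {V} m => ?_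
  set l := ((a ≫ (p.U x).ι) ⁻¹ᵁ V).ι with hl
  have hm := Coframe.mem_of_subtype (a ≫ (p.U x).ι) V
  have e' : (l ≫ b) ≫ (p.U y).ι = (l ≫ a) ≫ (p.U x).ι := by
    rw [Category.assoc, e, Category.assoc]
  have hma (z) : (p.U x).ι ((l ≫ a) z) ∈ V := hm z
  have hmb (z) : (p.U y).ι ((l ≫ b) z) ∈ V := by
    have := hma z
    rwa [← Scheme.Hom.comp_apply, ← e', Scheme.Hom.comp_apply] at this
  have hx : ⊤ ≤ ((l ≫ a) ≫ (p.U x).ι) ⁻¹ᵁ p.U x := fun z _ => ((l ≫ a) z).2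
  have hy' : ⊤ ≤ ((l ≫ b) ≫ (p.U y).ι) ⁻¹ᵁ p.U y := fun z _ => ((l ≫ b) z).2
  have hy : ⊤ ≤ ((l ≫ a) ≫ (p.U x).ι) ⁻¹ᵁ p.U y := by rw [← e']; exact hy'
  have hxV : ⊤ ≤ ((l ≫ a) ≫ (p.U x).ι) ⁻¹ᵁ (p.U x ⊓ V) := fun z hz => ⟨hx hz, hma z⟩
  have hyV : ⊤ ≤ ((l ≫ b) ≫ (p.U y).ι) ⁻¹ᵁ (p.U y ⊓ V) := fun z hz => ⟨hy' hz, hmb z⟩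
  have hyV' : ⊤ ≤ ((l ≫ a) ≫ (p.U x).ι) ⁻¹ᵁ (p.U y ⊓ V) := by rw [← e']; exact hyV
  have w : l ≫ a ≫ (p.U x).ι = (l ≫ a) ≫ (p.U x).ι := (Category.assoc _ _ _).symm
  have h1 : gmMap l c = P.div (p.pull x _ hx) (p.pull y _ hy) := by
    rw [p.pull_eq x (l ≫ a) rfl, p.pull_eq y (l ≫ b) e', ← P.res_res _ l rfl w,
      ← P.res_res _ l e w, hc, P.res_smul]
    exact P.eq_div rfl
  refine (Coframe.val_res a rfl (p.coframe x) l hm hma m).trans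
    (Eq.trans ?_ (Coframe.val_gm_smul _ _ l hm m).symm)
  have h2 := Coframe.val_res b e (p.coframe y) l hm hmb m
  refine Eq.trans ?_ (congrArg (_ * ·) h2.symm)
  refine (p.coframe_val x (l ≫ a) hma hxV m).trans
    (Eq.trans ?_ (congrArg (_ * ·) (p.coframe_val y (l ≫ b) hmb hyV m).symm))
  refine (p.ev_component m x y _ hx hy hxV hyV').trans ?_
  rw [h1]
  exact congrArg (_ * ·) (ev_congr e' hyV hyV' _).symm

/-- A line bundle is determined by its torsor. -/
theorem nonempty_iso_lineBundle {L : X.Modules} {hL : IsLineBundle L}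
    (Φ : Hom (coframeTorsor L hL) P) : Nonempty (L ≅ p.lineBundle) := by
  let ψ (x : X) : Coframe L (p.U x).ι := Φ.symm.app (p.sec x)
  have mem (x : X) (V : X.Opens) (z) : (p.U x).ι (liftOpens (p.U x ⊓ V).ι
      (top_le_ι (inf_le_left : p.U x ⊓ V ≤ p.U x)) z) ∈ V := by
    rw [← Scheme.Hom.comp_apply, liftOpens_ι]
    exact z.2.2
  choose F hF using fun (V : X.Opens) (m : Γ(L, V)) (x : X) => (bijective_ev_ι (p.U x ⊓ V)).2
    ((ψ x).val (liftOpens (p.U x ⊓ V).ι (top_le_ι inf_le_left)) (mem x V) m)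
  have hF' (V : X.Opens) (m : Γ(L, V)) (x : X) {W : Scheme.{u}} (l : W ⟶ X)
      (b : W ⟶ (p.U x).toScheme) (hb : b ≫ (p.U x).ι = l) (h : ⊤ ≤ l ⁻¹ᵁ (p.U x ⊓ V))
      (hV : ∀ z, (p.U x).ι (b z) ∈ V) : ev l h (F V m x) = (ψ x).val b hV m := by
    have e := liftOpens_ι l h
    have h' : ⊤ ≤ (liftOpens l h ≫ (p.U x ⊓ V).ι) ⁻¹ᵁ (p.U x ⊓ V) := by rw [e]; exact h
    have eb : liftOpens l h ≫ liftOpens (p.U x ⊓ V).ι (top_le_ι inf_le_left) = b := by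
      rw [← cancel_mono (p.U x).ι, Category.assoc, liftOpens_ι, e, hb]
    have hV' (z) : (p.U x).ι ((liftOpens l h ≫
        liftOpens (p.U x ⊓ V).ι (top_le_ι inf_le_left)) z) ∈ V := by rw [eb]; exact hV z
    rw [ev_congr e.symm h h', ev_comp _ _ (top_le_ι le_rfl) h', hF, ← (ψ x).val_congr eb hV' hV]
    exact ((ψ x).val_comp _ _ (mem x V) hV' m).symm
  have hdiv {V : X.Opens} (m : Γ(L, V)) (x y : X) {W : Scheme.{u}} [IsLocallyNoetherian W]
      (l : W ⟶ X) (a : W ⟶ (p.U x).toScheme) (b : W ⟶ (p.U y).toScheme)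
      (ha : a ≫ (p.U x).ι = l) (hb : b ≫ (p.U y).ι = l) (hx : ⊤ ≤ l ⁻¹ᵁ p.U x)
      (hy : ⊤ ≤ l ⁻¹ᵁ p.U y) (hxV : ∀ z, (p.U x).ι (a z) ∈ V) (hyV : ∀ z, (p.U y).ι (b z) ∈ V) :
      (ψ x).val a hxV m = (P.div (p.pull x l hx) (p.pull y l hy) : Γ(W, ⊤)) *
        (ψ y).val b hyV m := by
    have h1 : (ψ x).res a ha = P.div (p.pull x l hx) (p.pull y l hy) • (ψ y).res b hb := by
      have h2 := congrArg Φ.symm.app (P.div_smul (p.pull x l hx) (p.pull y l hy))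
      rw [Φ.symm.app_smul, p.pull_eq x a ha, p.pull_eq y b hb, Φ.symm.app_res,
        Φ.symm.app_res] at h2
      rw [p.pull_eq x a ha, p.pull_eq y b hb]
      exact h2.symm
    have hV (z) : l ((𝟙 W : W ⟶ W) z) ∈ V := by
      have := hxV z
      rw [← Scheme.Hom.comp_apply, ha] at this
      exact this
    have h2 := congrArg (fun χ => χ.val (𝟙 W) hV m) h1
    rw [← Coframe.val_id_res a ha (ψ x) hV hxV, ← Coframe.val_id_res b hb (ψ y) hV hyV]
    refine h2.trans ((Coframe.val_gm_smul _ _ _ hV m).trans ?_)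
    rw [gmMap_id]
  have hcoc (V : X.Opens) (m : Γ(L, V)) : F V m ∈ cocycleSections (p.cocycle 1) V := by
    intro x y W hi hj hij
    apply (bijective_ev_ι W).1
    have hx : ⊤ ≤ W.ι ⁻¹ᵁ p.U x := top_le_ι (hi.trans inf_le_left)
    have hy : ⊤ ≤ W.ι ⁻¹ᵁ p.U y := top_le_ι (hj.trans inf_le_left)
    have hmem {x : X} (hx : ⊤ ≤ W.ι ⁻¹ᵁ p.U x) (z) : (p.U x).ι (liftOpens W.ι hx z) ∈ V := by
      rw [← Scheme.Hom.comp_apply, liftOpens_ι]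
      exact (hi z.2).2
    rw [ev_mul, ev_rs _ _ (top_le_ι hi), ev_rs _ _ (top_le_ι hij), ev_rs _ _ (top_le_ι hj),
      p.ev_cocycle 1 x y _ hx hy, zpow_one,
      hF' V m x W.ι _ (liftOpens_ι _ hx) _ (hmem hx), hF' V m y W.ι _ (liftOpens_ι _ hy) _ (hmem hy)]
    exact hdiv m x y W.ι _ _ (liftOpens_ι _ hx) (liftOpens_ι _ hy) hx hy _ _
  let f : L ⟶ p.lineBundle := mkHom
    (fun V m => (⟨F V m, hcoc V m⟩ : cocycleSections (p.cocycle 1) V))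
    (fun V m n => Subtype.ext <| funext fun x => (bijective_ev_ι _).1 <| by
      refine (hF V (m + n) x).trans ((Coframe.val_add _ _ _ _ _).trans ?_)
      rw [← hF, ← hF]
      exact (RingHom.map_add _ _ _).symm)
    (fun V a m => Subtype.ext <| funext fun x => (bijective_ev_ι _).1 <| by
      refine (hF V (a • m) x).trans ((Coframe.val_smul _ _ _ _ _).trans ?_)
      refine Eq.trans ?_ (ev_mul _ _ (rs inf_le_right a) (F V m x)).symm
      rw [ev_rs _ _ (top_le_ι inf_le_right), hF]
      exact congrArg (· * _) (ev_congr (liftOpens_ι _ _) _ _ a))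
    (fun {V V'} i m => Subtype.ext <| funext fun x => (bijective_ev_ι _).1 <| by
      refine (hF V' (mres L i m) x).trans ((Coframe.val_mres _ _ _ _ _).trans ?_)
      refine Eq.trans ?_ (ev_rs _ (inf_le_inf_left _ i)
        (top_le_ι (inf_le_inf_left _ i)) _ (F V m x)).symm
      exact (hF' V m x _ _ (liftOpens_ι _ _) _ _).symm)
  have : IsIso f := isIso_of_isGenerator f fun x => by
    obtain ⟨V, hxV, e, he⟩ := hL x
    have hW : p.U x ⊓ V ≤ p.U x := inf_le_left
    have he' := he.mres (inf_le_right : p.U x ⊓ V ≤ V)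
    refine ⟨p.U x ⊓ V, ⟨p.mem x, hxV⟩, _, he', ?_⟩
    have h1 : f.app _ (mres L (inf_le_right : p.U x ⊓ V ≤ V) e) =
        rs (le_inf hW le_rfl) (F _ (mres L (inf_le_right : p.U x ⊓ V ≤ V) e) x) •
          mres p.lineBundle hW ((p.isCocycle 1).gen x) :=
      (p.isCocycle 1).eq_smul_gen hW ⟨F _ _, hcoc _ _⟩
    rw [h1]
    refine (((p.isCocycle 1).isGenerator_gen x).mres hW).unit_smul (IsUnit.map _ ?_)
    refine (MulEquiv.isUnit_map (RingEquiv.ofBijective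
      ((p.U x ⊓ (p.U x ⊓ V)).ι.appLE _ _ (top_le_ι le_rfl)).hom (bijective_ev_ι _))).1 ?_
    have h2 := (ψ x).isUnit_val he' _ (mem x (p.U x ⊓ V))
    rw [← hF] at h2
    exact h2
  exact ⟨asIso f⟩

end LocalSections

theorem Hom.nonempty_of_sec {P Q : GmTorsor X} (s : P.sec (𝟙 X)) (t : Q.sec (𝟙 X)) :
    Nonempty (Hom P Q) :=
  Hom.exists_of_cover (ι := PUnit) (k := fun _ => 𝟙 X)
    ⟨fun _ => inferInstance, fun _ => inferInstance, fun x => ⟨⟨⟩, x, rfl⟩⟩ (fun _ => s) (fun _ => t)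
    fun _ _ W _ a b e c hc => by
      have hab : a = b := by simpa using e.symm
      subst hab
      have hc1 : c = 1 := by
        rw [P.eq_div hc.symm]
        exact P.div_self _
      rw [hc1, one_smul]

end GmTorsor

/-! ### Torsors represent the Picard group -/

section
variable {X : Scheme.{u}} [IsLocallyNoetherian X]

/-- A torsor represents a class in the Picard group if it is isomorphic to the torsor of coframes of
a line bundle in that class. -/
def Represents (a : Pic X) (P : GmTorsor X) : Prop :=
  ∃ (L : X.Modules) (h : a.1.val = .mk L),
    Nonempty (GmTorsor.Hom (coframeTorsor L (isLineBundle_of_mk_eq h)) P)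

theorem exists_represents (a : Pic X) : ∃ P, Represents a P := by
  obtain ⟨L, hL⟩ := Quotient.exists_rep a.1.val
  exact ⟨_, L, hL.symm, ⟨.id _⟩⟩

/-- Every torsor comes from a line bundle: by Hilbert 90 it has sections over an open covering, and
these differ by a cocycle. -/
theorem exists_represented (P : GmTorsor X) : ∃ a, Represents a P := by
  obtain ⟨p⟩ := P.nonempty_localSections
  obtain ⟨a, ha⟩ := (p.isCocycle 1).exists_pic (p.isCocycle (-1)) p.cocycle_mul_cocycle
  obtain ⟨Φ⟩ := p.nonempty_hom_lineBundle
  exact ⟨a, _, ha, ⟨Φ.symm⟩⟩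

namespace Represents

variable {a b : Pic X} {P Q : GmTorsor X}

theorem of_hom (h : Represents a P) (Φ : GmTorsor.Hom P Q) : Represents a Q := by
  obtain ⟨L, hL, ⟨Ψ⟩⟩ := h
  exact ⟨L, hL, ⟨Ψ.comp Φ⟩⟩

/-- The class of a torsor is unique, since a line bundle is recovered from its torsor of coframes. -/
theorem unique (ha : Represents a P) (hb : Represents b P) : a = b := by
  obtain ⟨p⟩ := P.nonempty_localSections
  obtain ⟨L, hL, ⟨Φ⟩⟩ := ha
  obtain ⟨M, hM, ⟨Ψ⟩⟩ := hb
  obtain ⟨f⟩ := p.nonempty_iso_lineBundle Φ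
  obtain ⟨g⟩ := p.nonempty_iso_lineBundle Ψ
  refine Subtype.ext (Units.ext ?_)
  rw [hL, hM]
  exact ModuleClass.mk_eq_mk_iff.2 ⟨f ≪≫ g.symm⟩

theorem nonempty_hom (hP : Represents a P) (hQ : Represents a Q) :
    Nonempty (GmTorsor.Hom P Q) := by
  obtain ⟨L, hL, ⟨Φ⟩⟩ := hP
  obtain ⟨M, hM, ⟨Ψ⟩⟩ := hQ
  obtain ⟨f⟩ := ModuleClass.mk_eq_mk_iff.1 (hM.symm.trans hL)
  exact ⟨Φ.symm.comp ((coframeTorsorMap _ _ f).comp Ψ)⟩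

theorem restrict {Z : Scheme.{u}} [IsLocallyNoetherian Z] (k : Z ⟶ X) (h : Represents a P) :
    Represents (Pic.map k a) (P.restrict k) := by
  obtain ⟨L, hL, ⟨Φ⟩⟩ := h
  have hkL : (Pic.map k a).1.val = .mk ((Scheme.Modules.pullback k).obj L) :=
    congrArg (ModuleClass.map k) hL
  exact ⟨_, hkL, ⟨(coframeTorsorPullback (isLineBundle_of_mk_eq hL) k
    (isLineBundle_of_mk_eq hkL)).symm.comp (Φ.restrict k)⟩⟩

/-- A class in the Picard group is trivial if and only if a torsor representing it has a global
section. -/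
theorem one_iff (h : Represents a P) : a = 1 ↔ Nonempty (P.sec (𝟙 X)) := by
  have h1 : Represents (1 : Pic X) (coframeTorsor _ isLineBundle_structureSheaf) :=
    ⟨_, rfl, ⟨.id _⟩⟩
  constructor
  · rintro rfl
    obtain ⟨Φ⟩ := h1.nonempty_hom h
    exact ⟨Φ.app (unitCoframe X)⟩
  · rintro ⟨s⟩
    obtain ⟨Φ⟩ := GmTorsor.Hom.nonempty_of_sec (Q := P) (P :=
      coframeTorsor _ isLineBundle_structureSheaf) (unitCoframe X) s
    exact h.unique (h1.of_hom Φ)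

end Represents

end

/-! ### Descent of classes in the Picard group along the base -/

instance isLocallyNoetherian_pullback_right {X Y Z : Scheme.{u}} (f : X ⟶ Z) (g : Y ⟶ Z)
    [IsLocallyNoetherian X] [LocallyOfFiniteType g] : IsLocallyNoetherian (pullback f g) :=
  LocallyOfFiniteType.isLocallyNoetherian (pullback.fst f g)

instance isLocallyNoetherian_pullback_left {X Y Z : Scheme.{u}} (f : X ⟶ Z) (g : Y ⟶ Z)
    [IsLocallyNoetherian Y] [LocallyOfFiniteType f] : IsLocallyNoetherian (pullback f g) :=
  LocallyOfFiniteType.isLocallyNoetherian (pullback.snd f g)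

section
variable {Z B : Scheme.{u}} (π : Z ⟶ B)

/-- The functions on the base changes of `π` to locally Noetherian schemes come from the base. -/
def HasUniversalFunctions : Prop :=
  ∀ {Y : Scheme.{u}} [IsLocallyNoetherian Y] (h : Y ⟶ B),
    Function.Bijective (pullback.snd π h).appTop

variable {π}

theorem HasUniversalFunctions.bijective_gmMap (hπ : HasUniversalFunctions π) {Y : Scheme.{u}}
    [IsLocallyNoetherian Y] (h : Y ⟶ B) : Function.Bijective (gmMap (pullback.snd π h)) := by
  refine ⟨fun a b hab => Units.ext ((hπ h).1 (congrArg Units.val hab)), fun b => ?_⟩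
  exact ⟨(Units.mapEquiv (MulEquiv.ofBijective (pullback.snd π h).appTop.hom (hπ h))).symm b,
    (Units.mapEquiv (MulEquiv.ofBijective (pullback.snd π h).appTop.hom (hπ h))).apply_symm_apply b⟩

variable (π) in
/-- The morphism of base changes of `π` induced by a morphism between the bases. -/
noncomputable def bc {Y Y' : Scheme.{u}} (k : Y' ⟶ Y) {h : Y ⟶ B} {h' : Y' ⟶ B} (w : k ≫ h = h') :
    pullback π h' ⟶ pullback π h :=
  pullback.lift (pullback.fst π h') (pullback.snd π h' ≫ k)
    (by rw [Category.assoc, w, pullback.condition])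

section
variable {Y Y' : Scheme.{u}} (k : Y' ⟶ Y) {h : Y ⟶ B} {h' : Y' ⟶ B} (w : k ≫ h = h')

@[simp]
theorem bc_fst : bc π k w ≫ pullback.fst π h = pullback.fst π h' := pullback.lift_fst _ _ _

@[simp]
theorem bc_snd : bc π k w ≫ pullback.snd π h = pullback.snd π h' ≫ k := pullback.lift_snd _ _ _

theorem bc_id (w : 𝟙 Y ≫ h = h) : bc π (𝟙 Y) w = 𝟙 _ := by
  apply pullback.hom_ext <;> simp

theorem bc_comp {Y'' : Scheme.{u}} (l : Y'' ⟶ Y') {h'' : Y'' ⟶ B} (w' : l ≫ h' = h'')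
    (w'' : (l ≫ k) ≫ h = h'') : bc π l w' ≫ bc π k w = bc π (l ≫ k) w'' := by
  apply pullback.hom_ext
  · rw [Category.assoc, bc_fst, bc_fst, bc_fst]
  · rw [Category.assoc, bc_snd, ← Category.assoc, bc_snd, bc_snd, Category.assoc]

theorem isPullback_bc : IsPullback (bc π k w) (pullback.snd π h') (pullback.snd π h) k := by
  subst w
  refine IsPullback.of_right ?_ (bc_snd k rfl) (IsPullback.of_hasPullback π h)
  rw [bc_fst]
  exact IsPullback.of_hasPullback π (k ≫ h)

end

variable (π) in
/-- The Weil restriction of a torsor along `π`: its sections over `h : Y ⟶ B` are the sections of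
the given torsor over the base change `Z ×_B Y`. -/
noncomputable def weilRestriction [LocallyOfFiniteType π]
    (hπ : HasUniversalFunctions π) (P : GmTorsor Z)
    (H : ∀ b : B, ∃ (Y : Scheme.{u}) (_ : IsLocallyNoetherian Y) (k : Y ⟶ B)
      (_ : Flat k) (_ : LocallyOfFinitePresentation k) (y : Y), k y = b ∧
        Nonempty (P.sec (pullback.fst π k))) : GmTorsor B where
  sec h := P.sec (pullback.fst π h)
  act h := MulAction.compHom _ (gmMap (pullback.snd π h))
  res k h h' w s := P.res (bc π k w) (bc_fst k w) s
  res_id w s := (P.res_congr (bc_id w) _ _ s).trans (P.res_id (Category.id_comp _) s)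
  res_res k l h h' h'' w w' w'' s := by
    have e := bc_comp (π := π) k w l w' w''
    exact (P.res_res _ _ _ _ (by rw [e, bc_fst]) s).trans (P.res_congr e _ _ s)
  res_smul k h h' w c s := by
    refine (P.res_smul _ _ _ _).trans ?_
    rw [← gmMap_comp, bc_snd, gmMap_comp]
    rfl
  existsUnique_smul {Y _ h} s t := by
    obtain ⟨c, hc⟩ := (hπ.bijective_gmMap h).2 (P.div t s)
    refine ⟨c, ?_, fun d hd => (hπ.bijective_gmMap h).1 ?_⟩
    · change gmMap (pullback.snd π h) c • s = t
      rw [hc, P.div_smul]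
    · rw [hc]
      exact P.eq_div hd
  glue {ι Y _ Z' _ k} hk h s hs := by
    have hk' : IsFppfCover (fun i => bc π (k i) (h := h) rfl) :=
      hk.of_isPullback (fun i => isPullback_bc (k i) rfl)
    obtain ⟨t, ht⟩ := P.glue hk' (pullback.fst π h)
      (fun i => P.res (𝟙 _) ((Category.id_comp _).trans (bc_fst (k i) rfl).symm) (s i))
      (fun i j W _ p q e h' wp wq => by
        have e1 : (p ≫ pullback.snd π (k i ≫ h)) ≫ k i = (q ≫ pullback.snd π (k j ≫ h)) ≫ k j := by
          have := congrArg (· ≫ pullback.snd π h) e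
          simpa only [Category.assoc, bc_snd] using this
        obtain ⟨h₀, w₀⟩ : ∃ h₀, (p ≫ pullback.snd π (k i ≫ h)) ≫ k i ≫ h = h₀ := ⟨_, rfl⟩
        have w₁ : (q ≫ pullback.snd π (k j ≫ h)) ≫ k j ≫ h = h₀ := by
          rw [← w₀, ← Category.assoc, ← e1, Category.assoc]
        have h1 := hs i j _ _ e1 h₀ w₀ w₁
        have wp' : p ≫ pullback.fst π (k i ≫ h) = h' := by rw [← wp, bc_fst]
        have wq' : q ≫ pullback.fst π (k j ≫ h) = h' := by rw [← wq, bc_fst]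
        -- restrict the equality over the base change along the graph of `W` in `Z ×_B W`
        let γ : W ⟶ pullback π h₀ := pullback.lift h' (𝟙 W) (by
          rw [Category.id_comp, ← w₀, ← wp', Category.assoc, Category.assoc, pullback.condition])
        have hγ : γ ≫ pullback.fst π h₀ = h' := pullback.lift_fst _ _ _
        have hγp : γ ≫ bc π _ w₀ = p := by
          apply pullback.hom_ext
          · rw [Category.assoc, bc_fst, hγ, wp']
          · rw [Category.assoc, bc_snd, pullback.lift_snd_assoc, Category.id_comp]
        have hγq : γ ≫ bc π _ w₁ = q := by
          apply pullback.hom_ext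
          · rw [Category.assoc, bc_fst, hγ, wq']
          · rw [Category.assoc, bc_snd, pullback.lift_snd_assoc, Category.id_comp]
        have h2 := congrArg (P.res γ hγ) h1
        rw [P.res_res _ _ _ _ (by rw [hγp, wp']), P.res_res _ _ _ _ (by rw [hγq, wq']),
          P.res_congr hγp _ wp', P.res_congr hγq _ wq'] at h2
        rw [P.res_res _ _ _ _ (by rw [Category.comp_id, wp']),
          P.res_res _ _ _ _ (by rw [Category.comp_id, wq']),
          P.res_congr (Category.comp_id p) _ wp', P.res_congr (Category.comp_id q) _ wq', h2])
    refine ⟨t, fun i => ?_⟩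
    have h1 := congrArg (P.res (𝟙 _) (h' := pullback.fst π (k i ≫ h)) (by simp)) (ht i)
    rw [P.res_res _ _ _ _ (by simp), P.res_res _ _ _ _ (by simp),
      P.res_congr (Category.id_comp _) _ (bc_fst (k i) rfl),
      P.res_congr (Category.id_comp _) _ (Category.id_comp _), P.res_id] at h1
    exact h1
  locally_nonempty := H

/-- A torsor over `Z` with sections locally on the base is the pullback of its Weil restriction. -/
theorem nonempty_hom_weilRestriction [IsLocallyNoetherian Z] [LocallyOfFiniteType π]
    (hπ : HasUniversalFunctions π) (P : GmTorsor Z) (H) :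
    Nonempty (GmTorsor.Hom ((weilRestriction π hπ P H).restrict π) P) := by
  let γ {Y : Scheme.{u}} (h : Y ⟶ Z) : Y ⟶ pullback π (h ≫ π) :=
    pullback.lift h (𝟙 Y) (Category.id_comp _).symm
  have hγ {Y : Scheme.{u}} (h : Y ⟶ Z) : γ h ≫ pullback.fst π (h ≫ π) = h :=
    pullback.lift_fst _ _ _
  have hγ' {Y : Scheme.{u}} (h : Y ⟶ Z) : γ h ≫ pullback.snd π (h ≫ π) = 𝟙 Y :=
    pullback.lift_snd _ _ _
  exact ⟨{ app := fun {Y _ h} s => P.res (γ h) (hγ h) s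
           app_res := fun {Y Y'} _ _ k {h h'} w s => by
            subst w
            have e : γ (k ≫ h) ≫ bc π k (Category.assoc k h π).symm = k ≫ γ h := by
              apply pullback.hom_ext
              · rw [Category.assoc, bc_fst, hγ, Category.assoc, hγ]
              · rw [Category.assoc, bc_snd, ← Category.assoc, hγ', Category.id_comp,
                  Category.assoc, hγ', Category.comp_id]
            have e1 : (γ (k ≫ h) ≫ bc π k (Category.assoc k h π).symm) ≫ pullback.fst π (h ≫ π) =
                k ≫ h := by rw [Category.assoc, bc_fst, hγ]
            refine (P.res_res _ _ _ _ e1 _).trans ((P.res_congr e _ (by rw [← e, e1]) _).trans ?_)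
            exact (P.res_res _ _ _ _ _ _).symm
           app_smul := fun {Y _ h} c s => by
            refine (P.res_smul _ _ _ _).trans ?_
            rw [← gmMap_comp, hγ', gmMap_id] }⟩

/-- A class in the Picard group of `Z` comes from the base if it does so locally on the base. -/
theorem mem_range_picMap_of_locally [IsLocallyNoetherian Z] [IsLocallyNoetherian B]
    [LocallyOfFiniteType π] (hπ : HasUniversalFunctions π) (a : Pic Z)
    (H : ∀ b : B, ∃ (Y : Scheme.{u}) (_ : IsLocallyNoetherian Y) (k : Y ⟶ B)
      (_ : Flat k) (_ : LocallyOfFinitePresentation k) (y : Y), k y = b ∧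
        Pic.map (pullback.fst π k) a ∈ (Pic.map (pullback.snd π k)).range) :
    a ∈ (Pic.map π).range := by
  obtain ⟨P, hP⟩ := exists_represents a
  have H' : ∀ b : B, ∃ (Y : Scheme.{u}) (_ : IsLocallyNoetherian Y) (k : Y ⟶ B)
      (_ : Flat k) (_ : LocallyOfFinitePresentation k) (y : Y), k y = b ∧
        Nonempty (P.sec (pullback.fst π k)) := fun b => by
    obtain ⟨Y, hY, k, h1, h2, y, hy, c, hc⟩ := H b
    -- the class `c` on `Y` becomes trivial on an fppf covering of `Y`
    obtain ⟨Q, hQ⟩ := exists_represents c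
    obtain ⟨Y', hY', l, h1', h2', y', hy', ⟨s⟩⟩ := Q.locally_nonempty y
    have hl : Pic.map l c = 1 := ((hQ.restrict l).one_iff).2
      ⟨Q.res (𝟙 _) (by simp) s⟩
    have h3 : Pic.map (pullback.fst π (l ≫ k)) a = 1 := by
      have e1 := bc_fst (π := π) l (rfl : l ≫ k = l ≫ k)
      have e2 := bc_snd (π := π) l (rfl : l ≫ k = l ≫ k)
      rw [← e1, Pic.map_comp, MonoidHom.comp_apply, ← hc, ← MonoidHom.comp_apply, ← Pic.map_comp,
        e2, Pic.map_comp, MonoidHom.comp_apply, hl, map_one]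
    obtain ⟨t⟩ := ((hP.restrict (pullback.fst π (l ≫ k))).one_iff).1 h3
    refine ⟨Y', hY', l ≫ k, inferInstance, inferInstance, y', ?_,
      ⟨P.res (𝟙 _) (by simp) (show P.sec (𝟙 _ ≫ pullback.fst π (l ≫ k)) from t)⟩⟩
    rw [Scheme.Hom.comp_apply, hy', hy]
  obtain ⟨c, hc⟩ := exists_represented (weilRestriction π hπ P H')
  obtain ⟨Φ⟩ := nonempty_hom_weilRestriction hπ P H'
  exact ⟨c, ((hc.restrict π).of_hom Φ).unique hP⟩

end

/-! ### Descent of torsors -/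

/-- A descent datum on torsors `P i` over the members `ζ i : Z i ⟶ X` of a family: a transitive
system of natural equivariant maps between the sections over two morphisms `a : W ⟶ Z i` and
`b : W ⟶ Z j` that become equal over `X`. -/
structure DescentDatum {ι : Type u} {X : Scheme.{u}} {Z : ι → Scheme.{u}} (ζ : ∀ i, Z i ⟶ X)
    (P : ∀ i, GmTorsor (Z i)) where
  map (i j : ι) {W : Scheme.{u}} [IsLocallyNoetherian W] {a : W ⟶ Z i} {b : W ⟶ Z j}
    (e : a ≫ ζ i = b ≫ ζ j) : (P i).sec a → (P j).sec b
  map_res (i j : ι) {W W' : Scheme.{u}} [IsLocallyNoetherian W] [IsLocallyNoetherian W']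
    (k : W' ⟶ W) {a : W ⟶ Z i} {b : W ⟶ Z j} {a' : W' ⟶ Z i} {b' : W' ⟶ Z j}
    (e : a ≫ ζ i = b ≫ ζ j) (wa : k ≫ a = a') (wb : k ≫ b = b') (e' : a' ≫ ζ i = b' ≫ ζ j)
    (s : (P i).sec a) : map i j e' ((P i).res k wa s) = (P j).res k wb (map i j e s)
  map_smul (i j : ι) {W : Scheme.{u}} [IsLocallyNoetherian W] {a : W ⟶ Z i} {b : W ⟶ Z j}
    (e : a ≫ ζ i = b ≫ ζ j) (c : gm W) (s : (P i).sec a) : map i j e (c • s) = c • map i j e s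
  map_map (i j l : ι) {W : Scheme.{u}} [IsLocallyNoetherian W] {a : W ⟶ Z i} {b : W ⟶ Z j}
    {c : W ⟶ Z l} (e : a ≫ ζ i = b ≫ ζ j) (e' : b ≫ ζ j = c ≫ ζ l) (s : (P i).sec a) :
    map j l e' (map i j e s) = map i l (e.trans e') s

namespace DescentDatum

variable {ι : Type u} {X : Scheme.{u}} {Z : ι → Scheme.{u}}
  {ζ : ∀ i, Z i ⟶ X} {P : ∀ i, GmTorsor (Z i)} (D : DescentDatum ζ P)

theorem div_map (i j : ι) {W : Scheme.{u}} [IsLocallyNoetherian W] {a : W ⟶ Z i} {b : W ⟶ Z j}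
    (e : a ≫ ζ i = b ≫ ζ j) (s t : (P i).sec a) :
    (P j).div (D.map i j e s) (D.map i j e t) = (P i).div s t :=
  ((P j).eq_div (by rw [← D.map_smul, (P i).div_smul])).symm

variable [∀ i, LocallyOfFiniteType (ζ i)]

/-- A section of the descended torsor over `h : Y ⟶ X`: a compatible family of sections of the given
torsors over the fibre products of `Y` and `Z i`. -/
structure Sec {Y : Scheme.{u}} [IsLocallyNoetherian Y] (h : Y ⟶ X) : Type u where
  toFun (i : ι) : (P i).sec (pullback.snd h (ζ i))
  compat (i j : ι) {W : Scheme.{u}} [IsLocallyNoetherian W] {a : W ⟶ pullback h (ζ i)}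
    {b : W ⟶ pullback h (ζ j)} (_ : a ≫ pullback.fst h (ζ i) = b ≫ pullback.fst h (ζ j))
    (e : (a ≫ pullback.snd h (ζ i)) ≫ ζ i = (b ≫ pullback.snd h (ζ j)) ≫ ζ j) :
    D.map i j e ((P i).res a rfl (toFun i)) = (P j).res b rfl (toFun j)

namespace Sec

variable {D} {Y : Scheme.{u}} [IsLocallyNoetherian Y] {h : Y ⟶ X}

/-- The member of the family `s` on any scheme mapping compatibly to `Y` and to `Z i`. -/
noncomputable def val (s : D.Sec h) (i : ι) {W : Scheme.{u}} [IsLocallyNoetherian W] (p : W ⟶ Y)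
    (a : W ⟶ Z i) (e : p ≫ h = a ≫ ζ i) : (P i).sec a :=
  (P i).res (pullback.lift p a e) (pullback.lift_snd _ _ _) (s.toFun i)

section
variable {W W' : Scheme.{u}} [IsLocallyNoetherian W] [IsLocallyNoetherian W']

theorem res_val (s : D.Sec h) (i : ι) (p : W ⟶ Y) (a : W ⟶ Z i) (e : p ≫ h = a ≫ ζ i)
    (k : W' ⟶ W) {p' : W' ⟶ Y} {a' : W' ⟶ Z i} (wp : k ≫ p = p') (wa : k ≫ a = a')
    (e' : p' ≫ h = a' ≫ ζ i) : (P i).res k wa (s.val i p a e) = s.val i p' a' e' := by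
  have h1 : k ≫ pullback.lift p a e = pullback.lift p' a' e' := by
    apply pullback.hom_ext
    · rw [Category.assoc, pullback.lift_fst, pullback.lift_fst, wp]
    · rw [Category.assoc, pullback.lift_snd, pullback.lift_snd, wa]
  have h2 : (k ≫ pullback.lift p a e) ≫ pullback.snd h (ζ i) = a' := by
    rw [h1, pullback.lift_snd]
  exact ((P i).res_res _ _ _ _ h2 _).trans ((P i).res_congr h1 _ _ _)

theorem map_val (s : D.Sec h) (i j : ι) (p : W ⟶ Y) (a : W ⟶ Z i) (b : W ⟶ Z j)
    (ea : p ≫ h = a ≫ ζ i) (eb : p ≫ h = b ≫ ζ j) (e : a ≫ ζ i = b ≫ ζ j) :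
    D.map i j e (s.val i p a ea) = s.val j p b eb := by
  obtain ⟨x, hx⟩ : ∃ x, pullback.lift p a ea = x := ⟨_, rfl⟩
  obtain ⟨y, hy⟩ : ∃ y, pullback.lift p b eb = y := ⟨_, rfl⟩
  have x1 : x ≫ pullback.fst h (ζ i) = p := by rw [← hx, pullback.lift_fst]
  have y1 : y ≫ pullback.fst h (ζ j) = p := by rw [← hy, pullback.lift_fst]
  have x2 : x ≫ pullback.snd h (ζ i) = a := by rw [← hx, pullback.lift_snd]
  have y2 : y ≫ pullback.snd h (ζ j) = b := by rw [← hy, pullback.lift_snd]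
  rw [val, val, (P i).res_congr hx _ x2, (P j).res_congr hy _ y2]
  subst x2 y2
  exact s.compat i j (x1.trans y1.symm) e

theorem ext {s t : D.Sec h} (H : ∀ i {W : Scheme.{u}} [IsLocallyNoetherian W] (p : W ⟶ Y)
    (a : W ⟶ Z i) (e : p ≫ h = a ≫ ζ i), s.val i p a e = t.val i p a e) : s = t := by
  have key (s : D.Sec h) (i : ι) : s.val i _ _ pullback.condition = s.toFun i := by
    have e : pullback.lift _ _ (pullback.condition (f := h) (g := ζ i)) = 𝟙 _ := by
      apply pullback.hom_ext <;> simp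
    exact ((P i).res_congr e _ (Category.id_comp _) _).trans ((P i).res_id _ _)
  obtain ⟨s, hs⟩ := s
  obtain ⟨t, ht⟩ := t
  obtain rfl : s = t := funext fun i => by
    have := H i _ _ pullback.condition
    rwa [key, key] at this
  rfl

end

/-- A compatible natural family of local sections defines a section of the descended torsor. -/
noncomputable def ofVal (V : ∀ i {W : Scheme.{u}} [IsLocallyNoetherian W] (p : W ⟶ Y)
      (a : W ⟶ Z i) (_ : p ≫ h = a ≫ ζ i), (P i).sec a)
    (hres : ∀ i {W W' : Scheme.{u}} [IsLocallyNoetherian W] [IsLocallyNoetherian W'] (p : W ⟶ Y)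
      (a : W ⟶ Z i) (e : p ≫ h = a ≫ ζ i) (k : W' ⟶ W) (e' : (k ≫ p) ≫ h = (k ≫ a) ≫ ζ i),
      (P i).res k rfl (V i p a e) = V i (k ≫ p) (k ≫ a) e')
    (hmap : ∀ i j {W : Scheme.{u}} [IsLocallyNoetherian W] (p : W ⟶ Y) (a : W ⟶ Z i) (b : W ⟶ Z j)
      (ea : p ≫ h = a ≫ ζ i) (eb : p ≫ h = b ≫ ζ j) (e : a ≫ ζ i = b ≫ ζ j),
      D.map i j e (V i p a ea) = V j p b eb) : D.Sec h where
  toFun i := V i _ _ pullback.condition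
  compat i j {W} _ {a b} e e' := by
    have w (i : ι) (a : W ⟶ pullback h (ζ i)) :
        (a ≫ pullback.fst h (ζ i)) ≫ h = (a ≫ pullback.snd h (ζ i)) ≫ ζ i := by
      rw [Category.assoc, Category.assoc, pullback.condition]
    rw [hres i _ _ _ a (w i a), hres j _ _ _ b (w j b)]
    have : ∀ (p p' : W ⟶ Y) (_ : p = p') (wi : p ≫ h = (a ≫ pullback.snd h (ζ i)) ≫ ζ i)
        (wj : p' ≫ h = (b ≫ pullback.snd h (ζ j)) ≫ ζ j),
        D.map i j e' (V i p (a ≫ pullback.snd h (ζ i)) wi) =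
          V j p' (b ≫ pullback.snd h (ζ j)) wj := by
      rintro p _ rfl wi wj
      exact hmap i j p _ _ wi wj e'
    exact this _ _ e _ _

theorem val_ofVal {V hres hmap} (i : ι) {W : Scheme.{u}} [IsLocallyNoetherian W] (p : W ⟶ Y)
    (a : W ⟶ Z i) (e : p ≫ h = a ≫ ζ i) :
    (ofVal (D := D) (h := h) V hres hmap).val i p a e = V i p a e := by
  have h1 := pullback.lift_fst p a e
  have h2 := pullback.lift_snd p a e
  have w : (pullback.lift p a e ≫ pullback.fst h (ζ i)) ≫ h =
      (pullback.lift p a e ≫ pullback.snd h (ζ i)) ≫ ζ i := by rw [h1, h2, e]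
  have h3 := hres i _ _ pullback.condition (pullback.lift p a e) w
  have : ∀ (p' : W ⟶ Y) (a' : W ⟶ Z i) (k : W ⟶ pullback h (ζ i)) (_ : p' = p) (_ : a' = a)
      (w' : p' ≫ h = a' ≫ ζ i) (w1 : k ≫ pullback.snd h (ζ i) = a')
      (w2 : k ≫ pullback.snd h (ζ i) = a)
      (_ : (P i).res k w1 (V i _ _ pullback.condition) = V i p' a' w'),
      (P i).res k w2 (V i _ _ pullback.condition) = V i p a e := by
    rintro _ _ k rfl rfl w' w1 w2 h4
    exact h4
  exact this _ _ _ h1 h2 w rfl h2 h3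

noncomputable instance : SMul (gm Y) (D.Sec h) where
  smul c s := ofVal (fun i W _ p a e => gmMap p c • s.val i p a e)
    (fun i W W' _ _ p a e k e' => by
      rw [(P i).res_smul, s.res_val i p a e k rfl rfl e', gmMap_comp])
    (fun i j W _ p a b ea eb e => by rw [D.map_smul, s.map_val i j p a b ea eb e])

theorem val_smul (c : gm Y) (s : D.Sec h) (i : ι) {W : Scheme.{u}} [IsLocallyNoetherian W]
    (p : W ⟶ Y) (a : W ⟶ Z i) (e : p ≫ h = a ≫ ζ i) :
    (c • s).val i p a e = gmMap p c • s.val i p a e := val_ofVal _ _ _ _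

/-- The action of units on sections of the descended torsor. -/
noncomputable instance : MulAction (gm Y) (D.Sec h) where
  one_smul s := ext fun i W _ p a e => by rw [val_smul, map_one, one_smul]
  mul_smul c d s := ext fun i W _ p a e => by
    rw [val_smul, val_smul, val_smul, map_mul, mul_smul]

/-- Restriction of sections of the descended torsor. -/
noncomputable def res {Y' : Scheme.{u}} [IsLocallyNoetherian Y'] (k : Y' ⟶ Y) {h' : Y' ⟶ X}
    (w : k ≫ h = h') (s : D.Sec h) : D.Sec h' :=
  ofVal (fun i W _ p a e => s.val i (p ≫ k) a (by rw [Category.assoc, w, e]))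
    (fun i W W' _ _ p a e l e' => s.res_val i _ _ _ l (Category.assoc _ _ _).symm rfl _)
    (fun i j W _ p a b ea eb e => s.map_val i j _ _ _ _ _ _)

theorem val_res {Y' : Scheme.{u}} [IsLocallyNoetherian Y'] (k : Y' ⟶ Y) {h' : Y' ⟶ X}
    (w : k ≫ h = h') (s : D.Sec h) (i : ι) {W : Scheme.{u}} [IsLocallyNoetherian W]
    (p : W ⟶ Y') (a : W ⟶ Z i) (e : p ≫ h' = a ≫ ζ i) (e' : (p ≫ k) ≫ h = a ≫ ζ i) :
    (s.res k w).val i p a e = s.val i (p ≫ k) a e' := val_ofVal _ _ _ _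

theorem val_congr (s : D.Sec h) (i : ι) {W : Scheme.{u}} [IsLocallyNoetherian W] {p p' : W ⟶ Y}
    (hp : p = p') (a : W ⟶ Z i) (e : p ≫ h = a ≫ ζ i) (e' : p' ≫ h = a ≫ ζ i) :
    s.val i p a e = s.val i p' a e' := by
  subst hp; rfl

theorem existsUnique_smul (hζ : IsFppfCover ζ) (s t : D.Sec h) : ∃! c : gm Y, c • s = t := by
  have hk := hζ.pullback_fst h
  obtain ⟨c, hc⟩ := hk.exists_gm
    (fun i => (P i).div (t.val i _ _ pullback.condition) (s.val i _ _ pullback.condition))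
    (fun i j W _ p q e => by
      have w (i : ι) (p : W ⟶ pullback h (ζ i)) :
          (p ≫ pullback.fst h (ζ i)) ≫ h = (p ≫ pullback.snd h (ζ i)) ≫ ζ i := by
        rw [Category.assoc, Category.assoc, pullback.condition]
      have w' : (p ≫ pullback.fst h (ζ i)) ≫ h = (q ≫ pullback.snd h (ζ j)) ≫ ζ j := by
        rw [e, w]
      have e' := (w i p).symm.trans w'
      rw [(P i).gmMap_div p rfl, (P j).gmMap_div q rfl, t.res_val i _ _ _ p rfl rfl (w i p),
        t.res_val j _ _ _ q e.symm rfl w', s.res_val i _ _ _ p rfl rfl (w i p),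
        s.res_val j _ _ _ q e.symm rfl w', ← t.map_val i j _ _ _ (w i p) w' e',
        ← s.map_val i j _ _ _ (w i p) w' e', D.div_map])
  refine ⟨c, ext fun i W _ p a e => ?_, fun d hd => hk.gm_ext fun i => ?_⟩
  · have h1 := pullback.lift_fst p a e
    have h2 : gmMap p c = (P i).div (t.val i p a e) (s.val i p a e) := by
      refine (congrArg (fun q => gmMap q c) h1.symm).trans ?_
      rw [gmMap_comp, hc, (P i).gmMap_div _ (pullback.lift_snd p a e),
        t.res_val i _ _ _ _ h1 (pullback.lift_snd p a e) e,
        s.res_val i _ _ _ _ h1 (pullback.lift_snd p a e) e]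
    rw [val_smul, h2, (P i).div_smul]
  · rw [hc]
    refine (P i).eq_div ?_
    rw [← val_smul, hd]

theorem exists_glue {κ : Type u} {Y' : κ → Scheme.{u}} [∀ m, IsLocallyNoetherian (Y' m)]
    {k : ∀ m, Y' m ⟶ Y} (hk : IsFppfCover k) (s : ∀ m, D.Sec (k m ≫ h))
    (hs : ∀ m n {W : Scheme.{u}} [IsLocallyNoetherian W] (p : W ⟶ Y' m) (q : W ⟶ Y' n)
      (_ : p ≫ k m = q ≫ k n) (h' : W ⟶ X) (wp : p ≫ k m ≫ h = h') (wq : q ≫ k n ≫ h = h'),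
      (s m).res p wp = (s n).res q wq) :
    ∃ t : D.Sec h, ∀ m, t.res (k m) rfl = s m := by
  have hs' (m n) {W : Scheme.{u}} [IsLocallyNoetherian W] (p : W ⟶ Y' m) (q : W ⟶ Y' n)
      (e : p ≫ k m = q ≫ k n) (i) (a : W ⟶ Z i) (ep : p ≫ k m ≫ h = a ≫ ζ i)
      (eq : q ≫ k n ≫ h = a ≫ ζ i) : (s m).val i p a ep = (s n).val i q a eq := by
    have h1 := congrArg (fun r => r.val i (𝟙 W) a (Category.id_comp _)) (hs m n p q e _ ep eq)
    rw [val_res p ep (s m) i _ _ _ (by rw [Category.id_comp, ep]),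
      val_res q eq (s n) i _ _ _ (by rw [Category.id_comp, eq])] at h1
    exact ((s m).val_congr i (Category.id_comp p).symm _ _ _).trans
      (h1.trans ((s n).val_congr i (Category.id_comp q) _ _ _))
  have main (i) {W : Scheme.{u}} [IsLocallyNoetherian W] (p : W ⟶ Y) (a : W ⟶ Z i)
      (e : p ≫ h = a ≫ ζ i) : ∃ t : (P i).sec a, ∀ m {W' : Scheme.{u}} [IsLocallyNoetherian W']
        (x : W' ⟶ W) (y : W' ⟶ Y' m) (_ : x ≫ p = y ≫ k m)
        (e'' : y ≫ k m ≫ h = (x ≫ a) ≫ ζ i), (P i).res x rfl t = (s m).val i y (x ≫ a) e'' := by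
    have hp := hk.pullback_fst p
    have := hp.isLocallyNoetherian
    have w (m) {W' : Scheme.{u}} (x : W' ⟶ W) (y : W' ⟶ Y' m) (e' : x ≫ p = y ≫ k m) :
        y ≫ k m ≫ h = (x ≫ a) ≫ ζ i := by
      rw [← Category.assoc, ← e', Category.assoc, e, Category.assoc]
    obtain ⟨t, ht⟩ := (P i).glue hp a
      (fun m => (s m).val i (pullback.snd p (k m)) (pullback.fst p (k m) ≫ a)
        (w m _ _ pullback.condition))
      (fun m n W' _ x y exy b hx hy => by
        have ex : (x ≫ pullback.snd p (k m)) ≫ k m ≫ h = b ≫ ζ i := by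
          rw [← hx, Category.assoc, w m _ _ pullback.condition, ← Category.assoc]
        have ey : (y ≫ pullback.snd p (k n)) ≫ k n ≫ h = b ≫ ζ i := by
          rw [← hy, Category.assoc, w n _ _ pullback.condition, ← Category.assoc]
        rw [(s m).res_val i _ _ _ x rfl hx ex, (s n).res_val i _ _ _ y rfl hy ey]
        refine hs' m n _ _ ?_ i b _ _
        rw [Category.assoc, ← pullback.condition, ← Category.assoc, exy, Category.assoc,
          pullback.condition, Category.assoc])
    refine ⟨t, fun m W' _ x y e' e'' => ?_⟩
    have h1 : pullback.lift x y e' ≫ pullback.fst p (k m) = x := pullback.lift_fst _ _ _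
    have h2 : pullback.lift x y e' ≫ pullback.snd p (k m) = y := pullback.lift_snd _ _ _
    have h3 : pullback.lift x y e' ≫ pullback.fst p (k m) ≫ a = x ≫ a := by
      rw [← Category.assoc, h1]
    have h4 := congrArg ((P i).res (pullback.lift x y e') h3) (ht m)
    rwa [(P i).res_res _ _ _ _ (by rw [h1]), (P i).res_congr h1 _ rfl,
      (s m).res_val i _ _ _ _ h2 h3 e''] at h4
  -- sections with the defining property of the glued section are unique
  have uniq (i) {W : Scheme.{u}} [IsLocallyNoetherian W] (p : W ⟶ Y) (a : W ⟶ Z i)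
      (e : p ≫ h = a ≫ ζ i) (t t' : (P i).sec a)
      (ht : ∀ m {W' : Scheme.{u}} [IsLocallyNoetherian W']
        (x : W' ⟶ W) (y : W' ⟶ Y' m) (_ : x ≫ p = y ≫ k m)
        (e'' : y ≫ k m ≫ h = (x ≫ a) ≫ ζ i), (P i).res x rfl t = (s m).val i y (x ≫ a) e'')
      (ht' : ∀ m {W' : Scheme.{u}} [IsLocallyNoetherian W']
        (x : W' ⟶ W) (y : W' ⟶ Y' m) (_ : x ≫ p = y ≫ k m)
        (e'' : y ≫ k m ≫ h = (x ≫ a) ≫ ζ i), (P i).res x rfl t' = (s m).val i y (x ≫ a) e'') :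
      t = t' := by
    have hp := hk.pullback_fst p
    have := hp.isLocallyNoetherian
    refine (P i).ext hp fun m => ?_
    have e'' : pullback.snd p (k m) ≫ k m ≫ h = (pullback.fst p (k m) ≫ a) ≫ ζ i := by
      rw [← Category.assoc, ← pullback.condition, Category.assoc, e, Category.assoc]
    rw [ht m _ _ pullback.condition e'', ht' m _ _ pullback.condition e'']
  refine ⟨ofVal (fun i W _ p a e => (main i p a e).choose)
    (fun i W W' _ _ p a e l e' => uniq i (l ≫ p) (l ≫ a) e' _ _
      (fun m W'' _ x y exy e'' => ?_) (main i _ _ e').choose_spec)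
    (fun i j W _ p a b ea eb e => uniq j p b eb _ _ (fun m W' _ x y exy e'' => ?_)
      (main j _ _ eb).choose_spec), fun m => ext fun i W _ p a e => ?_⟩
  · have w : y ≫ k m ≫ h = ((x ≫ l) ≫ a) ≫ ζ i := by rw [e'', Category.assoc x l a]
    have h1 := (main i p a e).choose_spec m (x ≫ l) y (by rw [Category.assoc, exy]) w
    have h2 : (x ≫ l) ≫ a = x ≫ l ≫ a := Category.assoc _ _ _
    rw [(P i).res_res _ _ _ _ h2]
    have h3 := congrArg ((P i).res (𝟙 W'') (by rw [Category.id_comp, h2] : _ = x ≫ l ≫ a)) h1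
    rw [(s m).res_val i _ _ _ (𝟙 _) (Category.id_comp y) _ e'',
      (P i).res_res _ _ _ _ (by rw [Category.id_comp, h2])] at h3
    rw [← h3]
    exact (P i).res_congr (Category.id_comp _).symm _ _ _
  · have w : y ≫ k m ≫ h = (x ≫ a) ≫ ζ i := by
      rw [e'', Category.assoc, Category.assoc, e]
    have e3 : (x ≫ a) ≫ ζ i = (x ≫ b) ≫ ζ j := by rw [← w, e'']
    rw [← D.map_res i j x e rfl rfl e3, (main i p a ea).choose_spec m x y exy w,
      (s m).map_val i j y _ _ w e'' e3]
  · have w : (p ≫ k m) ≫ h = a ≫ ζ i := by rw [Category.assoc, e]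
    have w' : p ≫ k m ≫ h = (𝟙 W ≫ a) ≫ ζ i := by rw [Category.id_comp, e]
    rw [val_res (k m) rfl _ i p a e w, val_ofVal]
    have h1 := (main i (p ≫ k m) a w).choose_spec m (𝟙 W) p (Category.id_comp _) w'
    have h2 := congrArg ((P i).res (𝟙 W) (by simp : _ = a)) h1
    rw [(P i).res_res _ _ _ _ (by simp), (s m).res_val i _ _ _ (𝟙 _) (Category.id_comp p) _ e] at h2
    rw [← h2]
    exact ((P i).res_id (Category.id_comp a) _).symm.trans
      ((P i).res_congr (Category.id_comp (𝟙 W)).symm _ _ _)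

end Sec

/-- The torsor obtained by descent. -/
noncomputable def torsor (hζ : IsFppfCover ζ) : GmTorsor X where
  sec h := D.Sec h
  act h := inferInstance
  res k _ _ w s := s.res k w
  res_id {_ _ h} w s := Sec.ext fun i W _ p a e => by
    have e' : (p ≫ 𝟙 _) ≫ h = a ≫ ζ i := by rw [Category.comp_id]; exact e
    exact (Sec.val_res _ _ _ _ _ _ _ e').trans (s.val_congr i (Category.comp_id p) _ _ _)
  res_res k l h h' h'' w w' w'' s := Sec.ext fun i W _ p a e => by
    have e1 : (p ≫ l) ≫ h' = a ≫ ζ i := by rw [Category.assoc, w', e]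
    have e2 : ((p ≫ l) ≫ k) ≫ h = a ≫ ζ i := by rw [Category.assoc, w, e1]
    have e3 : (p ≫ l ≫ k) ≫ h = a ≫ ζ i := by rw [Category.assoc, w'', e]
    rw [Sec.val_res l w' _ i p a e e1, Sec.val_res k w s i _ a e1 e2,
      Sec.val_res (l ≫ k) w'' s i p a e e3]
    exact s.val_congr i (Category.assoc _ _ _) _ _ _
  res_smul k h h' w c s := Sec.ext fun i W _ p a e => by
    have e1 : (p ≫ k) ≫ h = a ≫ ζ i := by rw [Category.assoc, w, e]
    rw [Sec.val_res k w _ i p a e e1, Sec.val_smul, Sec.val_smul, Sec.val_res k w s i p a e e1,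
      gmMap_comp]
  existsUnique_smul s t := Sec.existsUnique_smul hζ s t
  glue hk h s hs := Sec.exists_glue hk s hs
  locally_nonempty x := by
    obtain ⟨i, z, hz⟩ := hζ.exists_eq x
    have := hζ.flat i
    have := hζ.lfp i
    obtain ⟨Y, hY, k, h1, h2, y, hy, ⟨s⟩⟩ := (P i).locally_nonempty z
    refine ⟨Y, hY, k ≫ ζ i, inferInstance, inferInstance, y, ?_, ⟨Sec.ofVal
      (fun j W _ p a e => D.map i j ((Category.assoc p k (ζ i)).trans e) ((P i).res p rfl s))
      (fun j W W' _ _ p a e l e' => ?_) (fun j l W _ p a b ea eb e => D.map_map _ _ _ _ _ _)⟩⟩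
    · rw [Scheme.Hom.comp_apply, hy, hz]
    · have e1 : (l ≫ p) ≫ k = l ≫ p ≫ k := Category.assoc _ _ _
      rw [← D.map_res i j l _ e1.symm rfl (by rw [Category.assoc (l ≫ p) k, e']),
        (P i).res_res p l rfl e1.symm rfl]

/-- Descent for torsors: the descended torsor pulls back to the given ones. -/
theorem nonempty_hom [∀ i, IsLocallyNoetherian (Z i)] (hζ : IsFppfCover ζ) (i : ι) :
    Nonempty (GmTorsor.Hom ((D.torsor hζ).restrict (ζ i)) (P i)) :=
  ⟨{ app := fun {Y _ h} (s : D.Sec (h ≫ ζ i)) => s.val i (𝟙 Y) h (Category.id_comp _)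
     app_res := fun {Y Y'} _ _ k {h h'} w (s : D.Sec (h ≫ ζ i)) => by
      have e : (𝟙 Y' ≫ k) ≫ h ≫ ζ i = h' ≫ ζ i := by rw [Category.id_comp, ← w, Category.assoc]
      refine (Sec.val_res k (by rw [← w, Category.assoc]) s i (𝟙 Y') h' (Category.id_comp _)
        e).trans (s.res_val i _ _ _ k ?_ w e).symm
      rw [Category.comp_id, Category.id_comp]
     app_smul := fun {Y _ h} c (s : D.Sec (h ≫ ζ i)) => by
      refine (Sec.val_smul c s i _ _ _).trans ?_
      rw [gmMap_id] }⟩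

end DescentDatum

/-! ### Gluing classes in the Picard group along the base in the presence of a section -/

namespace GmTorsor.Hom

variable {V X₁ X₂ X₃ : Scheme.{u}} [IsLocallyNoetherian V] {P : GmTorsor X₁} {Q : GmTorsor X₂}
  {R : GmTorsor X₃} {q₁ : V ⟶ X₁} {q₂ : V ⟶ X₂} {q₃ : V ⟶ X₃}

/-- The action of a morphism between pulled back torsors on sections over morphisms that are equal
to the composites with the given ones. -/
noncomputable def eval (Φ : Hom (P.restrict q₁) (Q.restrict q₂)) {W : Scheme.{u}}
    [IsLocallyNoetherian W] (c : W ⟶ V) {a : W ⟶ X₁} {b : W ⟶ X₂} (ea : c ≫ q₁ = a)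
    (eb : c ≫ q₂ = b) : P.sec a → Q.sec b := by
  subst ea eb
  exact (Φ.app : (P.restrict q₁).sec c → (Q.restrict q₂).sec c)

section
variable (Φ : Hom (P.restrict q₁) (Q.restrict q₂)) {W W' : Scheme.{u}} [IsLocallyNoetherian W]
  [IsLocallyNoetherian W'] (c : W ⟶ V) {a : W ⟶ X₁} {b : W ⟶ X₂} (ea : c ≫ q₁ = a)
  (eb : c ≫ q₂ = b)

theorem eval_res (k : W' ⟶ W) {c' : W' ⟶ V} (hc : k ≫ c = c') {a' : W' ⟶ X₁} {b' : W' ⟶ X₂}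
    (ea' : c' ≫ q₁ = a') (eb' : c' ≫ q₂ = b') (wa : k ≫ a = a') (wb : k ≫ b = b')
    (s : P.sec a) : Φ.eval c' ea' eb' (P.res k wa s) = Q.res k wb (Φ.eval c ea eb s) := by
  subst ea eb ea' eb'
  exact Φ.app_res k hc _

theorem eval_smul (d : gm W) (s : P.sec a) : Φ.eval c ea eb (d • s) = d • Φ.eval c ea eb s := by
  subst ea eb
  exact Φ.app_smul d _

theorem eval_comp (Ψ : Hom (Q.restrict q₂) (R.restrict q₃)) {d : W ⟶ X₃} (ed : c ≫ q₃ = d)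
    (s : P.sec a) : (Φ.comp Ψ).eval c ea ed s = Ψ.eval c eb ed (Φ.eval c ea eb s) := by
  subst ea eb ed
  rfl

/-- The pullback of a morphism between pulled back torsors. -/
noncomputable def pull {V' : Scheme.{u}} [IsLocallyNoetherian V'] (m : V' ⟶ V) {r₁ : V' ⟶ X₁}
    {r₂ : V' ⟶ X₂} (e₁ : m ≫ q₁ = r₁) (e₂ : m ≫ q₂ = r₂) :
    Hom (P.restrict r₁) (Q.restrict r₂) where
  app {W _ c} s := Φ.eval (c ≫ m) (by rw [Category.assoc, e₁]) (by rw [Category.assoc, e₂]) s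
  app_res k c c' w s := Φ.eval_res _ _ _ k (by rw [← w, Category.assoc]) _ _ _ _ s
  app_smul d s := Φ.eval_smul _ _ _ d s

theorem eval_pull {V' : Scheme.{u}} [IsLocallyNoetherian V'] (m : V' ⟶ V) {r₁ : V' ⟶ X₁}
    {r₂ : V' ⟶ X₂} (e₁ : m ≫ q₁ = r₁) (e₂ : m ≫ q₂ = r₂) (c' : W ⟶ V') (hc : c' ≫ m = c)
    (ea' : c' ≫ r₁ = a) (eb' : c' ≫ r₂ = b) (s : P.sec a) :
    (Φ.pull m e₁ e₂).eval c' ea' eb' s = Φ.eval c ea eb s := by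
  subst ea' eb' hc
  rfl

end

end GmTorsor.Hom

section
variable {Z B : Scheme.{u}} {π : Z ⟶ B} {g : B ⟶ Z} (hg : g ≫ π = 𝟙 B)

/-- The section of a base change of `π` induced by a section of `π`. -/
noncomputable def sectionLift {Y : Scheme.{u}} (h : Y ⟶ B) : Y ⟶ pullback π h :=
  pullback.lift (h ≫ g) (𝟙 Y) (by rw [Category.assoc, hg, Category.comp_id, Category.id_comp])

theorem sectionLift_fst {Y : Scheme.{u}} (h : Y ⟶ B) :
    sectionLift hg h ≫ pullback.fst π h = h ≫ g := pullback.lift_fst _ _ _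

theorem sectionLift_snd {Y : Scheme.{u}} (h : Y ⟶ B) :
    sectionLift hg h ≫ pullback.snd π h = 𝟙 Y := pullback.lift_snd _ _ _

theorem comp_sectionLift {Y Y' : Scheme.{u}} (k : Y' ⟶ Y) {h : Y ⟶ B} {h' : Y' ⟶ B}
    (w : k ≫ h = h') : k ≫ sectionLift hg h = sectionLift hg h' ≫ bc π k w := by
  apply pullback.hom_ext
  · rw [Category.assoc, Category.assoc, sectionLift_fst, bc_fst, sectionLift_fst, ← w,
      Category.assoc]
  · rw [Category.assoc, Category.assoc, sectionLift_snd, bc_snd, ← Category.assoc,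
      sectionLift_snd, Category.id_comp, Category.comp_id]

variable (hπ : HasUniversalFunctions π)

include hπ in
/-- A morphism of torsors over a base change of `π` is determined by its effect on one section along
a section of `π`, since the functions on the base change come from the base. -/
theorem GmTorsor.Hom.app_eq_of_sectionLift {Y : Scheme.{u}} [IsLocallyNoetherian Y] {h : Y ⟶ B}
    {P Q : GmTorsor (pullback π h)} (Φ Ψ : GmTorsor.Hom P Q) (s : P.sec (sectionLift hg h))
    (hs : Φ.app s = Ψ.app s) {W : Scheme.{u}} [IsLocallyNoetherian W] {c : W ⟶ pullback π h}
    (t : P.sec c) : Φ.app t = Ψ.app t := by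
  obtain ⟨d, hd⟩ := Φ.exists_twist Ψ
  obtain ⟨e, rfl⟩ := (hπ.bijective_gmMap h).2 d
  have h1 := hd s
  rw [← gmMap_comp, sectionLift_snd, gmMap_id, hs] at h1
  have he : e = 1 := Q.smul_left_cancel (h1.symm.trans (one_smul _ _).symm)
  rw [hd t, he, map_one, map_one, one_smul]

variable [LocallyOfFiniteType π]

include hπ in
theorem GmTorsor.Hom.eval_eq_of_sectionLift {Y : Scheme.{u}} [IsLocallyNoetherian Y] {h : Y ⟶ B}
    {X₁ X₂ : Scheme.{u}} {P : GmTorsor X₁} {Q : GmTorsor X₂} {q₁ : pullback π h ⟶ X₁}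
    {q₂ : pullback π h ⟶ X₂} (Φ Ψ : GmTorsor.Hom (P.restrict q₁) (Q.restrict q₂))
    (s : P.sec (sectionLift hg h ≫ q₁))
    (hs : Φ.eval _ rfl rfl s = Ψ.eval _ rfl rfl s) {W : Scheme.{u}}
    [IsLocallyNoetherian W] (c : W ⟶ pullback π h) {a : W ⟶ X₁} {b : W ⟶ X₂} (ea : c ≫ q₁ = a)
    (eb : c ≫ q₂ = b) (t : P.sec a) : Φ.eval c ea eb t = Ψ.eval c ea eb t := by
  subst ea eb
  exact Φ.app_eq_of_sectionLift hg hπ Ψ s hs (c := c) t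

/-- Two torsors over a base change of `π` in the same class, trivialized along a section of `π`, are
isomorphic by a morphism that respects the trivializations. -/
theorem Represents.exists_hom_sectionLift {Y : Scheme.{u}} [IsLocallyNoetherian Y] {h : Y ⟶ B}
    {P Q : GmTorsor (pullback π h)} {a : Pic (pullback π h)} (hP : Represents a P)
    (hQ : Represents a Q) (s : P.sec (sectionLift hg h)) (t : Q.sec (sectionLift hg h)) :
    ∃ Φ : GmTorsor.Hom P Q, Φ.app s = t := by
  obtain ⟨Φ⟩ := hP.nonempty_hom hQ
  refine ⟨Φ.twist (gmMap (pullback.snd π h) (Q.div t (Φ.app s))), ?_⟩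
  change gmMap (sectionLift hg h) (gmMap _ _) • Φ.app s = t
  rw [← gmMap_comp, sectionLift_snd, gmMap_id, Q.div_smul]

variable [IsLocallyNoetherian Z] {ι : Type u} {U : ι → Scheme.{u}} [∀ i, IsLocallyNoetherian (U i)]
  {k : ∀ i, U i ⟶ B} (hk : IsFppfCover k)

include hπ hk in
/-- Classes in the Picard groups of the base changes of `π` to a covering of the base which are
trivial along a section of `π` and agree on the overlaps are induced by a class on the total
space: isomorphisms on the overlaps that respect trivializations along the section are unique, hence
satisfy the cocycle condition. -/
theorem exists_pic_of_trivial_sectionLift (a : ∀ i, Pic (pullback π (k i)))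
    (ha : ∀ i, Pic.map (sectionLift hg (k i)) (a i) = 1)
    (H : ∀ i j {Y : Scheme.{u}} [IsLocallyNoetherian Y] {h : Y ⟶ B} (p : Y ⟶ U i) (q : Y ⟶ U j)
      (wp : p ≫ k i = h) (wq : q ≫ k j = h), Pic.map (bc π p wp) (a i) = Pic.map (bc π q wq) (a j)) :
    ∃ b : Pic Z, ∀ i, Pic.map (pullback.fst π (k i)) b = a i := by
  have := hk.lfp
  choose P hP using fun i => exists_represents (a i)
  have hτ (i) : Nonempty ((P i).sec (sectionLift hg (k i))) := by
    obtain ⟨s⟩ := ((hP i).restrict (sectionLift hg (k i))).one_iff.1 (ha i)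
    exact ⟨(P i).res (𝟙 _) (by simp) (show (P i).sec (𝟙 _ ≫ sectionLift hg (k i)) from s)⟩
  let τ i := (hτ i).some
  -- the trivialization of `P i` along the section, over a scheme `Y` over the base
  let σ (i) {Y : Scheme.{u}} [IsLocallyNoetherian Y] {h : Y ⟶ B} (p : Y ⟶ U i)
      (wp : p ≫ k i = h) : (P i).sec (sectionLift hg h ≫ bc π p wp) :=
    (P i).res p (comp_sectionLift hg p wp) (τ i)
  have hΘ (i j) : ∃ Θ : GmTorsor.Hom
      ((P i).restrict (bc π (pullback.fst (k i) (k j)) rfl))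
      ((P j).restrict (bc π (pullback.snd (k i) (k j)) pullback.condition.symm)),
      Θ.eval (sectionLift hg _) rfl rfl (σ i _ rfl) = σ j _ pullback.condition.symm :=
    ((hP i).restrict (bc π (pullback.fst (k i) (k j)) rfl)).exists_hom_sectionLift hg
      (by rw [H i j _ _ rfl pullback.condition.symm]; exact (hP j).restrict _) _ _
  choose Θ hΘ using hΘ
  -- the universal morphism to the overlap defined by `a` and `b`
  let c (i j) {W : Scheme.{u}} (a : W ⟶ pullback π (k i)) (b : W ⟶ pullback π (k j))
      (e : a ≫ pullback.fst π (k i) = b ≫ pullback.fst π (k j)) :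
      W ⟶ pullback π (pullback.fst (k i) (k j) ≫ k i) :=
    pullback.lift (a ≫ pullback.fst π (k i)) (pullback.lift (a ≫ pullback.snd π (k i))
      (b ≫ pullback.snd π (k j)) (by
        rw [Category.assoc, Category.assoc, ← pullback.condition, ← pullback.condition,
          ← Category.assoc, e, Category.assoc]))
      (by rw [pullback.lift_fst_assoc, Category.assoc, Category.assoc, pullback.condition])
  have c₁ (i j) {W : Scheme.{u}} (a : W ⟶ pullback π (k i)) (b : W ⟶ pullback π (k j)) (e) :
      c i j a b e ≫ bc π (pullback.fst (k i) (k j)) rfl = a := by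
    apply pullback.hom_ext
    · rw [Category.assoc, bc_fst, pullback.lift_fst]
    · rw [Category.assoc, bc_snd, pullback.lift_snd_assoc, pullback.lift_fst]
  have c₂ (i j) {W : Scheme.{u}} (a : W ⟶ pullback π (k i)) (b : W ⟶ pullback π (k j)) (e) :
      c i j a b e ≫ bc π (pullback.snd (k i) (k j)) pullback.condition.symm = b := by
    apply pullback.hom_ext
    · rw [Category.assoc, bc_fst, pullback.lift_fst, e]
    · rw [Category.assoc, bc_snd, pullback.lift_snd_assoc, pullback.lift_snd]
  have c_res (i j) {W W' : Scheme.{u}} (l : W' ⟶ W) (a : W ⟶ pullback π (k i))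
      (b : W ⟶ pullback π (k j)) (e) {a' b'} (wa : l ≫ a = a') (wb : l ≫ b = b') (e') :
      l ≫ c i j a b e = c i j a' b' e' := by
    subst wa wb
    apply pullback.hom_ext
    · rw [Category.assoc, pullback.lift_fst, pullback.lift_fst, Category.assoc]
    · rw [Category.assoc, pullback.lift_snd, pullback.lift_snd]
      apply pullback.hom_ext
      · rw [Category.assoc, pullback.lift_fst, pullback.lift_fst, Category.assoc]
      · rw [Category.assoc, pullback.lift_snd, pullback.lift_snd, Category.assoc]
  -- over any base `Y`, the pullbacks of `Θ` respect the trivializations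
  have rig (i j) {Y : Scheme.{u}} [IsLocallyNoetherian Y] {h : Y ⟶ B} (p : Y ⟶ U i) (q : Y ⟶ U j)
      (wp : p ≫ k i = h) (wq : q ≫ k j = h) :
      ∃ Ψ : GmTorsor.Hom ((P i).restrict (bc π p wp)) ((P j).restrict (bc π q wq)),
        Ψ.eval (sectionLift hg h) rfl rfl (σ i p wp) = σ j q wq ∧
        ∀ {W : Scheme.{u}} [IsLocallyNoetherian W] (d : W ⟶ pullback π h) {a b}
          (ea : d ≫ bc π p wp = a) (eb : d ≫ bc π q wq = b) (e) (s : (P i).sec a),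
          Ψ.eval d ea eb s = (Θ i j).eval (c i j a b e) (c₁ i j a b e) (c₂ i j a b e) s := by
    let r : Y ⟶ pullback (k i) (k j) := pullback.lift p q (wp.trans wq.symm)
    have r1 : r ≫ pullback.fst (k i) (k j) = p := pullback.lift_fst _ _ _
    have r2 : r ≫ pullback.snd (k i) (k j) = q := pullback.lift_snd _ _ _
    have wr : r ≫ pullback.fst (k i) (k j) ≫ k i = h := by rw [← Category.assoc, r1, wp]
    have e₁ : bc π r wr ≫ bc π (pullback.fst (k i) (k j)) rfl = bc π p wp := by
      rw [bc_comp _ _ _ _ (by rw [r1, wp])]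
      simp only [r1]
    have e₂ : bc π r wr ≫ bc π (pullback.snd (k i) (k j)) pullback.condition.symm =
        bc π q wq := by
      rw [bc_comp _ _ _ _ (by rw [r2, wq])]
      simp only [r2]
    refine ⟨(Θ i j).pull (bc π r wr) e₁ e₂, ?_, fun {W} _ d {a b} ea eb e s => ?_⟩
    · have h1 : sectionLift hg h ≫ bc π r wr = r ≫ sectionLift hg _ :=
        (comp_sectionLift hg r wr).symm
      have h2 : r ≫ sectionLift hg _ ≫ bc π (pullback.fst (k i) (k j)) rfl =
          sectionLift hg h ≫ bc π p wp := by
        rw [← Category.assoc, ← h1, Category.assoc, e₁]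
      have h3 : r ≫ sectionLift hg _ ≫
          bc π (pullback.snd (k i) (k j)) pullback.condition.symm =
          sectionLift hg h ≫ bc π q wq := by
        rw [← Category.assoc, ← h1, Category.assoc, e₂]
      have h4 : σ i p wp = (P i).res r h2 (σ i _ rfl) := by
        refine ((P i).res_congr r1.symm _ ?_ _).trans ((P i).res_res _ _ _ _ _ _).symm
        rw [r1]; exact comp_sectionLift hg p wp
      have h5 : σ j q wq = (P j).res r h3 (σ j _ pullback.condition.symm) := by
        refine ((P j).res_congr r2.symm _ ?_ _).trans ((P j).res_res _ _ _ _ _ _).symm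
        rw [r2]; exact comp_sectionLift hg q wq
      rw [(Θ i j).eval_pull _ _ _ _ _ _ _ h1 _ _ _, h4, h5, ← hΘ i j]
      · exact (Θ i j).eval_res _ rfl rfl r rfl _ _ h2 h3 _
      · rw [← h2, Category.assoc]
      · rw [← h3, Category.assoc]
    · refine (Θ i j).eval_pull _ _ _ _ _ _ _ ?_ _ _ s
      apply pullback.hom_ext
      · rw [Category.assoc, bc_fst, pullback.lift_fst, ← ea, Category.assoc, bc_fst]
      · rw [Category.assoc, bc_snd, pullback.lift_snd]
        apply pullback.hom_ext
        · rw [Category.assoc, Category.assoc, r1, pullback.lift_fst, ← ea, Category.assoc, bc_snd]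
        · rw [Category.assoc, Category.assoc, r2, pullback.lift_snd, ← eb, Category.assoc, bc_snd]
  let D : DescentDatum (fun i => pullback.fst π (k i)) P :=
    { map i j W _ a b e := (Θ i j).eval (c i j a b e) (c₁ i j a b e) (c₂ i j a b e)
      map_res i j W W' _ _ l a b a' b' e wa wb e' s :=
        (Θ i j).eval_res _ _ _ l (c_res i j l a b e wa wb e') _ _ wa wb s
      map_smul i j W _ a b e d s := (Θ i j).eval_smul _ _ _ d s
      map_map i j l W _ x y z e e' s := by
        obtain ⟨h, hh⟩ : ∃ h, (x ≫ pullback.fst π (k i)) ≫ π = h := ⟨_, rfl⟩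
        have wx : (x ≫ pullback.snd π (k i)) ≫ k i = h := by
          rw [← hh, Category.assoc, Category.assoc, pullback.condition]
        have wy : (y ≫ pullback.snd π (k j)) ≫ k j = h := by
          rw [← hh, e, Category.assoc, Category.assoc, pullback.condition]
        have wz : (z ≫ pullback.snd π (k l)) ≫ k l = h := by
          rw [← hh, e, e', Category.assoc, Category.assoc, pullback.condition]
        obtain ⟨Φ, h1, h2⟩ := rig i j _ _ wx wy
        obtain ⟨Ψ, h3, h4⟩ := rig j l _ _ wy wz
        obtain ⟨Ξ, h5, h6⟩ := rig i l _ _ wx wz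
        let d : W ⟶ pullback π h := pullback.lift (x ≫ pullback.fst π (k i)) (𝟙 W)
          (by rw [hh, Category.id_comp])
        have dx : d ≫ bc π _ wx = x := by
          apply pullback.hom_ext
          · rw [Category.assoc, bc_fst, pullback.lift_fst]
          · rw [Category.assoc, bc_snd, pullback.lift_snd_assoc, Category.id_comp]
        have dy : d ≫ bc π _ wy = y := by
          apply pullback.hom_ext
          · rw [Category.assoc, bc_fst, pullback.lift_fst, e]
          · rw [Category.assoc, bc_snd, pullback.lift_snd_assoc, Category.id_comp]
        have dz : d ≫ bc π _ wz = z := by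
          apply pullback.hom_ext
          · rw [Category.assoc, bc_fst, pullback.lift_fst, e, e']
          · rw [Category.assoc, bc_snd, pullback.lift_snd_assoc, Category.id_comp]
        rw [← h2 d dx dy e, ← h4 d dy dz e', ← h6 d dx dz (e.trans e'), ← Φ.eval_comp]
        refine (Φ.comp Ψ).eval_eq_of_sectionLift hg hπ Ξ (σ i _ wx) ?_ d dx dz s
        rw [Φ.eval_comp _ rfl rfl, h1, h3, h5] }
  have hζ := hk.pullback_fst π
  obtain ⟨b, hb⟩ := exists_represented (D.torsor hζ)
  refine ⟨b, fun i => ?_⟩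
  obtain ⟨Φ⟩ := D.nonempty_hom hζ i
  exact ((hb.restrict (pullback.fst π (k i))).of_hom Φ).unique (hP i)

include hg hπ hk in
/-- In the presence of a section, classes in the Picard groups of the base changes of `π` to a
covering of the base which agree on overlaps up to classes from the base are induced, up to classes
from the base, by a class on the total space. -/
theorem exists_pic_of_section (a : ∀ i, Pic (pullback π (k i)))
    (H : ∀ i j {Y : Scheme.{u}} [IsLocallyNoetherian Y] {h : Y ⟶ B} (p : Y ⟶ U i) (q : Y ⟶ U j)
      (wp : p ≫ k i = h) (wq : q ≫ k j = h), ∃ c : Pic Y,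
        Pic.map (bc π p wp) (a i) = Pic.map (bc π q wq) (a j) * Pic.map (pullback.snd π h) c) :
    ∃ b : Pic Z, ∀ i, ∃ c : Pic (U i),
      Pic.map (pullback.fst π (k i)) b = a i * Pic.map (pullback.snd π (k i)) c := by
  have hs {Y : Scheme.{u}} (h : Y ⟶ B) (c : Pic Y) :
      Pic.map (sectionLift hg h) (Pic.map (pullback.snd π h) c) = c := by
    rw [← MonoidHom.comp_apply, ← Pic.map_comp, sectionLift_snd, Pic.map_id, MonoidHom.id_apply]
  let a' i := a i * Pic.map (pullback.snd π (k i)) (Pic.map (sectionLift hg (k i)) (a i))⁻¹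
  have ha' (i) : Pic.map (sectionLift hg (k i)) (a' i) = 1 := by
    rw [map_mul, hs, mul_inv_cancel]
  obtain ⟨b, hb⟩ := exists_pic_of_trivial_sectionLift hg hπ hk a' ha'
    (fun i j Y _ h p q wp wq => by
      have key (i) (p : Y ⟶ U i) (wp : p ≫ k i = h) :
          Pic.map (sectionLift hg h) (Pic.map (bc π p wp) (a' i)) = 1 := by
        rw [← MonoidHom.comp_apply, ← Pic.map_comp, ← comp_sectionLift, Pic.map_comp,
          MonoidHom.comp_apply, ha', map_one]
      have key' (i) (p : Y ⟶ U i) (wp : p ≫ k i = h) : ∃ c : Pic Y,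
          Pic.map (bc π p wp) (a' i) = Pic.map (bc π p wp) (a i) * Pic.map (pullback.snd π h) c := by
        refine ⟨Pic.map p (Pic.map (sectionLift hg (k i)) (a i))⁻¹, ?_⟩
        rw [map_mul, ← MonoidHom.comp_apply (Pic.map (bc π p wp)), ← Pic.map_comp, bc_snd,
          Pic.map_comp, MonoidHom.comp_apply]
      obtain ⟨c, hc⟩ := H i j p q wp wq
      obtain ⟨c₁, h₁⟩ := key' i p wp
      obtain ⟨c₂, h₂⟩ := key' j q wq
      have h3 : Pic.map (bc π p wp) (a' i) =
          Pic.map (bc π q wq) (a' j) * Pic.map (pullback.snd π h) (c * c₁ * c₂⁻¹) := by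
        rw [h₁, h₂, hc, map_mul, map_mul, map_inv]
        generalize Pic.map (pullback.snd π h) c = x, Pic.map (pullback.snd π h) c₁ = y,
          Pic.map (pullback.snd π h) c₂ = z
        rw [mul_assoc, mul_assoc, mul_comm (x * y), mul_inv_cancel_left]
      have h4 := congrArg (Pic.map (sectionLift hg h)) h3
      rw [key, map_mul, key, hs, one_mul] at h4
      rw [h3, ← h4, map_one, mul_one])
  exact ⟨b, fun i => ⟨_, hb i⟩⟩

end

/-! ### Coverings of locally Noetherian schemes over the base -/

section
variable {S : Scheme.{u}}

instance (T : LocNoethOver S) : IsLocallyNoetherian T.obj.left := T.property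

/-- A scheme over a locally Noetherian `S`-scheme, as an object of the site. -/
abbrev LocNoethOver.mk' {T : LocNoethOver S} {Y : Scheme.{u}} [IsLocallyNoetherian Y]
    (k : Y ⟶ T.obj.left) : LocNoethOver S :=
  ⟨Over.mk (k ≫ T.obj.hom), inferInstanceAs (IsLocallyNoetherian Y)⟩

/-- The structure morphism of a scheme over a locally Noetherian `S`-scheme, as a morphism of the
site. -/
abbrev LocNoethOver.homMk' {T : LocNoethOver S} {Y : Scheme.{u}} [IsLocallyNoetherian Y]
    (k : Y ⟶ T.obj.left) : LocNoethOver.mk' k ⟶ T :=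
  ObjectProperty.homMk (Over.homMk k rfl)

/-- A property of morphisms to `T` holds fppf locally if every point of `T` lies in the image of a
flat morphism locally of finite presentation with this property. -/
def FppfLocally (T : LocNoethOver S) (p : ∀ ⦃T' : LocNoethOver S⦄, (T' ⟶ T) → Prop) : Prop :=
  ∀ t : T.obj.left, ∃ (T' : LocNoethOver S) (k : T' ⟶ T), Flat k.hom.left ∧
    LocallyOfFinitePresentation k.hom.left ∧ (∃ t', k.hom.left t' = t) ∧ p k

theorem LocNoethOver.exists_pullback {T T' T'' : LocNoethOver S} (k : T' ⟶ T) (l : T'' ⟶ T)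
    [Flat k.hom.left] [LocallyOfFinitePresentation k.hom.left] {t' : T'.obj.left}
    {t'' : T''.obj.left} (h : l.hom.left t'' = k.hom.left t') :
    ∃ (P : LocNoethOver S) (a : P ⟶ T'') (b : P ⟶ T'), a ≫ l = b ≫ k ∧ Flat a.hom.left ∧
      LocallyOfFinitePresentation a.hom.left ∧ ∃ p, a.hom.left p = t'' := by
  obtain ⟨p, hp, -⟩ := Scheme.Pullback.exists_preimage_pullback t'' t' h
  refine ⟨mk' (pullback.fst l.hom.left k.hom.left), homMk' _,
    ObjectProperty.homMk (Over.homMk (pullback.snd l.hom.left k.hom.left) ?_), ?_,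
    inferInstanceAs (Flat (pullback.fst l.hom.left k.hom.left)),
    inferInstanceAs (LocallyOfFinitePresentation (pullback.fst l.hom.left k.hom.left)), p, hp⟩
  · change _ = pullback.fst l.hom.left k.hom.left ≫ T''.obj.hom
    rw [← Over.w k.hom, ← Over.w l.hom, ← Category.assoc, ← pullback.condition, Category.assoc]
  · exact ObjectProperty.hom_ext _ (Over.OverMorphism.ext pullback.condition)

/-- The members of a covering sieve for the fppf topology cover the target. -/
theorem fppfLocally_of_mem_fppfTopology {T : LocNoethOver S} {R : Sieve T}
    (hR : R ∈ fppfTopology S T) : FppfLocally T (fun _ k => R k) := by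
  induction hR with
  | of T R hR =>
    intro t
    obtain ⟨Y, g, ⟨hk⟩, t', ht'⟩ :=
      (Presieve.mem_comap_jointlySurjectivePrecoverage_iff Scheme.forget).1 hR.1 t
    have h := hR.2 (Presieve.map.of hk)
    exact ⟨_, _, h.1, h.2, ⟨t', ht'⟩, Sieve.le_generate _ _ _ hk⟩
  | top T =>
    exact fun t => ⟨T, 𝟙 T, inferInstanceAs (Flat (𝟙 T.obj.left)),
      inferInstanceAs (LocallyOfFinitePresentation (𝟙 T.obj.left)), ⟨t, rfl⟩, trivial⟩
  | pullback T R _ T'' l ih =>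
    intro t''
    obtain ⟨T', k, h1, h2, ⟨t', ht'⟩, hk⟩ := ih (l.hom.left t'')
    obtain ⟨P, a, b, e, h3, h4, h5⟩ := LocNoethOver.exists_pullback k l ht'.symm
    refine ⟨P, a, h3, h4, h5, ?_⟩
    change R (a ≫ l)
    rw [e]
    exact R.downward_closed hk b
  | transitive T R R' _ _ ih ih' =>
    intro t
    obtain ⟨T', k, h1, h2, ⟨t', ht'⟩, hk⟩ := ih t
    obtain ⟨T'', l, h3, h4, ⟨t'', ht''⟩, hl⟩ := ih' hk t'
    refine ⟨T'', l ≫ k, inferInstanceAs (Flat (l.hom.left ≫ k.hom.left)),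
      inferInstanceAs (LocallyOfFinitePresentation (l.hom.left ≫ k.hom.left)), ⟨t'', ?_⟩, hl⟩
    change (l.hom.left ≫ k.hom.left) t'' = t
    rw [Scheme.Hom.comp_apply, ht'', ht']

variable {X : Scheme.{u}} (f : X ⟶ S)

/-- The sieve of the `S`-schemes over `T` with a lift to `X`. -/
def liftSieve (T : LocNoethOver S) : Sieve T where
  arrows T' _ := ∃ g : T'.obj.left ⟶ X, g ≫ f = T'.obj.hom
  downward_closed := by
    rintro T' T'' _ ⟨g, hg⟩ l
    exact ⟨l.hom.left ≫ g, by rw [Category.assoc, hg, Over.w]⟩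

/-- If `f` has a section over a covering of `S` by morphisms with a property stable under base
change, then every `T` has a covering by such morphisms whose members lift to `X`. -/
theorem liftSieve_mem (P : MorphismProperty Scheme.{u}) [P.IsStableUnderBaseChange]
    (hP : ∀ {U V : Scheme.{u}} (p : U ⟶ V), P p → LocallyOfFiniteType p)
    (h : HasSectionLocally f (Scheme.precoverage P)) (T : LocNoethOver S) :
    liftSieve f T ∈
      ((Scheme.precoverage P).comap (LocNoethOver.toScheme S)).toGrothendieck T := by
  obtain ⟨𝒰, h𝒰, hg⟩ := h
  let R : Presieve T := fun T' k => liftSieve f T k ∧ P k.hom.left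
  have hR : R ∈ ((Scheme.precoverage P).comap (LocNoethOver.toScheme S)) T := by
    refine ⟨(Presieve.mem_comap_jointlySurjectivePrecoverage_iff Scheme.forget).2 fun t => ?_, ?_⟩
    · obtain ⟨U, p, hp, x, hx⟩ :=
        (Presieve.mem_comap_jointlySurjectivePrecoverage_iff Scheme.forget).1 h𝒰.1 (T.obj.hom t)
      have hPp : P p := h𝒰.2 hp
      have := hP p hPp
      obtain ⟨y, hy, -⟩ := Scheme.Pullback.exists_preimage_pullback t x hx.symm
      obtain ⟨g, hgp⟩ := hg p hp
      refine ⟨_, _, Presieve.map.of (F := LocNoethOver.toScheme S)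
        (u := LocNoethOver.homMk' (pullback.fst T.obj.hom p)) ⟨⟨pullback.snd T.obj.hom p ≫ g, ?_⟩,
          P.pullback_fst _ _ hPp⟩, y, hy⟩
      rw [Category.assoc, hgp, ← pullback.condition]
      rfl
    · rintro Y _ ⟨hk⟩
      exact hk.2
  exact GrothendieckTopology.superset_covering _
    ((Sieve.generate_le_iff _ _).2 fun _ _ hk => hk.1)
    (Precoverage.generate_mem_toGrothendieck hR)

end

/-! ### Comparison of sheafifications -/

section
variable {C : Type (u + 1)} [Category.{u} C] {F : Cᵒᵖ ⥤ AddCommGrpCat.{u + 1}}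
  {J K : GrothendieckTopology C}

/-- A separated presheaf embeds into its associated sheaf. -/
theorem injective_toSheafify_app (h : ∀ T : C, ∀ R ∈ K T, ∀ x y : F.obj (op T),
      (∀ ⦃T' : C⦄ (k : T' ⟶ T), R k → F.map k.op x = F.map k.op y) → x = y) (T : Cᵒᵖ) :
    Function.Injective ((toSheafify K F).app T) := fun x y hxy =>
  h T.unop _ (Presheaf.equalizerSieve_mem K (toSheafify K F) x y hxy) x y fun _ _ hk => hk

/-- If `F` embeds into its associated sheaf for `K`, so does its associated sheaf for a coarser
topology `J`: the comparison map is locally injective for `J`, as both come from `F`. -/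
theorem injective_sheafifyLift_app (hJ : Presheaf.IsSheaf J (sheafify K F))
    (h : ∀ T, Function.Injective ((toSheafify K F).app T)) (T : Cᵒᵖ) :
    Function.Injective ((sheafifyLift J (toSheafify K F) hJ).app T) := by
  have := Presheaf.isLocallyInjective_of_injective J _ h
  have h1 : Presheaf.IsLocallyInjective J (sheafifyLift J (toSheafify K F) hJ) :=
    Presheaf.isLocallyInjective_of_isLocallyInjective_of_isLocallySurjective_fac J _
      (toSheafify_sheafifyLift J (toSheafify K F) hJ)
  let φ : (presheafToSheaf J AddCommGrpCat.{u + 1}).obj F ⟶ ⟨sheafify K F, hJ⟩ :=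
    ⟨sheafifyLift J (toSheafify K F) hJ⟩
  exact (Sheaf.isLocallyInjective_iff_injective φ).1 h1 T

/-- If moreover the sections of the associated sheaf for `K` come `J`-locally from `F`, then the two
associated sheaves agree. -/
theorem isIso_sheafifyLift (hJ : Presheaf.IsSheaf J (sheafify K F))
    (h : ∀ T, Function.Injective ((toSheafify K F).app T))
    (h' : Presheaf.IsLocallySurjective J (toSheafify K F)) :
    IsIso (sheafifyLift J (toSheafify K F) hJ) := by
  have h1 : Presheaf.IsLocallySurjective J (sheafifyLift J (toSheafify K F) hJ) :=
    Presheaf.isLocallySurjective_of_isLocallySurjective_fac J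
      (toSheafify_sheafifyLift J (toSheafify K F) hJ)
  have h2 := Presheaf.isLocallyInjective_of_injective J _ (injective_sheafifyLift_app hJ h)
  let φ : (presheafToSheaf J AddCommGrpCat.{u + 1}).obj F ⟶ ⟨sheafify K F, hJ⟩ :=
    ⟨sheafifyLift J (toSheafify K F) hJ⟩
  have h3 : IsIso φ := (Sheaf.isLocallyBijective_iff_isIso φ).1 ⟨h2, h1⟩
  exact inferInstanceAs (IsIso ((sheafToPresheaf J AddCommGrpCat.{u + 1}).map φ))

end

/-! ### Separatedness and gluing for the relative Picard functor -/

section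
variable {S X : Scheme.{u}} {f : X ⟶ S}

theorem hasUniversalFunctions_pullback_snd (hf : UniversallyComorphismIso f) (T : LocNoethOver S) :
    HasUniversalFunctions (pullback.snd f T.obj.hom) := by
  intro Y _ h
  have h1 : IsIso (pullback.snd f (h ≫ T.obj.hom)).appTop :=
    @NatIso.isIso_app_of_isIso _ _ _ _ _ _ (pullback.snd f (h ≫ T.obj.hom)).c
      (hf (LocNoethOver.mk' h)) (op ⊤)
  have h2 : IsIso (pullback.snd (pullback.snd f T.obj.hom) h).appTop := by
    rw [← pullbackLeftPullbackSndIso_hom_snd f T.obj.hom h, Scheme.Hom.comp_appTop]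
    have h3 : IsIso (pullbackLeftPullbackSndIso f T.obj.hom h).hom.appTop :=
      inferInstanceAs (IsIso ((pullbackLeftPullbackSndIso f T.obj.hom h).hom.app ⊤))
    exact IsIso.comp_isIso
  exact (ConcreteCategory.isIso_iff_bijective _).1 h2

variable (f) in
/-- The identification of `X_T ×_T T'` with `X_{T'}`, for a morphism `T' ⟶ T` of `S`-schemes. -/
noncomputable def baseChangeIso {T' T : Over S} (k : T' ⟶ T) :
    pullback (pullback.snd f T.hom) k.left ≅ pullback f T'.hom :=
  (isPullback_bc (π := f) k.left (Over.w k)).isoPullback.symm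

theorem baseChangeIso_hom_baseChangeMap {T' T : Over S} (k : T' ⟶ T) :
    (baseChangeIso f k).hom ≫ baseChangeMap f k = pullback.fst _ _ :=
  (isPullback_bc (π := f) k.left (Over.w k)).isoPullback_inv_fst

theorem baseChangeIso_hom_snd {T' T : Over S} (k : T' ⟶ T) :
    (baseChangeIso f k).hom ≫ pullback.snd f T'.hom = pullback.snd _ _ :=
  (isPullback_bc (π := f) k.left (Over.w k)).isoPullback_inv_snd

theorem bc_baseChangeIso_hom {T T' T'' : Over S} (k : T' ⟶ T) (l : T'' ⟶ T) (p : T'' ⟶ T')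
    (w : p ≫ k = l) (w' : p.left ≫ k.left = l.left) :
    bc (pullback.snd f T.hom) p.left w' ≫ (baseChangeIso f k).hom =
      (baseChangeIso f l).hom ≫ baseChangeMap f p := by
  refine (isPullback_bc (π := f) k.left (Over.w k)).hom_ext ?_ ?_
  · change (_ ≫ _) ≫ baseChangeMap f k = (_ ≫ _) ≫ baseChangeMap f k
    rw [Category.assoc, Category.assoc, baseChangeIso_hom_baseChangeMap, bc_fst,
      ← baseChangeMap_comp, w, baseChangeIso_hom_baseChangeMap]
  · rw [Category.assoc, Category.assoc, baseChangeIso_hom_snd, baseChangeMap_snd, bc_snd,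
      ← Category.assoc, baseChangeIso_hom_snd]

theorem picMap_map {Y Z W : Scheme.{u}} {k : Z ⟶ Y} {l : W ⟶ Z} {m : W ⟶ Y} (w : l ≫ k = m)
    (a : Pic Y) : Pic.map l (Pic.map k a) = Pic.map m a := by
  rw [← w, Pic.map_comp, MonoidHom.comp_apply]

theorem injective_picMap_hom {Y Z : Scheme.{u}} (e : Z ≅ Y) :
    Function.Injective (Pic.map e.hom) := by
  refine Function.LeftInverse.injective (g := Pic.map e.inv) fun a => ?_
  rw [picMap_map e.inv_hom_id, Pic.map_id, MonoidHom.id_apply]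

variable {T T' : LocNoethOver S}

/-- The class in the relative Picard functor of a class in the Picard group of `X_T`. -/
noncomputable def relPicMk (a : Pic (pullback f T.obj.hom)) : (relPicFunctor f).obj (op T) :=
  Additive.ofMul (QuotientGroup.mk a)

theorem relPicMk_surjective (x : (relPicFunctor f).obj (op T)) : ∃ a, relPicMk a = x :=
  QuotientGroup.mk_surjective (Additive.toMul x)

theorem relPicMk_eq_iff {a b : Pic (pullback f T.obj.hom)} :
    (relPicMk a : (relPicFunctor f).obj (op T)) = relPicMk b ↔
      ∃ c, a = b * Pic.map (pullback.snd f T.obj.hom) c := by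
  refine (eq_comm.trans (QuotientGroup.eq (a := b) (b := a))).trans ?_
  exact ⟨fun ⟨c, hc⟩ => ⟨c, by rw [hc, mul_inv_cancel_left]⟩,
    fun ⟨c, hc⟩ => ⟨c, by rw [hc, inv_mul_cancel_left]⟩⟩

theorem map_relPicMk (k : T' ⟶ T) (a : Pic (pullback f T.obj.hom)) :
    (relPicFunctor f).map k.op (relPicMk a) = relPicMk (Pic.map (baseChangeMap f k.hom) a) := rfl

theorem map_relPicMk_eq_iff (k : T' ⟶ T) {a : Pic (pullback f T.obj.hom)}
    {b : Pic (pullback f T'.obj.hom)} : (relPicFunctor f).map k.op (relPicMk a) = relPicMk b ↔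
      ∃ c, Pic.map (pullback.fst (pullback.snd f T.obj.hom) k.hom.left) a =
        Pic.map (baseChangeIso f k.hom).hom b *
          Pic.map (pullback.snd (pullback.snd f T.obj.hom) k.hom.left) c := by
  rw [map_relPicMk, relPicMk_eq_iff]
  refine exists_congr fun c => ?_
  rw [← (injective_picMap_hom (baseChangeIso f k.hom)).eq_iff, map_mul,
    picMap_map (baseChangeIso_hom_baseChangeMap k.hom), picMap_map (baseChangeIso_hom_snd k.hom)]

variable [LocallyOfFiniteType f] (hf : UniversallyComorphismIso f)

include hf in
/-- The relative Picard functor is separated for the fppf topology. -/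
theorem relPic_ext (x y : (relPicFunctor f).obj (op T))
    (H : FppfLocally T fun _ k => (relPicFunctor f).map k.op x = (relPicFunctor f).map k.op y) :
    x = y := by
  obtain ⟨a, rfl⟩ := relPicMk_surjective x
  obtain ⟨b, rfl⟩ := relPicMk_surjective y
  obtain ⟨c, hc⟩ := mem_range_picMap_of_locally (hasUniversalFunctions_pullback_snd hf T) (a / b)
    fun t => by
      obtain ⟨T', k, h1, h2, ⟨t', ht'⟩, h⟩ := H t
      refine ⟨_, T'.property, k.hom.left, h1, h2, t', ht', ?_⟩
      rw [map_relPicMk k b, map_relPicMk_eq_iff,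
        picMap_map (baseChangeIso_hom_baseChangeMap k.hom)] at h
      obtain ⟨c, hc⟩ := h
      exact ⟨c, by rw [map_div, hc, mul_div_cancel_left]⟩
  exact relPicMk_eq_iff.2 ⟨c, by rw [hc, mul_div_cancel]⟩

variable {K : GrothendieckTopology (LocNoethOver S)} (hK : K ≤ fppfTopology S)

include hf hK in
theorem injective_toSheafify_relPicFunctor (T) :
    Function.Injective ((toSheafify K (relPicFunctor f)).app T) :=
  injective_toSheafify_app (fun T R hR x y h => relPic_ext hf x y fun t => by
    obtain ⟨T', k, h1, h2, h3, hk⟩ := fppfLocally_of_mem_fppfTopology (hK _ hR) t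
    exact ⟨T', k, h1, h2, h3, h k hk⟩) T

include hf hK in
/-- If `X_T ⟶ T` has a section, then the sections over `T` of a sheaf associated to the relative
Picard functor come from the relative Picard functor. -/
theorem surjective_toSheafify_relPicFunctor {g : T.obj.left ⟶ X} (hg : g ≫ f = T.obj.hom) :
    Function.Surjective ((toSheafify K (relPicFunctor f)).app (op T)) := by
  intro y
  set η := toSheafify K (relPicFunctor f) with hη
  have hinj := injective_toSheafify_relPicFunctor hf hK
  have nat {T₁ T₂ : LocNoethOver S} (k : T₂ ⟶ T₁) (x : (relPicFunctor f).obj (op T₁)) :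
      η.app (op T₂) ((relPicFunctor f).map k.op x) =
        (sheafify K (relPicFunctor f)).map k.op (η.app (op T₁) x) :=
    NatTrans.naturality_apply η k.op x
  have map_map {T₁ T₂ T₃ : LocNoethOver S} (k : T₂ ⟶ T₁) (l : T₃ ⟶ T₂)
      (z : (sheafify K (relPicFunctor f)).obj (op T₁)) :
      (sheafify K (relPicFunctor f)).map l.op ((sheafify K (relPicFunctor f)).map k.op z) =
        (sheafify K (relPicFunctor f)).map (l ≫ k).op z := by
    rw [op_comp, Functor.map_comp, ConcreteCategory.comp_apply]
  -- local lifts of `y` agree wherever they are both defined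
  have compat {T₁ T₂ T₃ : LocNoethOver S} {k₁ : T₁ ⟶ T} {k₂ : T₂ ⟶ T}
      {x₁ : (relPicFunctor f).obj (op T₁)} {x₂ : (relPicFunctor f).obj (op T₂)}
      (h₁ : η.app (op T₁) x₁ = (sheafify K (relPicFunctor f)).map k₁.op y)
      (h₂ : η.app (op T₂) x₂ = (sheafify K (relPicFunctor f)).map k₂.op y) (p : T₃ ⟶ T₁)
      (q : T₃ ⟶ T₂) (e : p ≫ k₁ = q ≫ k₂) :
      (relPicFunctor f).map p.op x₁ = (relPicFunctor f).map q.op x₂ := by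
    apply hinj (op T₃)
    rw [← hη, nat, nat, h₁, h₂, map_map, map_map, e]
  have hloc := Presheaf.imageSieve_mem K η (U := op T) y
  have hloc' := fppfLocally_of_mem_fppfTopology (hK _ hloc)
  unfold FppfLocally at hloc'
  choose T' k hk₁ hk₂ hT' hk using hloc'
  choose t' ht' using hT'
  choose x hx using hk
  choose a ha using fun t => relPicMk_surjective (x t)
  -- the section of `X_T ⟶ T` along which the local representatives are rigidified
  let s : T.obj.left ⟶ pullback f T.obj.hom :=
    pullback.lift g (𝟙 _) (by rw [hg, Category.id_comp])
  obtain ⟨b, hb⟩ := exists_pic_of_section (π := pullback.snd f T.obj.hom) (g := s)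
    (pullback.lift_snd _ _ _)
    (hasUniversalFunctions_pullback_snd hf T) (k := fun t => (k t).hom.left)
    ⟨hk₁, hk₂, fun t => ⟨t, t' t, ht' t⟩⟩
    (fun t => Pic.map (baseChangeIso f (k t).hom).hom (a t)) (fun i j Y _ h p q wp wq => by
      let Y' := LocNoethOver.mk' (T := T) h
      let p' : Y' ⟶ T' i := ObjectProperty.homMk (Over.homMk p (by
        rw [← Over.w (k i).hom, ← Category.assoc, wp]; rfl))
      let q' : Y' ⟶ T' j := ObjectProperty.homMk (Over.homMk q (by
        rw [← Over.w (k j).hom, ← Category.assoc, wq]; rfl))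
      have e : p' ≫ k i = q' ≫ k j :=
        ObjectProperty.hom_ext _ (Over.OverMorphism.ext (wp.trans wq.symm))
      have h1 := compat (hx i) (hx j) p' q' e
      rw [← ha, ← ha, map_relPicMk, map_relPicMk, relPicMk_eq_iff] at h1
      obtain ⟨c, hc⟩ := h1
      have hi := bc_baseChangeIso_hom (f := f) (k i).hom (LocNoethOver.homMk' h).hom p'.hom
        (Over.OverMorphism.ext wp) wp
      have hj := bc_baseChangeIso_hom (f := f) (k j).hom (LocNoethOver.homMk' h).hom q'.hom
        (Over.OverMorphism.ext wq) wq
      refine ⟨c, (picMap_map hi (a i)).trans ((picMap_map rfl (a i)).symm.trans ?_)⟩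
      refine Eq.trans ?_ (congrArg (· * _) ((picMap_map rfl (a j)).trans
        (picMap_map hj (a j)).symm))
      rw [hc, map_mul, picMap_map (baseChangeIso_hom_snd _)]
      rfl)
  refine ⟨relPicMk b, ?_⟩
  have hbx (t) : (relPicFunctor f).map (k t).op (relPicMk b) = x t := by
    rw [← ha, map_relPicMk_eq_iff]
    exact hb t
  have hsep := (((presheafToSheaf K AddCommGrpCat.{u + 1}).obj (relPicFunctor f)).2)
  have hsep' := ((Presheaf.isSheaf_iff_isSheaf_forget K _ (forget AddCommGrpCat.{u + 1})).1 hsep)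
  -- the sieve of local lifts of `y` may be larger than the chosen covering, so the class of `b` is
  -- compared with such a lift over a common refinement, by separatedness
  refine ((isSheaf_iff_isSheaf_of_type _ _).1 hsep').isSeparated _ hloc |>.ext fun T₁ l hl => ?_
  obtain ⟨z, hz⟩ := hl
  refine Eq.trans ?_ hz
  refine (nat l _).symm.trans (congrArg _ (relPic_ext hf _ _ fun t₁ => ?_))
  obtain ⟨P, c, d, e, h1, h2, h3⟩ := @LocNoethOver.exists_pullback _ _ _ _ (k (l.hom.left t₁)) l
    (hk₁ _) (hk₂ _) _ _ (ht' (l.hom.left t₁)).symm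
  refine ⟨P, c, h1, h2, h3, ?_⟩
  refine Eq.trans ?_ (compat hz (hx (l.hom.left t₁)) c d e).symm
  rw [← hbx, ← ConcreteCategory.comp_apply,
    ← ConcreteCategory.comp_apply, ← Functor.map_comp, ← Functor.map_comp, ← op_comp, ← op_comp, e]

include hf hK in
/-- If `f` has a section locally, the sections of an associated sheaf for a finer topology come locally
from the relative Picard functor. -/
theorem isLocallySurjective_toSheafify_relPicFunctor {J : GrothendieckTopology (LocNoethOver S)}
    (h : ∀ T, liftSieve f T ∈ J T) :
    Presheaf.IsLocallySurjective J (toSheafify K (relPicFunctor f)) where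
  imageSieve_mem {T} y := by
    refine J.superset_covering (fun T' k hk => ?_) (h T)
    obtain ⟨g, hg⟩ := hk
    exact surjective_toSheafify_relPicFunctor hf hK hg _

end

end PicardFunctor

theorem theorem2 {S X : Scheme.{u}} [IsLocallyNoetherian S] (f : X ⟶ S)
    [IsSeparated f] [LocallyOfFiniteType f] [QuasiCompact f]
    (hf : PicardFunctor.UniversallyComorphismIso f) :
    ((∀ T, Function.Injective ((PicardFunctor.toPicZar f).app T)) ∧
      (∀ T, Function.Injective ((PicardFunctor.picZarToPicEt f).app T)) ∧
      (∀ T, Function.Injective ((PicardFunctor.picEtToPicFppf f).app T))) ∧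
    (PicardFunctor.HasSection f →
      IsIso (PicardFunctor.toPicZar f) ∧ IsIso (PicardFunctor.picZarToPicEt f) ∧
        IsIso (PicardFunctor.picEtToPicFppf f)) ∧
    (PicardFunctor.HasSectionLocally f Scheme.zariskiPrecoverage →
      IsIso (PicardFunctor.picZarToPicEt f) ∧ IsIso (PicardFunctor.picEtToPicFppf f)) ∧
    (PicardFunctor.HasSectionLocally f Scheme.etalePrecoverage →
      IsIso (PicardFunctor.picEtToPicFppf f)) := by
  open PicardFunctor in
  have het := etaleTopology_le_fppfTopology (S := S)
  have hzar := zariskiTopology_le_etaleTopology (S := S)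
  have inj {K : GrothendieckTopology (LocNoethOver S)} (hK : K ≤ fppfTopology S) :=
    injective_toSheafify_relPicFunctor hf hK
  have surj {J K : GrothendieckTopology (LocNoethOver S)} (hK : K ≤ fppfTopology S)
      (h : ∀ T, liftSieve f T ∈ J T) :=
    isLocallySurjective_toSheafify_relPicFunctor hf hK h
  have isoFppf (h : ∀ T, liftSieve f T ∈ etaleTopology S T) : IsIso (picEtToPicFppf f) :=
    isIso_sheafifyLift _ (inj le_rfl) (surj le_rfl h)
  have isoEt (h : ∀ T, liftSieve f T ∈ zariskiTopology S T) : IsIso (picZarToPicEt f) :=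
    isIso_sheafifyLift _ (inj het) (surj het h)
  refine ⟨⟨inj (hzar.trans het), injective_sheafifyLift_app _ (inj het),
    injective_sheafifyLift_app _ (inj le_rfl)⟩, fun ⟨g, hg⟩ => ?_, fun h => ?_, fun h => ?_⟩
  · have lift (T : LocNoethOver S) : (T.obj.hom ≫ g) ≫ f = T.obj.hom := by
      rw [Category.assoc, hg, Category.comp_id]
    have h (J : GrothendieckTopology (LocNoethOver S)) (T) : liftSieve f T ∈ J T := by
      convert J.top_mem T
      ext T' k
      exact ⟨fun _ => trivial, fun _ => ⟨_, lift T'⟩⟩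
    refine ⟨?_, isoEt (h _), isoFppf (h _)⟩
    have iso (T) : IsIso ((toPicZar f).app T) := (ConcreteCategory.isIso_iff_bijective _).2
      ⟨inj (hzar.trans het) T,
        surjective_toSheafify_relPicFunctor hf (hzar.trans het) (lift T.unop)⟩
    exact NatIso.isIso_of_isIso_app _
  · have h' := liftSieve_mem f @IsOpenImmersion (fun _ _ => inferInstance) h
    exact ⟨isoEt h', isoFppf fun T => hzar _ (h' T)⟩
  · exact isoFppf (liftSieve_mem f @Etale (fun _ _ => inferInstance) h)
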